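/- Let $P\subset\mathbb{R}^3$ be a $3$-dimensional convex polytope with $n$ vertices and $m$ facets, labeled by $1,\dots,n$ and $1,\dots,m$ respectively. Let $f_i(P)$ be the number of $i$-dimensional faces of $P$, let $f_{0,2}(P)$ be the number of vertex-facet incidences, and put $\mathrm{NG}(P):=3\,(f_0(P)+f_2(P))-f_{0,2}(P)$. Let the centered realization space $\mathrm{RC}(P)\subset\mathbb{R}^{3\times(n+m)}$ be the set of all pairs of matrices $(V,A)$ with columns $v_1,\dots,v_n$ and $a_1,\dots,a_m$ in $\mathbb{R}^3$ such that $Q:=\mathrm{conv}(v_1,\dots,v_n)=\{x\in\mathbb{R}^3 : A^t x\le \mathbf 1\}$ is a $3$-polytope with the origin in its interior, with vertices $v_1,\dots,v_n$ and facets $\{x\in Q : a_j^t x=1\}$ $(1\le j\le m)$, and there is an isomorphism between the face lattices of $P$ and $Q$ that respects these labelings of the vertices and of the facets. Then $\mathrm{RC}(P)$ is a (nonempty, smoothly embedded) smooth manifold of dimension $\mathrm{NG}(P)=f_1(P)+6$. -/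

import Mathlib

open scoped Manifold ContDiff

noncomputable section

namespace Polytopes

/-- Dimension of a face: the dimension of its affine hull, with `dim ∅ = -1`. -/
def faceDim {d : ℕ} (F : Set (EuclideanSpace ℝ (Fin d))) : ℤ :=
  open Classical in if F.Nonempty then (Module.finrank ℝ (vectorSpan ℝ F) : ℤ) else -1

/-- `P` is a `d`-polytope in `ℝ^d`: the convex hull of a finite set, of dimension `d`. -/
def IsFullPolytope {d : ℕ} (P : Set (EuclideanSpace ℝ (Fin d))) : Prop :=
  (∃ S : Set (EuclideanSpace ℝ (Fin d)), S.Finite ∧ P = convexHull ℝ S) ∧ faceDim P = d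

/-- The faces of `P`: the sets of maximizers over `P` of a linear functional (the zero functional
gives `P` itself), together with the empty face. -/
def faces {d : ℕ} (P : Set (EuclideanSpace ℝ (Fin d))) :
    Set (Set (EuclideanSpace ℝ (Fin d))) :=
  {F | IsExposed ℝ P F}

/-- The faces of `P` of dimension `k`. Vertices are the faces of dimension `0` (as singletons),
edges those of dimension `1`, facets those of dimension `d - 1`. -/
def facesOfDim {d : ℕ} (P : Set (EuclideanSpace ℝ (Fin d))) (k : ℤ) :
    Set (Set (EuclideanSpace ℝ (Fin d))) :=
  {F ∈ faces P | faceDim F = k}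

/-- `f_k(P)`, the number of `k`-dimensional faces. -/
def fNum {d : ℕ} (P : Set (EuclideanSpace ℝ (Fin d))) (k : ℤ) : ℕ :=
  (facesOfDim P k).ncard

/-- `f_{k,l}(P)`, the number of incidences between `k`-faces and `l`-faces. -/
def flagNum {d : ℕ} (P : Set (EuclideanSpace ℝ (Fin d))) (k l : ℤ) : ℕ :=
  {p : Set (EuclideanSpace ℝ (Fin d)) × Set (EuclideanSpace ℝ (Fin d)) |
    p.1 ∈ facesOfDim P k ∧ p.2 ∈ facesOfDim P l ∧ p.1 ⊆ p.2}.ncard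

/-- The natural guess `NG(P) = d (f_0 + f_{d-1}) - f_{0,d-1}`. -/
def naturalGuess {d : ℕ} (P : Set (EuclideanSpace ℝ (Fin d))) : ℤ :=
  d * ((fNum P 0 : ℤ) + fNum P (d - 1)) - flagNum P 0 (d - 1)

/-- A `d`-polytope in `ℝ^d` whose vertices and facets are labeled bijectively by
`Fin n` and `Fin m`. -/
structure LabeledPolytope (d n m : ℕ) where
  carrier : Set (EuclideanSpace ℝ (Fin d))
  isFullPolytope : IsFullPolytope carrier
  vertex : Fin n → EuclideanSpace ℝ (Fin d)
  vertex_injective : Function.Injective vertex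
  range_vertex :
    (Set.range fun i => ({vertex i} : Set (EuclideanSpace ℝ (Fin d)))) = facesOfDim carrier 0
  facet : Fin m → Set (EuclideanSpace ℝ (Fin d))
  facet_injective : Function.Injective facet
  range_facet : Set.range facet = facesOfDim carrier (d - 1)

namespace LabeledPolytope

variable {d n m : ℕ}

/-- The face lattice: all faces ordered by inclusion. -/
abbrev FaceLattice (P : LabeledPolytope d n m) : Type := faces P.carrier

/-- The vertex with label `i`, as an element of the face lattice. -/
def vertexFace (P : LabeledPolytope d n m) (i : Fin n) : P.FaceLattice :=
  ⟨{P.vertex i}, (P.range_vertex.subset ⟨i, rfl⟩).1⟩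

/-- The facet with label `j`, as an element of the face lattice. -/
def facetFace (P : LabeledPolytope d n m) (j : Fin m) : P.FaceLattice :=
  ⟨P.facet j, (P.range_facet.subset ⟨j, rfl⟩).1⟩

/-- `Q` realizes `P`: there is an isomorphism of face lattices which respects the labels of
the vertices and of the facets. -/
def Realizes (Q P : LabeledPolytope d n m) : Prop :=
  ∃ φ : P.FaceLattice ≃o Q.FaceLattice,
    (∀ i, φ (P.vertexFace i) = Q.vertexFace i) ∧ ∀ j, φ (P.facetFace j) = Q.facetFace j

/-- `Q` contains the origin in its interior. -/
def IsCentered (Q : LabeledPolytope d n m) : Prop :=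
  (0 : EuclideanSpace ℝ (Fin d)) ∈ interior Q.carrier

/-- `(V, A)`, given by the columns of the two matrices, is the combined vertex and facet
description of the labeled polytope `Q`: `Q = conv V = {x | Aᵗ x ≤ 1}`, where the `i`-th column of
`V` is the vertex with label `i` and the `j`-th inequality defines the facet with label `j`. -/
def IsDescribedBy (Q : LabeledPolytope d n m)
    (V : Fin n → EuclideanSpace ℝ (Fin d)) (A : Fin m → EuclideanSpace ℝ (Fin d)) : Prop :=
  Q.carrier = convexHull ℝ (Set.range V) ∧
  Q.carrier = {x | ∀ j, inner ℝ (A j) x ≤ 1} ∧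
  (∀ i, Q.vertex i = V i) ∧
  ∀ j, Q.facet j = {x ∈ Q.carrier | inner ℝ (A j) x = 1}

/-- The centered realization space `RC(P) ⊆ ℝ^{d × (n + m)}`: all combined vertex and facet
descriptions of centered realizations of `P`. -/
def centeredRealizationSpace (P : LabeledPolytope d n m) :
    Set ((Fin n → EuclideanSpace ℝ (Fin d)) × (Fin m → EuclideanSpace ℝ (Fin d))) :=
  {p | ∃ Q : LabeledPolytope d n m, Q.IsCentered ∧ Q.Realizes P ∧ Q.IsDescribedBy p.1 p.2}

end LabeledPolytope

/-- `S` is a (smoothly embedded) smooth manifold of dimension `k` in the normed space `E`: the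
subspace `S` carries a `k`-dimensional smooth structure, compatible with the subspace topology, for
which the inclusion into `E` is a smooth embedding. -/
def IsSmoothSubmanifold {E : Type*} [NormedAddCommGroup E] [NormedSpace ℝ E]
    (S : Set E) (k : ℕ) : Prop :=
  ∃ _ : ChartedSpace (EuclideanSpace ℝ (Fin k)) S,
    IsManifold (𝓡 k) ∞ S ∧
    Manifold.IsSmoothEmbedding (𝓡 k) 𝓘(ℝ, E) ∞ (Subtype.val : S → E)

end Polytopes

end

/-!
The proof rests on a description of `RC(P)` by equations alone. A centered realization is a pair
`(V, A)` with `conv V = {x | Aᵗ x ≤ 1}` in which `⟪A j, V i⟫ = 1` holds exactly for the incidences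
of `P`; such pairs are called polar pairs here. Since faces are determined by the vertices they
contain, and these vertex sets can be read off from the incidences, every polar pair with the
right incidences has the right face lattice (`LabeledPolytope.mem_centeredRealizationSpace_iff`).
A translation moves the origin into the interior of `P`, and polarity provides the facet normals,
so `RC(P)` is nonempty (`LabeledPolytope.exists_realization`). By compactness, a small
perturbation of a polar pair which still satisfies the equations `⟪A j, V i⟫ = 1`, one for each
incidence, is a polar pair with the same incidences (`IsPolarPair.eventually`). Hence `RC(P)` is
locally the solution set of `f₀₂` quadratic equations in `3 (f₀ + f₂)` unknowns, and it remains to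
see that their differentials are independent.

A linear relation between the differentials at `(V, A)` assigns a weight to every incidence such
that at every vertex the weighted normals sum to zero, and at every facet the weighted vertices
sum to zero. A nontrivial dependence between the facet normals at one vertex has at least four
nonzero coefficients, because the normals are in convex position in an affine plane
(`IsPolarPair.four_le_card_dependence`), and dually for facets. So in the graph of the incidences
with nonzero weight every node has degree at least four or zero. But this graph is bipartite and
planar, hence, if it has an edge, it has a node of degree at most three
(`IsQuadrangulation.exists_degree_le_three`). So all weights vanish.

Planarity enters through homology with coefficients in `𝔽₂`. The edges of the polytope, as
quadrilaterals with two vertices and two facets as corners, form a cell structure on the sphere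
whose graph is the incidence graph. Once Euler's formula and connectedness are known, a dimension
count shows that every cycle is a boundary, and this gives Euler's inequality for all subgraphs.
Euler's formula itself (`IsPolarPair.card_add_card_eq`) comes from a generic height function:
every edge descends from one of its vertices; a facet has two descending edges at its highest
vertex, none at its lowest, and one at each of the others; and the level plane through a vertex
which is neither highest nor lowest cuts exactly two of the facets at that vertex. Counting pairs
of a facet and a descending edge of it in two ways gives `2 f₁ = 2 f₂ + 2 (f₀ - 2)`.

Finally `f₀₂ = 2 f₁`, since each edge contributes four corners and each incidence lies in two
edges. With Euler's formula, `3 (f₀ + f₂) - f₀₂ = 3 (f₁ + 2) - 2 f₁ = f₁ + 6`.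
-/


noncomputable section

namespace Polytopes

/-! ### Planarity of the incidence graph -/

section Planar

open Finset

/-- The dimensions of the kernels of a matrix and of its transpose differ by the difference of the
numbers of columns and rows. -/
lemma finrank_ker_add_card_eq {K m n : Type*} [Field K] [Fintype m] [Fintype n]
    (A : Matrix m n K) :
    Module.finrank K (LinearMap.ker A.mulVecLin) + Fintype.card m =
      Fintype.card n + Module.finrank K (LinearMap.ker A.transpose.mulVecLin) := by
  classical
  have h1 := A.mulVecLin.finrank_range_add_finrank_ker
  have h2 := A.transpose.mulVecLin.finrank_range_add_finrank_ker
  have h3 := A.rank_transpose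
  rw [Matrix.rank, Matrix.rank] at h3
  simp only [Module.finrank_fintype_fun_eq_card] at h1 h2
  omega

variable {I J E : Type*} [Fintype I] [Fintype J] [Fintype E]

/-- A cell structure on the sphere whose `2`-cells are the quadrilaterals `e : E`, and whose graph
is the bipartite incidence graph between the types `I` and `J`: the quadrilateral `e` has the two
corners `eI e` in `I` and the two corners `eJ e` in `J`. For a `3`-polytope, `I` is the set of
vertices, `J` the set of facets, and `E` the set of edges. The topology of the sphere enters
through Euler's formula and through two connectedness properties, stated cohomologically
with coefficients in `𝔽₂`. -/
structure IsQuadrangulation (inc : I → J → Prop) (eI : E → Finset I) (eJ : E → Finset J) :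
    Prop where
  card_left : ∀ e, #(eI e) = 2
  card_right : ∀ e, #(eJ e) = 2
  inc_of_mem : ∀ e, ∀ i ∈ eI e, ∀ j ∈ eJ e, inc i j
  card_corner : ∀ i j, inc i j → open Classical in #{e | i ∈ eI e ∧ j ∈ eJ e} = 2
  euler : Fintype.card I + Fintype.card J = Fintype.card E + 2
  conn_edge : ∀ h : E → ZMod 2,
    (∀ i j e e', i ∈ eI e → j ∈ eJ e → i ∈ eI e' → j ∈ eJ e' → h e = h e') → ∀ e e', h e = h e'
  conn_node : ∀ y : I ⊕ J → ZMod 2, (∀ i j, inc i j → y (.inl i) = y (.inr j)) →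
    ∀ x x', y x = y x'

/-- The node `x` is an end of the corner `p`. -/
def IsEnd (x : I ⊕ J) (p : I × J) : Prop := x = .inl p.1 ∨ x = .inr p.2

open Classical in
/-- The entries of the boundary map from the corners to the nodes. -/
def endCoeff (x : I ⊕ J) (p : I × J) : ZMod 2 := if IsEnd x p then 1 else 0

open Classical in
/-- The boundary modulo two of a `2`-chain of quadrilaterals. -/
def quadBoundary (eI : E → Finset I) (eJ : E → Finset J) :
    (E → ZMod 2) →ₗ[ZMod 2] (I × J → ZMod 2) where
  toFun h p := ∑ e with p.1 ∈ eI e ∧ p.2 ∈ eJ e, h e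
  map_add' h h' := by ext p; simp [sum_add_distrib]
  map_smul' a h := by ext p; simp [mul_sum]

variable {inc : I → J → Prop} {eI : E → Finset I} {eJ : E → Finset J}

lemma sum_endCoeff_mul (x : I ⊕ J) (f : I × J → ZMod 2) :
    ∑ p, endCoeff x p * f p = Sum.elim (fun i => ∑ j, f (i, j)) (fun j => ∑ i, f (i, j)) x := by
  classical
  rcases x with i | j
  · rw [Fintype.sum_prod_type, Finset.sum_eq_single i]
    · simp [endCoeff, IsEnd]
    · intro b _ hb
      simp [endCoeff, IsEnd, hb.symm]
    · simp
  · rw [Fintype.sum_prod_type_right, Finset.sum_eq_single j]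
    · simp [endCoeff, IsEnd]
    · intro b _ hb
      simp [endCoeff, IsEnd, hb.symm]
    · simp

lemma sum_mul_endCoeff (y : I ⊕ J → ZMod 2) (p : I × J) :
    ∑ x, endCoeff x p * y x = y (.inl p.1) + y (.inr p.2) := by
  classical
  simp [endCoeff, IsEnd]

namespace IsQuadrangulation

variable (hq : IsQuadrangulation inc eI eJ)
include hq

open Classical in
/-- Every quadrilateral has four corners, each of which it shares with one other quadrilateral. -/
lemma card_corners : Fintype.card {p : I × J // inc p.1 p.2} = 2 * Fintype.card E := by
  have h := sum_card_bipartiteAbove_eq_sum_card_bipartiteBelow (s := univ) (t := univ)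
    (fun (p : {p : I × J // inc p.1 p.2}) (e : E) => p.1.1 ∈ eI e ∧ p.1.2 ∈ eJ e)
  have h1 : ∀ p : {p : I × J // inc p.1 p.2},
      #(bipartiteAbove (fun (p : {p : I × J // inc p.1 p.2}) (e : E) =>
        p.1.1 ∈ eI e ∧ p.1.2 ∈ eJ e) univ p) = 2 := fun p => hq.card_corner _ _ p.2
  have h2 : ∀ e : E, #(bipartiteBelow (fun (p : {p : I × J // inc p.1 p.2}) (e : E) =>
        p.1.1 ∈ eI e ∧ p.1.2 ∈ eJ e) univ e) = 4 := by
    intro e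
    have : #(eI e ×ˢ eJ e) = 4 := by rw [card_product, hq.card_left, hq.card_right]
    rw [← this]
    refine card_bij (fun p _ => p.1) ?_ ?_ ?_
    · intro p hp
      simpa [bipartiteBelow] using hp
    · intro p _ p' _ h
      exact Subtype.ext h
    · intro p hp
      rw [mem_product] at hp
      exact ⟨⟨p, hq.inc_of_mem e _ hp.1 _ hp.2⟩, by simpa [bipartiteBelow] using hp, rfl⟩
  simp only [h1, h2, sum_const, smul_eq_mul, card_univ] at h
  omega

/-- A boundary is a cycle. -/
lemma boundary_quadBoundary (h : E → ZMod 2) (x : I ⊕ J) :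
    ∑ p, endCoeff x p * quadBoundary eI eJ h p = 0 := by
  classical
  rw [sum_endCoeff_mul]
  have two : (2 : ZMod 2) = 0 := rfl
  rcases x with i | j
  · simp only [Sum.elim_inl, quadBoundary, LinearMap.coe_mk, AddHom.coe_mk, sum_filter]
    rw [sum_comm]
    refine sum_eq_zero fun e _ => ?_
    rw [← sum_filter, sum_const]
    by_cases hi : i ∈ eI e
    · simp [hi, hq.card_right e, two]
    · simp [hi]
  · simp only [Sum.elim_inr, quadBoundary, LinearMap.coe_mk, AddHom.coe_mk, sum_filter]
    rw [sum_comm]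
    refine sum_eq_zero fun e _ => ?_
    rw [← sum_filter, sum_const]
    by_cases hi : j ∈ eJ e
    · simp [hi, hq.card_left e, two]
    · simp [hi]

/-- A corner lies in exactly two quadrilaterals. -/
lemma quadBoundary_of_pair {i : I} {j : J} (hij : inc i j) : ∃ e e' : E, e ≠ e' ∧
    (∀ e'', i ∈ eI e'' ∧ j ∈ eJ e'' ↔ e'' = e ∨ e'' = e') ∧
    ∀ h, quadBoundary eI eJ h (i, j) = h e + h e' := by
  classical
  obtain ⟨e, e', hne, h⟩ := card_eq_two.1 (hq.card_corner i j hij)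
  refine ⟨e, e', hne, fun e'' => ?_, fun f => ?_⟩
  · simpa using congrArg (e'' ∈ ·) h
  · change ∑ e with i ∈ eI e ∧ j ∈ eJ e, f e = _
    rw [h, sum_pair hne]

omit [Fintype I] [Fintype J] hq in
lemma quadBoundary_of_not_inc (hq : ∀ e, ∀ i ∈ eI e, ∀ j ∈ eJ e, inc i j)
    {p : I × J} (hp : ¬ inc p.1 p.2) (h : E → ZMod 2) :
    quadBoundary eI eJ h p = 0 := by
  classical
  refine sum_eq_zero fun e he => ?_
  simp only [mem_filter, mem_univ, true_and] at he
  exact absurd (hq e _ he.1 _ he.2) hp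

/-- Only constant chains have boundary zero. -/
lemma eq_of_quadBoundary_eq_zero {h : E → ZMod 2} (hh : quadBoundary eI eJ h = 0) (e e' : E) :
    h e = h e' := by
  refine hq.conn_edge h ?_ e e'
  intro i j e e' hi hj hi' hj'
  obtain ⟨a, b, -, hab, hs⟩ := hq.quadBoundary_of_pair (hq.inc_of_mem e i hi j hj)
  have h0 : h a + h b = 0 := by rw [← hs, hh]; rfl
  have h1 : h a = h b := by
    rw [CharTwo.add_eq_zero] at h0
    exact h0
  rcases (hab e).1 ⟨hi, hj⟩ with rfl | rfl <;> rcases (hab e').1 ⟨hi', hj'⟩ with rfl | rfl <;>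
    simp [h1]

/-- The first homology of the sphere vanishes: every cycle is a boundary. The boundaries are cycles,
and Euler's formula says that the two spaces have the same dimension. -/
lemma exists_quadBoundary_eq [Nonempty E] {w : I × J → ZMod 2} (hw : ∀ p, ¬ inc p.1 p.2 → w p = 0)
    (hc : ∀ x, ∑ p, endCoeff x p * w p = 0) : ∃ h, quadBoundary eI eJ h = w := by
  classical
  let C := {p : I × J // inc p.1 p.2}
  let A : Matrix (I ⊕ J) C (ZMod 2) := fun x p => endCoeff x p.1
  let R : (E → ZMod 2) →ₗ[ZMod 2] (C → ZMod 2) :=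
    (LinearMap.funLeft (ZMod 2) (ZMod 2) (fun p : C => p.1)) ∘ₗ quadBoundary eI eJ
  have hsum : ∀ (x : I ⊕ J) (f : I × J → ZMod 2), (∀ p, ¬ inc p.1 p.2 → f p = 0) →
      ∑ p : C, endCoeff x p.1 * f p.1 = ∑ p, endCoeff x p * f p := by
    intro x f hf
    rw [← sum_subtype (univ.filter fun p : I × J => inc p.1 p.2) (by simp)
      (fun p => endCoeff x p * f p), sum_filter]
    refine sum_congr rfl fun p _ => ?_
    split_ifs with h
    · rfl
    · simp [hf p h]
  have hR : ∀ h p, R h p = quadBoundary eI eJ h p.1 := fun _ _ => rfl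
  -- `A` is the boundary map from the corners to the nodes, `R` the one from the quadrilaterals
  have hle : LinearMap.range R ≤ LinearMap.ker A.mulVecLin := by
    rintro _ ⟨h, rfl⟩
    rw [LinearMap.mem_ker]
    ext x
    change ∑ p : C, endCoeff x p.1 * quadBoundary eI eJ h p.1 = 0
    rw [hsum x _ fun p hp => quadBoundary_of_not_inc hq.inc_of_mem hp h]
    exact hq.boundary_quadBoundary h x
  have hkerR : Module.finrank (ZMod 2) (LinearMap.ker R) ≤ 1 := by
    refine finrank_le_one ⟨1, ?_⟩ ?_
    · rw [LinearMap.mem_ker]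
      ext p
      obtain ⟨e, e', -, -, hs⟩ := hq.quadBoundary_of_pair p.2
      rw [hR, hs]
      rfl
    · rintro ⟨h, hh⟩
      obtain ⟨e0⟩ := ‹Nonempty E›
      refine ⟨h e0, ?_⟩
      ext e
      have h0 : quadBoundary eI eJ h = 0 := by
        ext p
        by_cases hp : inc p.1 p.2
        · exact congrFun (LinearMap.mem_ker.1 hh) ⟨p, hp⟩
        · exact quadBoundary_of_not_inc hq.inc_of_mem hp h
      simpa using hq.eq_of_quadBoundary_eq_zero h0 e0 e
  have hkerA : Module.finrank (ZMod 2) (LinearMap.ker A.transpose.mulVecLin) ≤ 1 := by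
    obtain ⟨e0⟩ := ‹Nonempty E›
    have hn : (eI e0).Nonempty := card_pos.1 (by rw [hq.card_left]; norm_num)
    obtain ⟨i0, -⟩ := hn
    have hy : ∀ y ∈ LinearMap.ker A.transpose.mulVecLin, ∀ x x', y x = y x' := by
      intro y hy
      refine hq.conn_node y fun i j hij => ?_
      have := congrFun (LinearMap.mem_ker.1 hy) ⟨(i, j), hij⟩
      change ∑ x, endCoeff x (i, j) * y x = 0 at this
      rw [sum_mul_endCoeff, CharTwo.add_eq_zero] at this
      exact this
    refine finrank_le_one ⟨1, ?_⟩ ?_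
    · rw [LinearMap.mem_ker]
      ext p
      change ∑ x, endCoeff x p.1 * 1 = 0
      rw [sum_mul_endCoeff (fun _ => 1)]
      rfl
    · rintro ⟨y, hyk⟩
      refine ⟨y (.inl i0), ?_⟩
      ext x
      simpa using hy y hyk (.inl i0) x
  have hE : Module.finrank (ZMod 2) (LinearMap.range R) =
      Module.finrank (ZMod 2) (LinearMap.ker A.mulVecLin) := by
    refine le_antisymm (Submodule.finrank_mono hle) ?_
    have h1 := finrank_ker_add_card_eq A
    have h2 := R.finrank_range_add_finrank_ker
    have h3 := hq.card_corners
    have h4 := hq.euler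
    rw [Module.finrank_fintype_fun_eq_card] at h2
    rw [Fintype.card_sum, show Fintype.card C = _ from h3] at h1
    omega
  have hmem : (fun p : C => w p.1) ∈ LinearMap.range R := by
    rw [Submodule.eq_of_le_of_finrank_eq hle hE, LinearMap.mem_ker]
    ext x
    change ∑ p : C, endCoeff x p.1 * w p.1 = 0
    rw [hsum x w hw, hc x]
  obtain ⟨h, hh⟩ := hmem
  refine ⟨h, ?_⟩
  ext p
  by_cases hp : inc p.1 p.2
  · exact congrFun hh ⟨p, hp⟩
  · rw [hw p hp, quadBoundary_of_not_inc hq.inc_of_mem hp h]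

omit hq [Fintype E] in
/-- The support of a nonzero cycle has at least four corners, because the incidence graph is
bipartite. -/
lemma four_le_card_support {w : I × J → ZMod 2} (hw : w ≠ 0)
    (hc : ∀ x, ∑ p, endCoeff x p * w p = 0) : 4 ≤ #{p | w p ≠ 0} := by
  classical
  have hI : ∀ i j, w (i, j) ≠ 0 → ∃ j' ≠ j, w (i, j') ≠ 0 := by
    intro i j h
    by_contra! hcon
    have := hc (.inl i)
    rw [sum_endCoeff_mul, Sum.elim_inl, sum_eq_single j (fun j' _ hj' => hcon j' hj') (by simp)]
      at this
    exact h this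
  have hJ : ∀ i j, w (i, j) ≠ 0 → ∃ i' ≠ i, w (i', j) ≠ 0 := by
    intro i j h
    by_contra! hcon
    have := hc (.inr j)
    rw [sum_endCoeff_mul, Sum.elim_inr, sum_eq_single i (fun j' _ hj' => hcon j' hj') (by simp)]
      at this
    exact h this
  obtain ⟨⟨i, j⟩, hp⟩ := Function.ne_iff.1 hw
  obtain ⟨j', hj', hp1⟩ := hI i j hp
  obtain ⟨i', hi', hp2⟩ := hJ i j hp
  obtain ⟨i'', hi'', hp3⟩ := hJ i j' hp1
  have hsub : ({(i, j), (i, j'), (i', j), (i'', j')} : Finset (I × J)) ⊆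
      univ.filter fun p => w p ≠ 0 := by
    intro p hp
    simp only [mem_insert, mem_singleton] at hp
    rw [mem_filter]
    rcases hp with rfl | rfl | rfl | rfl <;> exact ⟨mem_univ _, by assumption⟩
  refine le_trans ?_ (card_le_card hsub)
  rw [card_insert_of_notMem, card_insert_of_notMem, card_insert_of_notMem, card_singleton]
  · simp [hj'.symm]
  · simp [hi''.symm, hj']
  · simp [hj'.symm, hi'.symm]

/-- The relation between quadrilaterals on the two sides of a corner which is not in `S`. Its
classes are the regions into which the subgraph `S` cuts the sphere. -/
def Adj (eI : E → Finset I) (eJ : E → Finset J) (S : Finset (I × J)) (e e' : E) : Prop :=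
  ∃ i j, (i, j) ∉ S ∧ i ∈ eI e ∧ j ∈ eJ e ∧ i ∈ eI e' ∧ j ∈ eJ e'

/-- A chain which is constant on every region has its boundary in `S`. -/
lemma quadBoundary_eq_zero_of_adj {S : Finset (I × J)} {h : E → ZMod 2}
    (hh : ∀ e e', Adj eI eJ S e e' → h e = h e') {p : I × J} (hp : p ∉ S) :
    quadBoundary eI eJ h p = 0 := by
  by_cases hi : inc p.1 p.2
  · obtain ⟨e, e', -, hab, hs⟩ := hq.quadBoundary_of_pair hi
    rw [hs, CharTwo.add_eq_zero]
    have h1 := (hab e).2 (.inl rfl)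
    have h2 := (hab e').2 (.inr rfl)
    exact hh e e' ⟨p.1, p.2, hp, h1.1, h1.2, h2.1, h2.2⟩
  · exact quadBoundary_of_not_inc hq.inc_of_mem hi h

/-- A chain with boundary in `S` is constant on every region. -/
lemma eq_of_adj {S : Finset (I × J)} {h : E → ZMod 2}
    (hh : ∀ p ∉ S, quadBoundary eI eJ h p = 0) {e e' : E} (ha : Adj eI eJ S e e') : h e = h e' := by
  obtain ⟨i, j, hS, hi, hj, hi', hj'⟩ := ha
  obtain ⟨a, b, -, hab, hs⟩ := hq.quadBoundary_of_pair (hq.inc_of_mem e i hi j hj)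
  have h0 : h a + h b = 0 := by rw [← hs, hh _ hS]
  have h1 : h a = h b := by
    rw [CharTwo.add_eq_zero] at h0
    exact h0
  rcases (hab e).1 ⟨hi, hj⟩ with rfl | rfl <;> rcases (hab e').1 ⟨hi', hj'⟩ with rfl | rfl <;>
    simp [h1]

open Classical in
/-- Every region other than the whole sphere is bounded by at least four corners, and every corner
of `S` bounds at most two regions. -/
lemma four_mul_card_regions_le {S : Finset (I × J)} (hS : ∀ p ∈ S, inc p.1 p.2)
    [Fintype (Quot (Adj eI eJ S))] (h2 : 2 ≤ Fintype.card (Quot (Adj eI eJ S))) :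
    4 * Fintype.card (Quot (Adj eI eJ S)) ≤ 2 * #S := by
  -- the indicator function of a region
  let ind : Quot (Adj eI eJ S) → E → ZMod 2 := fun q e => if Quot.mk _ e = q then 1 else 0
  have hz : ∀ q, ∀ p ∉ S, quadBoundary eI eJ (ind q) p = 0 := by
    intro q p hp
    refine hq.quadBoundary_eq_zero_of_adj (fun e e' ha => ?_) hp
    simp only [ind, Quot.sound ha]
  have h := sum_card_bipartiteAbove_eq_sum_card_bipartiteBelow (s := univ) (t := S)
    (fun (q : Quot (Adj eI eJ S)) (p : I × J) => quadBoundary eI eJ (ind q) p ≠ 0)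
  have hlow : ∀ q ∈ (univ : Finset (Quot (Adj eI eJ S))), 4 ≤ #(bipartiteAbove
      (fun (q : Quot (Adj eI eJ S)) (p : I × J) => quadBoundary eI eJ (ind q) p ≠ 0) S q) := by
    intro q _
    have hne : quadBoundary eI eJ (ind q) ≠ 0 := by
      intro h0
      obtain ⟨q', hq'⟩ := Fintype.exists_ne_of_one_lt_card h2 q
      obtain ⟨e, rfl⟩ := Quot.exists_rep q
      obtain ⟨e', rfl⟩ := Quot.exists_rep q'
      have := hq.eq_of_quadBoundary_eq_zero h0 e e'
      simp [ind, hq'] at this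
    refine (four_le_card_support hne fun x => hq.boundary_quadBoundary _ x).trans
      (card_le_card fun p hp => ?_)
    simp only [mem_filter, mem_univ, true_and] at hp
    simp only [bipartiteAbove, mem_filter]
    exact ⟨by_contra fun hn => hp (hz q p hn), hp⟩
  have hup : ∀ p ∈ S, #(bipartiteBelow
      (fun (q : Quot (Adj eI eJ S)) (p : I × J) => quadBoundary eI eJ (ind q) p ≠ 0) univ p) ≤
      2 := by
    intro p hp
    obtain ⟨e, e', -, -, hs⟩ := hq.quadBoundary_of_pair (hS p hp)
    refine le_trans (card_le_card (t := {Quot.mk _ e, Quot.mk _ e'}) fun q hq' => ?_) card_le_two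
    simp only [bipartiteBelow, mem_filter, mem_univ, true_and] at hq'
    rw [mem_insert, mem_singleton]
    by_contra! hcon
    refine hq' ?_
    change quadBoundary eI eJ (ind q) (p.1, p.2) = 0
    rw [hs]
    simp [ind, hcon.1.symm, hcon.2.symm]
  have h3 := sum_le_sum hlow
  have h4 := sum_le_sum hup
  rw [h] at h3
  have := h3.trans h4
  simpa [mul_comm] using this

open Classical in
/-- Euler's inequality for the subgraph `S`: it cuts the sphere into at least `#S - #T + 2` regions,
where `T` is the set of its nodes. -/
lemma card_add_two_le_card_regions [Nonempty E] {S : Finset (I × J)} (hne : S.Nonempty)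
    (hS : ∀ p ∈ S, inc p.1 p.2) {T : Finset (I ⊕ J)} (hT : ∀ x, x ∈ T ↔ ∃ p ∈ S, IsEnd x p)
    [Fintype (Quot (Adj eI eJ S))] :
    #S + 2 ≤ #T + Fintype.card (Quot (Adj eI eJ S)) := by
  let A : Matrix T S (ZMod 2) := fun x p => endCoeff x.1 p.1
  -- the chains with boundary in `S`
  let H : Submodule (ZMod 2) (E → ZMod 2) :=
    { carrier := {h | ∀ p ∉ S, quadBoundary eI eJ h p = 0}
      add_mem' := by
        intro a b ha hb p hp
        rw [map_add, Pi.add_apply, ha p hp, hb p hp, add_zero]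
      zero_mem' := by simp
      smul_mem' := by
        intro a b hb p hp
        rw [map_smul, Pi.smul_apply, hb p hp, smul_zero] }
  have hHF : Module.finrank (ZMod 2) H ≤ Fintype.card (Quot (Adj eI eJ S)) := by
    rw [← Module.finrank_fintype_fun_eq_card (ZMod 2)]
    let L : H →ₗ[ZMod 2] (Quot (Adj eI eJ S) → ZMod 2) :=
      { toFun := fun h => Quot.lift h.1 fun e e' ha => hq.eq_of_adj h.2 ha
        map_add' := by
          intro a b
          ext q
          obtain ⟨e, rfl⟩ := Quot.exists_rep q
          rfl
        map_smul' := by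
          intro a b
          ext q
          obtain ⟨e, rfl⟩ := Quot.exists_rep q
          rfl }
    refine LinearMap.finrank_le_finrank_of_injective (f := L) fun a b hab => ?_
    ext e
    exact congrFun hab (Quot.mk _ e)
  let R : H →ₗ[ZMod 2] (S → ZMod 2) :=
    (LinearMap.funLeft (ZMod 2) (ZMod 2) (fun p : S => p.1)) ∘ₗ quadBoundary eI eJ ∘ₗ H.subtype
  -- the cycles of the subgraph are boundaries
  have hker : LinearMap.ker A.mulVecLin ≤ LinearMap.range R := by
    intro w hw
    let w' : I × J → ZMod 2 := fun p => if hp : p ∈ S then w ⟨p, hp⟩ else 0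
    have hw0 : ∀ p ∉ S, w' p = 0 := fun p hp => by simp [w', hp]
    obtain ⟨h, hh⟩ := hq.exists_quadBoundary_eq (w := w')
      (fun p hp => hw0 p fun hpS => hp (hS p hpS)) (by
        intro x
        by_cases hx : x ∈ T
        · have := congrFun (LinearMap.mem_ker.1 hw) ⟨x, hx⟩
          change ∑ p : S, endCoeff x p.1 * w p = 0 at this
          rw [← this, ← sum_subset (subset_univ S), ← sum_coe_sort S]
          · refine sum_congr rfl fun p _ => ?_
            simp [w']
          · intro p _ hp
            simp [hw0 p hp]
        · refine sum_eq_zero fun p _ => ?_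
          by_cases hp : p ∈ S
          · have : ¬ IsEnd x p := fun hxp => hx ((hT x).2 ⟨p, hp, hxp⟩)
            simp [endCoeff, this]
          · simp [hw0 p hp])
    refine ⟨⟨h, fun p hp => by rw [hh, hw0 p hp]⟩, ?_⟩
    ext p
    change quadBoundary eI eJ h p.1 = w p
    simp [hh, w']
  -- the whole sphere has boundary zero
  have hone : 1 ≤ Module.finrank (ZMod 2) (LinearMap.ker R) := by
    have h1 : ∀ p, inc p.1 p.2 → quadBoundary eI eJ (1 : E → ZMod 2) p = 0 := by
      intro p hp
      obtain ⟨e, e', -, -, hs⟩ := hq.quadBoundary_of_pair hp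
      change quadBoundary eI eJ _ (p.1, p.2) = 0
      rw [hs]
      rfl
    have h2 : ∀ p, quadBoundary eI eJ (1 : E → ZMod 2) p = 0 := by
      intro p
      by_cases hp : inc p.1 p.2
      · exact h1 p hp
      · exact quadBoundary_of_not_inc hq.inc_of_mem hp _
    have : Nontrivial (LinearMap.ker R) := by
      refine ⟨⟨⟨⟨1, fun p _ => h2 p⟩, ?_⟩, 0, fun h0 => ?_⟩⟩
      · rw [LinearMap.mem_ker]
        ext p
        exact h2 p.1
      · obtain ⟨e0⟩ := ‹Nonempty E›
        have := congrFun (congrArg (fun z => z.1.1) h0) e0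
        simp at this
    exact Module.finrank_pos
  -- every corner has two ends
  have hAT : 1 ≤ Module.finrank (ZMod 2) (LinearMap.ker A.transpose.mulVecLin) := by
    obtain ⟨p0, hp0⟩ := hne
    have hx0 : (Sum.inl p0.1 : I ⊕ J) ∈ T := (hT _).2 ⟨p0, hp0, .inl rfl⟩
    have : Nontrivial (LinearMap.ker A.transpose.mulVecLin) := by
      refine ⟨⟨⟨1, ?_⟩, 0, fun h0 => ?_⟩⟩
      · rw [LinearMap.mem_ker]
        ext p
        change ∑ x : T, endCoeff x.1 p.1 * 1 = 0
        rw [sum_coe_sort T (fun x => endCoeff x p.1 * 1), sum_subset (subset_univ T),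
          sum_mul_endCoeff (fun _ => 1)]
        · rfl
        · intro x _ hx
          have : ¬ IsEnd x p.1 := fun hxp => hx ((hT x).2 ⟨p.1, p.2, hxp⟩)
          simp [endCoeff, this]
      · have := congrFun (congrArg (fun z => z.1) h0) ⟨_, hx0⟩
        simp at this
    exact Module.finrank_pos
  have h1 := finrank_ker_add_card_eq A
  have h2 := R.finrank_range_add_finrank_ker
  have h3 := Submodule.finrank_mono hker
  rw [Fintype.card_coe, Fintype.card_coe] at h1
  omega

open Classical in
/-- Every nonempty subgraph of a bipartite planar graph has a node of degree at most three. If all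
degrees were at least four, then a subgraph with `e` corners would have at most `e / 2` nodes, and
it has at most `e / 2` regions, contrary to Euler's inequality. -/
theorem exists_degree_le_three {S : Finset (I × J)} (hne : S.Nonempty)
    (hS : ∀ p ∈ S, inc p.1 p.2) :
    ∃ x, (∃ p ∈ S, IsEnd x p) ∧ #{p ∈ S | IsEnd x p} ≤ 3 := by
  by_contra! hcon
  have : Nonempty E := by
    obtain ⟨p, hp⟩ := hne
    obtain ⟨e, -⟩ := hq.quadBoundary_of_pair (hS p hp)
    exact ⟨e⟩
  have : Fintype (Quot (Adj eI eJ S)) := Fintype.ofFinite _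
  let T : Finset (I ⊕ J) := {x | ∃ p ∈ S, IsEnd x p}
  have hT : ∀ x, x ∈ T ↔ ∃ p ∈ S, IsEnd x p := by simp [T]
  have h1 := hq.card_add_two_le_card_regions hne hS hT
  have h := sum_card_bipartiteAbove_eq_sum_card_bipartiteBelow (s := T) (t := S) IsEnd
  have hlow : ∀ x ∈ T, 4 ≤ #(bipartiteAbove IsEnd S x) := by
    intro x hx
    exact hcon x ((hT x).1 hx)
  have hup : ∀ p ∈ S, #(bipartiteBelow IsEnd T p) ≤ 2 := by
    intro p hp
    refine le_trans (card_le_card (t := {.inl p.1, .inr p.2}) fun x hx => ?_) card_le_two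
    simp only [bipartiteBelow, mem_filter] at hx
    rw [mem_insert, mem_singleton]
    exact hx.2
  have h3 := (sum_le_sum hlow).trans (h ▸ sum_le_sum hup)
  simp only [sum_const, smul_eq_mul] at h3
  have h4 := hq.four_mul_card_regions_le hS (by omega)
  omega

end IsQuadrangulation

end Planar

open Set Filter Topology Module
open scoped InnerProductSpace

/-! ### Regular level sets are submanifolds -/

section Submanifold

universe u

variable {E F : Type u} [NormedAddCommGroup E] [NormedSpace ℝ E]
  [NormedAddCommGroup F] [NormedSpace ℝ F] {k : ℕ}

/-- `ψ` is a slice chart for `S`: a smooth chart of the ambient space, with values in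
`F × ℝ^k`, in which `S` is given by the vanishing of the first component. -/
structure IsSliceChart (S : Set E) (ψ : OpenPartialHomeomorph E (F × EuclideanSpace ℝ (Fin k))) :
    Prop where
  contDiffOn : ContDiffOn ℝ ∞ ψ ψ.source
  contDiffOn_symm : ContDiffOn ℝ ∞ ψ.symm ψ.target
  mem_iff : ∀ y ∈ ψ.source, y ∈ S ↔ (ψ y).1 = 0

/-- The chart of `S` cut out by a slice chart: the second component of the slice chart. The
point `x` is only the value of the inverse outside its target. -/
def IsSliceChart.chart {S : Set E} {ψ : OpenPartialHomeomorph E (F × EuclideanSpace ℝ (Fin k))}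
    (h : IsSliceChart S ψ) (x : S) : OpenPartialHomeomorph S (EuclideanSpace ℝ (Fin k)) :=
  open Classical in
  { toFun := fun y => (ψ y).2
    invFun := fun z => if hz : ψ.symm (0, z) ∈ S then ⟨ψ.symm (0, z), hz⟩ else x
    source := {y | (y : E) ∈ ψ.source}
    target := {z | ((0 : F), z) ∈ ψ.target}
    map_source' := by
      intro y hy
      have h0 := (h.mem_iff y hy).1 y.2
      have : ψ y = (0, (ψ y).2) := Prod.ext h0 rfl
      simpa [← this] using ψ.map_source hy
    map_target' := by
      intro z hz
      have hs := ψ.map_target hz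
      have hS : ψ.symm (0, z) ∈ S := (h.mem_iff _ hs).2 (by rw [ψ.right_inv hz])
      simpa [hS] using hs
    left_inv' := by
      intro y hy
      have h0 := (h.mem_iff y hy).1 y.2
      have h1 : ((0 : F), (ψ y).2) = ψ y := Prod.ext h0.symm rfl
      have h2 : ψ.symm (0, (ψ y).2) = y := by rw [h1, ψ.left_inv hy]
      ext
      simp [h2]
    right_inv' := by
      intro z hz
      have hs := ψ.map_target hz
      have hS : ψ.symm (0, z) ∈ S := (h.mem_iff _ hs).2 (by rw [ψ.right_inv hz])
      simp [hS, ψ.right_inv hz]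
    open_source := ψ.open_source.preimage continuous_subtype_val
    open_target := ψ.open_target.preimage (by fun_prop)
    continuousOn_toFun := by
      refine continuous_snd.comp_continuousOn ?_
      exact ψ.continuousOn.comp continuous_subtype_val.continuousOn (fun y hy => hy)
    continuousOn_invFun := by
      rw [continuousOn_iff_continuous_domRestrict, continuous_induced_rng]
      have : Continuous fun z : {z | ((0 : F), z) ∈ ψ.target} => ψ.symm (0, (z : _)) := by
        rw [← continuousOn_univ]
        exact ψ.continuousOn_symm.comp (by fun_prop) (fun z _ => z.2)
      refine this.congr fun z => ?_
      have hS : ψ.symm (0, (z : _)) ∈ S :=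
        (h.mem_iff _ (ψ.map_target z.2)).2 (by rw [ψ.right_inv z.2])
      simp [hS] }

lemma IsSliceChart.chart_symm_coe {S : Set E}
    {ψ : OpenPartialHomeomorph E (F × EuclideanSpace ℝ (Fin k))}
    (h : IsSliceChart S ψ) (x : S) {z : EuclideanSpace ℝ (Fin k)}
    (hz : z ∈ (h.chart x).target) : (((h.chart x).symm z : S) : E) = ψ.symm (0, z) := by
  have hz' : ((0 : F), z) ∈ ψ.target := hz
  have hS : ψ.symm (0, z) ∈ S := (h.mem_iff _ (ψ.map_target hz')).2 (by rw [ψ.right_inv hz'])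
  simp [IsSliceChart.chart, hS]

/-- A set covered by slice charts is a smoothly embedded submanifold. -/
theorem isSmoothSubmanifold_of_sliceCharts [FiniteDimensional ℝ E] [FiniteDimensional ℝ F]
    {S : Set E} (hdim : Module.finrank ℝ E = Module.finrank ℝ F + k)
    (hS : ∀ x ∈ S, ∃ ψ : OpenPartialHomeomorph E (F × EuclideanSpace ℝ (Fin k)),
      x ∈ ψ.source ∧ IsSliceChart S ψ) : IsSmoothSubmanifold S k := by
  choose ψ hxψ hψ using hS
  let c : S → OpenPartialHomeomorph S (EuclideanSpace ℝ (Fin k)) :=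
    fun x => (hψ x x.2).chart x
  let cs : ChartedSpace (EuclideanSpace ℝ (Fin k)) S :=
    { atlas := range c
      chartAt := c
      mem_chart_source := fun x => hxψ x x.2
      chart_mem_atlas := fun x => ⟨x, rfl⟩ }
  have man : IsManifold (𝓡 k) ∞ S := by
    apply isManifold_of_contDiffOn
    rintro _ _ ⟨x, rfl⟩ ⟨y, rfl⟩
    have h1 : ContDiffOn ℝ ∞ (fun z => (ψ y y.2 ((ψ x x.2).symm (0, z))).2)
        ((c x).symm.trans (c y)).source := by
      refine contDiff_snd.comp_contDiffOn ?_
      refine (hψ y y.2).contDiffOn.comp ((hψ x x.2).contDiffOn_symm.comp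
        (by fun_prop) ?_) ?_
      · intro z hz
        exact hz.1
      · intro z hz
        have hz2 : (((c x).symm z : S) : E) ∈ (ψ y y.2).source := hz.2
        rwa [IsSliceChart.chart_symm_coe _ _ hz.1] at hz2
    refine ContDiffOn.congr (h1.mono ?_) ?_
    · intro z hz
      exact hz.1
    · intro z hz
      have : (((c x).symm z : S) : E) = (ψ x x.2).symm (0, z) :=
        IsSliceChart.chart_symm_coe _ _ hz.1.1
      change (ψ y y.2 (((c x).symm z : S) : E)).2 = _
      rw [this]
  refine ⟨cs, man, ?_, IsEmbedding.subtypeVal⟩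
  have hd : Module.finrank ℝ (EuclideanSpace ℝ (Fin k) × F) = Module.finrank ℝ E := by
    simp [hdim, add_comm]
  let e : (EuclideanSpace ℝ (Fin k) × F) ≃L[ℝ] E := ContinuousLinearEquiv.ofFinrankEq hd
  let e' : (F × EuclideanSpace ℝ (Fin k)) ≃L[ℝ] E := (ContinuousLinearEquiv.prodComm ℝ _ _).trans e
  refine ⟨F, inferInstance, inferInstance, fun x => ?_⟩
  refine Manifold.IsImmersionAtOfComplement.mk_of_continuousAt
    continuous_subtype_val.continuousAt e (c x)
    ((ψ x x.2).trans e'.toHomeomorph.toOpenPartialHomeomorph) (hxψ x x.2) ?_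
    (IsManifold.subset_maximalAtlas ⟨x, rfl⟩) ?_ ?_
  · simpa using hxψ x x.2
  · rw [IsManifold.maximalAtlas, _root_.mem_maximalAtlas_iff]
    have key : (ψ x x.2).trans e'.toHomeomorph.toOpenPartialHomeomorph ∈
        contDiffGroupoid ∞ 𝓘(ℝ, E) := by
      rw [contDiffGroupoid, mem_groupoid_of_pregroupoid]
      constructor
      · have : ContDiffOn ℝ ∞ (fun y => e' (ψ x x.2 y)) (ψ x x.2).source :=
          e'.contDiff.comp_contDiffOn (hψ x x.2).contDiffOn
        refine this.mono ?_
        intro y hy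
        simpa using hy
      · have : ContDiffOn ℝ ∞ (fun y => (ψ x x.2).symm (e'.symm y))
            (e'.symm ⁻¹' (ψ x x.2).target) :=
          (hψ x x.2).contDiffOn_symm.comp e'.symm.contDiff.contDiffOn (fun y hy => hy)
        refine this.mono ?_
        intro y hy
        simpa using hy
    rintro f hf
    rw [chartedSpaceSelf_atlas] at hf
    subst hf
    constructor
    · simpa using StructureGroupoid.symm _ key
    · simpa using key
  · intro z hz
    have hz' : z ∈ (c x).target := by simpa using hz
    have h2 : ((0 : F), z) ∈ (ψ x x.2).target := hz'
    have : (((c x).symm z : S) : E) = (ψ x x.2).symm (0, z) :=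
        IsSliceChart.chart_symm_coe _ _ hz'
    simp [this, (ψ x x.2).right_inv h2, e']

/-- **Regular level sets.** If near each of its points `S` is a level set of a fixed analytic
submersion `f`, then `S` is a smoothly embedded submanifold, of codimension `dim F`. Analyticity
rather than smoothness is asked of `f` because the inverse function theorem yields regularity
at a point, which spreads to a neighbourhood for analytic functions. -/
theorem isSmoothSubmanifold_of_levelSet [FiniteDimensional ℝ E] [FiniteDimensional ℝ F]
    {S : Set E} {f : E → F} {f' : E → E →L[ℝ] F} (c : F) (hf : ContDiff ℝ ω f)
    (hdim : Module.finrank ℝ E = Module.finrank ℝ F + k)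
    (hf' : ∀ x ∈ S, HasFDerivAt f (f' x) x) (hsurj : ∀ x ∈ S, Function.Surjective (f' x))
    (hS : ∀ x ∈ S, ∀ᶠ y in 𝓝 x, y ∈ S ↔ f y = c) : IsSmoothSubmanifold S k := by
  refine isSmoothSubmanifold_of_sliceCharts (F := F) hdim fun x hx => ?_
  -- complete the derivative to an isomorphism `E ≃ F × ℝ^k`
  have hr : (f' x).range = ⊤ := LinearMap.range_eq_top.2 (hsurj x hx)
  obtain ⟨K, hK⟩ := (f' x).ker.exists_isCompl
  have hker : Module.finrank ℝ (f' x).ker = k := by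
    have h1 := (f' x).toLinearMap.finrank_range_add_finrank_ker
    have h2 : Module.finrank ℝ (f' x).range = Module.finrank ℝ F := by
      rw [hr, finrank_top]
    omega
  let e : (f' x).ker ≃ₗ[ℝ] EuclideanSpace ℝ (Fin k) :=
    LinearEquiv.ofFinrankEq _ _ (by simpa using hker)
  let g : E →L[ℝ] EuclideanSpace ℝ (Fin k) :=
    LinearMap.toContinuousLinearMap
      (e.toLinearMap ∘ₗ Submodule.projectionOnto (f' x).ker K hK)
  have hgr : g.range = ⊤ := by
    refine LinearMap.range_eq_top.2 ?_
    intro z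
    obtain ⟨w, hw⟩ := e.surjective z
    exact ⟨w, by simp [g, ← hw, Submodule.projectionOnto_apply_left]⟩
  have hgk : g.ker = K := by
    ext y
    simp [g]
  let L : E ≃L[ℝ] F × EuclideanSpace ℝ (Fin k) :=
    ContinuousLinearMap.equivProdOfSurjectiveOfIsCompl (f' x) g hr hgr (hgk ▸ hK)
  let G : E → F × EuclideanSpace ℝ (Fin k) := fun y => (f y - c, g y)
  have hG : ContDiff ℝ ω G := (hf.sub contDiff_const).prodMk g.contDiff
  have hG' : HasFDerivAt G (L : E →L[ℝ] F × EuclideanSpace ℝ (Fin k)) x :=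
    ((hf' x hx).sub_const c).prodMk g.hasFDerivAt
  let ψ := hG.contDiffAt.toOpenPartialHomeomorph G hG' (by simp)
  have hψx : x ∈ ψ.source := hG.contDiffAt.mem_toOpenPartialHomeomorph_source hG' (by simp)
  have hinv : ContDiffAt ℝ ω ψ.symm (ψ x) := hG.contDiffAt.to_localInverse hG' (by simp)
  obtain ⟨W, hW, hWo, hxW⟩ := eventually_nhds_iff.1 (hinv.eventually (by simp))
  obtain ⟨U, hU, hUo, hxU⟩ := eventually_nhds_iff.1 (hS x hx)
  -- shrink the chart so that its inverse is smooth and `S` is a level set in its source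
  let ψ' := (ψ.symm.restrOpen W hWo).symm.restrOpen U hUo
  refine ⟨ψ', ⟨⟨hψx, ?_⟩, hxU⟩, ⟨?_, ?_, ?_⟩⟩
  · simpa using hxW
  · exact (hG.of_le (by simp)).contDiffOn
  · intro z hz
    have hzW : z ∈ W := by
      have : z ∈ (ψ.symm.restrOpen W hWo).source := hz.1
      exact this.2
    exact ((hW z hzW).of_le (by simp)).contDiffWithinAt
  · intro y hy
    rw [hU y hy.2]
    exact sub_eq_zero.symm

end Submanifold

/-! ### Polar pairs of vertices and facet normals -/

section PolarPair

variable {E : Type*} [NormedAddCommGroup E] [InnerProductSpace ℝ E]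
variable {ι κ : Type*}

/-- The polyhedron `{x | Aᵗ x ≤ 1}`, that is, the polar of the set of the vectors `A j`. -/
def polarSet (A : κ → E) : Set E := {x | ∀ j, ⟪A j, x⟫_ℝ ≤ 1}

lemma mem_convexHull_range_iff [Fintype ι] {V : ι → E} {x : E} :
    x ∈ convexHull ℝ (range V) ↔
      ∃ w : ι → ℝ, (∀ i, 0 ≤ w i) ∧ ∑ i, w i = 1 ∧ ∑ i, w i • V i = x := by
  classical
  constructor
  · intro hx
    have hsub : convexHull ℝ (range V) ⊆
        (fun w : ι → ℝ => ∑ i, w i • V i) '' stdSimplex ℝ ι := by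
      refine convexHull_min ?_ ?_
      · rintro _ ⟨i, rfl⟩
        exact ⟨Pi.single i 1, single_mem_stdSimplex ℝ i, by simp [Pi.single_apply]⟩
      · refine (convex_stdSimplex ℝ ι).is_linear_image ⟨fun a b => ?_, fun c a => ?_⟩
        · simp [add_smul, Finset.sum_add_distrib]
        · simp [Finset.smul_sum, smul_smul]
    obtain ⟨w, hw, rfl⟩ := hsub hx
    exact ⟨w, hw.1, hw.2, rfl⟩
  · rintro ⟨w, h0, h1, rfl⟩
    exact (convex_convexHull ℝ _).sum_mem (fun i _ => h0 i) h1
      fun i _ => subset_convexHull ℝ _ ⟨i, rfl⟩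

/-- If a convex combination attains an upper bound of its terms, so do all terms of positive
weight. -/
lemma eq_of_sum_mul_eq [Fintype ι] {w f : ι → ℝ} {M : ℝ} (h0 : ∀ i, 0 ≤ w i) (h1 : ∑ i, w i = 1)
    (hf : ∀ i, f i ≤ M) (hs : ∑ i, w i * f i = M) {i : ι} (hi : w i ≠ 0) : f i = M := by
  have h2 : ∑ i, w i * (M - f i) = 0 := by
    simp only [mul_sub, Finset.sum_sub_distrib, ← Finset.sum_mul, h1, hs, one_mul, sub_self]
  have h3 := (Finset.sum_eq_zero_iff_of_nonneg
    (fun i _ => mul_nonneg (h0 i) (sub_nonneg.2 (hf i)))).1 h2 i (Finset.mem_univ i)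
  rcases mul_eq_zero.1 h3 with h | h
  · exact absurd h hi
  · linarith

lemma exists_weight_ne_zero [Fintype ι] {w : ι → ℝ} (h1 : ∑ i, w i = 1) : ∃ i, w i ≠ 0 := by
  by_contra! h
  simp [h] at h1

/-- The points of positive weight in a convex combination lie in all the faces through it. -/
lemma exists_weights [Fintype ι] {V : ι → E} {x : E} (hx : x ∈ convexHull ℝ (range V)) :
    ∃ w : ι → ℝ, (∀ i, 0 ≤ w i) ∧ ∑ i, w i = 1 ∧ ∑ i, w i • V i = x ∧
      ∀ i, w i ≠ 0 → ∀ (y : E) (M : ℝ), (∀ i, ⟪y, V i⟫_ℝ ≤ M) → ⟪y, x⟫_ℝ = M →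
        ⟪y, V i⟫_ℝ = M := by
  rw [mem_convexHull_range_iff] at hx
  obtain ⟨w, h0, h1, hx⟩ := hx
  refine ⟨w, h0, h1, hx, fun i hi y M hy hyx => ?_⟩
  refine eq_of_sum_mul_eq h0 h1 hy ?_ hi
  rw [← hyx, ← hx, inner_sum]
  simp [inner_smul_right]

lemma sum_smul_mem_convexHull_image [Fintype ι] {V : ι → E} {w : ι → ℝ} (h0 : ∀ i, 0 ≤ w i)
    (h1 : ∑ i, w i = 1) {s : Set ι} (hs : ∀ i, w i ≠ 0 → i ∈ s) :
    ∑ i, w i • V i ∈ convexHull ℝ (V '' s) := by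
  classical
  rw [← Finset.sum_filter_of_ne (p := fun i => w i ≠ 0)]
  · refine (convex_convexHull ℝ _).sum_mem (fun i _ => h0 i) ?_ fun i hi =>
      subset_convexHull ℝ _ ⟨i, hs i (Finset.mem_filter.1 hi).2, rfl⟩
    rw [Finset.sum_filter_ne_zero, h1]
  · intro i _ hi h
    simp [h] at hi

lemma zero_mem_polarSet (A : κ → E) : (0 : E) ∈ polarSet A := by
  intro j
  simp

lemma convex_polarSet (A : κ → E) : Convex ℝ (polarSet A) := by
  have : polarSet A = ⋂ j, {x | ⟪A j, x⟫_ℝ ≤ 1} := by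
    ext x
    simp [polarSet]
  rw [this]
  exact convex_iInter fun j => convex_halfSpace_le (innerSL ℝ (A j)).toLinearMap.isLinear 1

lemma isClosed_polarSet (A : κ → E) : IsClosed (polarSet A) := by
  have : polarSet A = ⋂ j, {x | ⟪A j, x⟫_ℝ ≤ 1} := by
    ext x
    simp [polarSet]
  rw [this]
  exact isClosed_iInter fun j => isClosed_le (by fun_prop) continuous_const

lemma zero_mem_interior_polarSet [Finite κ] (A : κ → E) : (0 : E) ∈ interior (polarSet A) := by
  rw [mem_interior_iff_mem_nhds]
  have : ∀ᶠ x in 𝓝 (0 : E), ∀ j, ⟪A j, x⟫_ℝ < 1 := by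
    refine eventually_all.2 fun j => ?_
    have hc : Continuous fun x : E => ⟪A j, x⟫_ℝ := by fun_prop
    exact hc.continuousAt.eventually_lt_const (by simp)
  filter_upwards [this] with x hx j using (hx j).le

/-- A direction which does not increase the tight constraints is feasible. -/
lemma exists_add_smul_mem_polarSet [Finite κ] {A : κ → E} {x u : E} (hx : x ∈ polarSet A)
    (hu : ∀ j, ⟪A j, x⟫_ℝ = 1 → ⟪A j, u⟫_ℝ ≤ 0) : ∃ t : ℝ, 0 < t ∧ x + t • u ∈ polarSet A := by
  have : ∀ᶠ t in 𝓝[>] (0 : ℝ), ∀ j, ⟪A j, x + t • u⟫_ℝ ≤ 1 := by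
    refine eventually_all.2 fun j => ?_
    rcases (hx j).lt_or_eq with h | h
    · have hc : Continuous fun t : ℝ => ⟪A j, x + t • u⟫_ℝ := by fun_prop
      have := (hc.continuousAt (x := 0)).eventually_lt_const (u := 1) (by simpa using h)
      filter_upwards [nhdsWithin_le_nhds this] with t ht using ht.le
    · filter_upwards [self_mem_nhdsWithin] with t ht
      rw [inner_add_right, inner_smul_right, h]
      nlinarith [hu j h, mem_Ioi.1 ht]
  obtain ⟨t, ht, ht0⟩ := (this.and self_mem_nhdsWithin).exists
  exact ⟨t, ht0, ht⟩

/-- The constraints which are tight at an extreme point of a polyhedron separate directions. -/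
lemma eq_zero_of_mem_extremePoints [Finite κ] {A : κ → E} {x u : E}
    (hx : x ∈ (polarSet A).extremePoints ℝ) (hu : ∀ j, ⟪A j, x⟫_ℝ = 1 → ⟪A j, u⟫_ℝ = 0) :
    u = 0 := by
  obtain ⟨s, hs, hs'⟩ := exists_add_smul_mem_polarSet (u := u) hx.1 fun j hj => (hu j hj).le
  obtain ⟨t, ht, ht'⟩ := exists_add_smul_mem_polarSet (u := -u) hx.1
    fun j hj => by simp [hu j hj]
  have hseg : x ∈ openSegment ℝ (x + s • u) (x + t • -u) := by
    refine ⟨t / (s + t), s / (s + t), by positivity, by positivity, by field_simp; ring, ?_⟩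
    have : (t / (s + t) + s / (s + t)) = 1 := by field_simp; ring
    have h2 : t / (s + t) * s - s / (s + t) * t = 0 := by ring
    calc _ = (t / (s + t) + s / (s + t)) • x + (t / (s + t) * s - s / (s + t) * t) • u := by
          module
      _ = x := by rw [this, h2]; simp
  have := hx.2 hs' ht' hseg
  simpa [hs.ne'] using this

/-- Converse to `eq_zero_of_mem_extremePoints`. -/
lemma mem_extremePoints_of_tight {A : κ → E} {x : E} (hx : x ∈ polarSet A)
    (hu : ∀ u, (∀ j, ⟪A j, x⟫_ℝ = 1 → ⟪A j, u⟫_ℝ = 0) → u = 0) :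
    x ∈ (polarSet A).extremePoints ℝ := by
  refine ⟨hx, fun y hy z hz hxyz => ?_⟩
  obtain ⟨a, b, ha, hb, hab, rfl⟩ := hxyz
  have h : y - (a • y + b • z) = 0 := by
    refine hu _ fun j hj => ?_
    rw [inner_sub_right, hj]
    rw [inner_add_right, inner_smul_right, inner_smul_right] at hj
    have h1 := hy j
    have h2 := hz j
    have : b * ⟪A j, z⟫_ℝ ≤ b * 1 := mul_le_mul_of_nonneg_left h2 hb.le
    have h3 : a * ⟪A j, y⟫_ℝ ≥ a * 1 := by linarith
    have h4 := le_of_mul_le_mul_left h3 ha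
    linarith
  exact sub_eq_zero.1 h

/-- `(V, A)` is a vertex and facet description, with incidences `inc`, of a bounded polyhedron
with the origin in its interior. Irredundancy is expressed by the last two fields: the facet normals
at a vertex separate directions, as do the vertices on a facet. -/
structure IsPolarPair (inc : ι → κ → Prop) (V : ι → E) (A : κ → E) : Prop where
  hull : convexHull ℝ (range V) = polarSet A
  inner_eq_one_iff : ∀ i j, ⟪A j, V i⟫_ℝ = 1 ↔ inc i j
  injective_left : Function.Injective V
  injective_right : Function.Injective A
  eq_zero_left : ∀ i u, (∀ j, inc i j → ⟪A j, u⟫_ℝ = 0) → u = 0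
  eq_zero_right : ∀ j u, (∀ i, inc i j → ⟪V i, u⟫_ℝ = 0) → u = 0

namespace IsPolarPair

variable {inc : ι → κ → Prop} {V : ι → E} {A : κ → E}

section

variable (h : IsPolarPair inc V A)
include h

lemma mem_polarSet (i : ι) : V i ∈ polarSet A :=
  h.hull ▸ subset_convexHull ℝ _ ⟨i, rfl⟩

lemma inner_le (i : ι) (j : κ) : ⟪A j, V i⟫_ℝ ≤ 1 := h.mem_polarSet i j

lemma inner_lt {i : ι} {j : κ} (hij : ¬ inc i j) : ⟪A j, V i⟫_ℝ < 1 :=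
  lt_of_le_of_ne (h.inner_le i j) fun he => hij ((h.inner_eq_one_iff i j).1 he)

lemma inner_eq {i : ι} {j : κ} (hij : inc i j) : ⟪A j, V i⟫_ℝ = 1 :=
  (h.inner_eq_one_iff i j).2 hij

lemma nonempty_left : Nonempty ι := by
  have h0 : (0 : E) ∈ convexHull ℝ (range V) := h.hull ▸ zero_mem_polarSet A
  have := convexHull_nonempty_iff.1 ⟨_, h0⟩
  exact range_nonempty_iff_nonempty.1 this

lemma exists_inc_left [Nontrivial E] (i : ι) : ∃ j, inc i j := by
  by_contra! hcon
  obtain ⟨u, hu⟩ := exists_ne (0 : E)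
  exact hu (h.eq_zero_left i u fun j hj => absurd hj (hcon j))

lemma exists_inc_right [Nontrivial E] (j : κ) : ∃ i, inc i j := by
  by_contra! hcon
  obtain ⟨u, hu⟩ := exists_ne (0 : E)
  exact hu (h.eq_zero_right j u fun i hj => absurd hj (hcon i))

lemma isCompact [Finite ι] : IsCompact (polarSet A) :=
  h.hull ▸ (finite_range V).isCompact_convexHull ℝ

/-- Some vertex lies on all the facets through a given point of the polytope. -/
lemma exists_vertex [Fintype ι] {x : E} (hx : x ∈ polarSet A) :
    ∃ i, ∀ j, ⟪A j, x⟫_ℝ = 1 → inc i j := by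
  obtain ⟨w, -, h1, -, h3⟩ := exists_weights (h.hull ▸ hx)
  obtain ⟨i, hi⟩ := exists_weight_ne_zero h1
  exact ⟨i, fun j hj => (h.inner_eq_one_iff i j).1 (h3 i hi _ _ (fun i => h.inner_le i j) hj)⟩

/-- If a point other than `V i` lies on some facets, these contain a vertex other than `V i`. -/
lemma exists_vertex_ne [Fintype ι] {x : E} (hx : x ∈ polarSet A) {i : ι} (hne : x ≠ V i) :
    ∃ i' ≠ i, ∀ j, ⟪A j, x⟫_ℝ = 1 → inc i' j := by
  classical
  obtain ⟨w, -, h1, hx, h3⟩ := exists_weights (h.hull ▸ hx)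
  by_cases hw : ∃ i' ≠ i, w i' ≠ 0
  · obtain ⟨i', hi', hw⟩ := hw
    exact ⟨i', hi', fun j hj =>
      (h.inner_eq_one_iff i' j).1 (h3 i' hw _ _ (fun i => h.inner_le i j) hj)⟩
  · push Not at hw
    rw [Fintype.sum_eq_single i hw] at h1
    rw [Fintype.sum_eq_single i (fun i' hi' => by rw [hw i' hi', zero_smul]), h1, one_smul] at hx
    exact absurd hx.symm hne

/-- **Polarity.** Exchanging vertices and facet normals gives the description of the polar. -/
theorem swap [FiniteDimensional ℝ E] [Nontrivial E] [Finite ι] [Finite κ] :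
    IsPolarPair (fun j i => inc i j) A V where
  hull := by
    refine Subset.antisymm ?_ ?_
    · refine convexHull_min ?_ (convex_polarSet V)
      rintro _ ⟨j, rfl⟩ i
      rw [real_inner_comm]
      exact h.inner_le i j
    · intro y hy
      by_contra hyA
      obtain ⟨l, u, hlt, huy⟩ := geometric_hahn_banach_closed_point (convex_convexHull ℝ (range A))
        ((finite_range A).isClosed_convexHull ℝ) hyA
      let z := (InnerProductSpace.toDual ℝ E).symm l
      have hz : ∀ v, ⟪z, v⟫_ℝ = l v := fun v => InnerProductSpace.toDual_symm_apply
      have hzA : ∀ j, ⟪A j, z⟫_ℝ < u := fun j => by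
        rw [real_inner_comm, hz]
        exact hlt _ (subset_convexHull ℝ _ ⟨j, rfl⟩)
      have hyV : ∀ x ∈ polarSet A, ⟪x, y⟫_ℝ ≤ 1 := by
        intro x hx
        rw [← h.hull] at hx
        refine convexHull_min (t := {x | ⟪x, y⟫_ℝ ≤ 1}) ?_ ?_ hx
        · rintro _ ⟨i, rfl⟩
          exact hy i
        · have : {x | ⟪x, y⟫_ℝ ≤ 1} = {x | innerSL ℝ y x ≤ 1} := by
            ext x
            simp [real_inner_comm]
          rw [this]
          exact convex_halfSpace_le (innerSL ℝ y).toLinearMap.isLinear 1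
      rcases lt_or_ge 0 u with hu | hu
      · have := hyV (u⁻¹ • z) fun j => by
          rw [inner_smul_right, inv_mul_le_iff₀ hu]
          simpa using (hzA j).le
        rw [real_inner_smul_left, inv_mul_le_iff₀ hu, hz] at this
        linarith
      · -- otherwise the polytope contains the ray spanned by `z`
        have hray : ∀ t : ℝ, 0 ≤ t → t • z ∈ polarSet A := by
          intro t ht j
          rw [inner_smul_right]
          nlinarith [hzA j]
        obtain ⟨i⟩ := h.nonempty_left
        obtain ⟨j, -⟩ := h.exists_inc_left i
        have hz0 : z ≠ 0 := by
          intro h0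
          have := hzA j
          rw [h0, inner_zero_right] at this
          linarith
        obtain ⟨R, hR⟩ := h.isCompact.isBounded.exists_norm_le
        have h1 := hR _ (hray ((|R| + 1) / ‖z‖) (by positivity))
        rw [norm_smul, Real.norm_of_nonneg (by positivity),
          div_mul_cancel₀ _ (norm_ne_zero_iff.2 hz0)] at h1
        linarith [le_abs_self R]
  inner_eq_one_iff j i := by rw [real_inner_comm, h.inner_eq_one_iff]
  injective_left := h.injective_right
  injective_right := h.injective_left
  eq_zero_left := h.eq_zero_right
  eq_zero_right := h.eq_zero_left

/-- Points on all facets through a vertex coincide with the vertex. -/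
lemma eq_vertex {x : E} {i : ι} (hx : ∀ j, inc i j → ⟪A j, x⟫_ℝ = 1) : x = V i := by
  refine sub_eq_zero.1 (h.eq_zero_left i _ fun j hj => ?_)
  rw [inner_sub_right, hx j hj, h.inner_eq hj, sub_self]

/-- Vectors with all vertices of a facet on the hyperplane `⟪y, ·⟫ = 1` coincide with the normal of
the facet. -/
lemma eq_normal {y : E} {j : κ} (hy : ∀ i, inc i j → ⟪V i, y⟫_ℝ = 1) : y = A j := by
  refine sub_eq_zero.1 (h.eq_zero_right j _ fun i hi => ?_)
  rw [inner_sub_right, hy i hi, real_inner_comm, h.inner_eq hi, sub_self]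

end

end IsPolarPair

end PolarPair

/-! ### Faces -/

section Faces

variable {E : Type*} [NormedAddCommGroup E] [InnerProductSpace ℝ E]
variable {ι κ : Type*}

/-- A nonempty proper face of a convex body with the origin in its interior is cut out by a
supporting hyperplane `⟪y, ·⟫ = 1`. -/
lemma eq_self_or_exists_of_isExposed [CompleteSpace E] {Q F : Set E} (h0 : (0 : E) ∈ interior Q)
    (hF : IsExposed ℝ Q F) (hne : F.Nonempty) :
    F = Q ∨ ∃ y : E, (∀ x ∈ Q, ⟪y, x⟫_ℝ ≤ 1) ∧ F = {x ∈ Q | ⟪y, x⟫_ℝ = 1} := by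
  obtain ⟨l, hl⟩ := hF hne
  obtain ⟨x0, hx0⟩ := hne
  let z := (InnerProductSpace.toDual ℝ E).symm l
  have hz : ∀ v, ⟪z, v⟫_ℝ = l v := fun v => InnerProductSpace.toDual_symm_apply
  rw [hl] at hx0
  by_cases hz0 : z = 0
  · left
    rw [hl]
    refine Subset.antisymm (fun x hx => hx.1) fun x hx => ⟨hx, fun y _ => ?_⟩
    rw [← hz, ← hz, hz0]
    simp
  · right
    have hM : 0 < l x0 := by
      have hc : ContinuousAt (fun t : ℝ => t • z) 0 := by fun_prop
      have h1 : ∀ᶠ t in 𝓝 (0 : ℝ), t • z ∈ Q := by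
        refine hc.eventually_mem ?_
        simpa using mem_interior_iff_mem_nhds.1 h0
      obtain ⟨t, ht, htp⟩ := ((h1.filter_mono nhdsWithin_le_nhds).and
        (self_mem_nhdsWithin (s := Ioi (0 : ℝ)))).exists
      have h2 := hx0.2 _ ht
      rw [← hz, inner_smul_right, real_inner_self_eq_norm_sq] at h2
      have : 0 < ‖z‖ := norm_pos_iff.2 hz0
      have htp' : (0 : ℝ) < t := htp
      have : 0 < t * ‖z‖ ^ 2 := by positivity
      linarith
    have hy : ∀ v, ⟪(l x0)⁻¹ • z, v⟫_ℝ = (l x0)⁻¹ * l v := fun v => by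
      rw [real_inner_smul_left, hz]
    refine ⟨(l x0)⁻¹ • z, fun x hx => ?_, ?_⟩
    · rw [hy, inv_mul_le_iff₀ hM, mul_one]
      exact hx0.2 x hx
    · rw [hl]
      ext x
      simp only [mem_ofPred_eq, hy, and_congr_right_iff]
      intro hx
      rw [inv_mul_eq_iff_eq_mul₀ hM.ne', mul_one]
      exact ⟨fun h => le_antisymm (hx0.2 x hx) (h x0 hx0.1), fun h y hy => h ▸ hx0.2 y hy⟩

/-- The points of a set at which given valid inequalities are tight form a face. -/
lemma isExposed_tight [Finite κ] {Q : Set E} {A : κ → E} (hQ : Q ⊆ polarSet A) (s : Set κ) :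
    IsExposed ℝ Q {x ∈ Q | ∀ j ∈ s, ⟪A j, x⟫_ℝ = 1} := by
  classical
  have := Fintype.ofFinite κ
  rintro ⟨x0, hx0, hx0'⟩
  refine ⟨innerSL ℝ (∑ j with j ∈ s, A j), ?_⟩
  have hval : ∀ x, innerSL ℝ (∑ j with j ∈ s, A j) x = ∑ j with j ∈ s, ⟪A j, x⟫_ℝ := by
    intro x
    rw [innerSL_apply_apply, sum_inner]
  have hle : ∀ x ∈ Q, ∑ j with j ∈ s, ⟪A j, x⟫_ℝ ≤ ∑ j with j ∈ s, (1 : ℝ) :=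
    fun x hx => Finset.sum_le_sum fun j _ => hQ hx j
  have heq : ∀ x, (∀ j ∈ s, ⟪A j, x⟫_ℝ = 1) →
      ∑ j with j ∈ s, ⟪A j, x⟫_ℝ = ∑ j with j ∈ s, (1 : ℝ) :=
    fun x hx => Finset.sum_congr rfl fun j hj => hx j (by simpa using hj)
  ext x
  simp only [mem_ofPred_eq, and_congr_right_iff, hval]
  intro hx
  constructor
  · intro h y hy
    rw [heq x h]
    exact hle y hy
  · intro h j hj
    have h1 := h x0 hx0
    rw [heq x0 hx0'] at h1
    have h2 := (Finset.sum_eq_sum_iff_of_le (s := Finset.univ.filter (· ∈ s))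
      (fun j _ => hQ hx j)).1 (le_antisymm (hle x hx) h1)
    exact h2 j (by simpa using hj)

/-- A face of a polytope is the convex hull of the vertices it contains. -/
lemma eq_convexHull_of_isExposed [CompleteSpace E] [Finite ι] {V : ι → E} {F : Set E}
    (hF : IsExposed ℝ (convexHull ℝ (range V)) F) : F = convexHull ℝ (V '' {i | V i ∈ F}) := by
  have := Fintype.ofFinite ι
  refine Subset.antisymm (fun x hx => ?_)
    (convexHull_min (by rintro _ ⟨i, hi, rfl⟩; exact hi) (hF.convex (convex_convexHull ℝ _)))
  obtain ⟨l, hl⟩ := hF ⟨x, hx⟩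
  let z := (InnerProductSpace.toDual ℝ E).symm l
  have hz : ∀ v, ⟪z, v⟫_ℝ = l v := fun v => InnerProductSpace.toDual_symm_apply
  have hx' := hx
  rw [hl] at hx'
  have hV : ∀ i, V i ∈ convexHull ℝ (range V) := fun i => subset_convexHull ℝ _ ⟨i, rfl⟩
  obtain ⟨w, h0, h1, hwx, hw⟩ := exists_weights hx'.1
  rw [← hwx]
  refine sum_smul_mem_convexHull_image h0 h1 fun i hi => ?_
  have := hw i hi z (l x) (fun i => by rw [hz]; exact hx'.2 _ (hV i)) (hz x)
  rw [mem_ofPred_eq, hl]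
  exact ⟨hV i, fun y hy => by rw [← hz (V i), this]; exact hx'.2 y hy⟩

/-- Sets of vertices which are cut out by a set of facets. These are the vertex sets of the
faces. -/
def IsClosedVertexSet (inc : ι → κ → Prop) (s : Set ι) : Prop :=
  ∀ i, (∀ j, (∀ i' ∈ s, inc i' j) → inc i j) → i ∈ s

namespace IsPolarPair

variable {inc : ι → κ → Prop} {V : ι → E} {A : κ → E} (h : IsPolarPair inc V A)
include h

lemma eq_convexHull [CompleteSpace E] [Finite ι] {F : Set E} (hF : IsExposed ℝ (polarSet A) F) :
    F = convexHull ℝ (V '' {i | V i ∈ F}) :=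
  eq_convexHull_of_isExposed (h.hull ▸ hF)

lemma subset_iff [CompleteSpace E] [Finite ι] {F F' : Set E} (hF : IsExposed ℝ (polarSet A) F)
    (hF' : IsExposed ℝ (polarSet A) F') : F ⊆ F' ↔ {i | V i ∈ F} ⊆ {i | V i ∈ F'} := by
  refine ⟨fun hs i hi => hs hi, fun hs => ?_⟩
  rw [h.eq_convexHull hF, h.eq_convexHull hF']
  exact convexHull_mono (image_mono hs)

/-- The functional cutting out a face is a convex combination of facet normals, and those which
occur in it are normals of facets containing the face. -/
lemma isClosedVertexSet [FiniteDimensional ℝ E] [Nontrivial E] [Finite ι] [Finite κ] {F : Set E}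
    (hF : IsExposed ℝ (polarSet A) F) : IsClosedVertexSet inc {i | V i ∈ F} := by
  have := Fintype.ofFinite κ
  intro i hi
  have key : ∀ y : E, y ∈ convexHull ℝ (range A) → (∀ i', V i' ∈ F → ⟪y, V i'⟫_ℝ = 1) →
      ⟪y, V i⟫_ℝ = 1 := by
    intro y hy hyF
    obtain ⟨w, h0, h1, hwy, hw⟩ := exists_weights hy
    rw [← hwy, sum_inner]
    have : ∀ j, ⟪w j • A j, V i⟫_ℝ = w j := by
      intro j
      rw [real_inner_smul_left]
      by_cases hj : w j = 0
      · simp [hj]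
      · rw [h.inner_eq (hi j fun i' hi' => ?_), mul_one]
        rw [← h.inner_eq_one_iff, real_inner_comm]
        refine hw j hj (V i') 1 (fun j => ?_) ?_
        · rw [real_inner_comm]
          exact h.inner_le i' j
        · rw [real_inner_comm]
          exact hyF i' hi'
    simp_rw [this, h1]
  rcases F.eq_empty_or_nonempty with rfl | hne
  · -- the origin is a convex combination of the facet normals, so no point is on all facets
    have := key 0 (h.swap.hull ▸ zero_mem_polarSet V) (by simp)
    simp at this
  · rcases eq_self_or_exists_of_isExposed (zero_mem_interior_polarSet A) hF hne with
      rfl | ⟨y, hy, rfl⟩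
    · exact h.mem_polarSet i
    · refine ⟨h.mem_polarSet i, key y ?_ fun i' hi' => hi'.2⟩
      rw [h.swap.hull]
      intro i'
      rw [real_inner_comm]
      exact hy _ (h.mem_polarSet i')

omit h in
lemma exists_face [Finite κ] (h : IsPolarPair inc V A) {s : Set ι} (hs : IsClosedVertexSet inc s) :
    ∃ F, IsExposed ℝ (polarSet A) F ∧ {i | V i ∈ F} = s := by
  refine ⟨_, isExposed_tight Subset.rfl {j | ∀ i ∈ s, inc i j}, ?_⟩
  ext i
  simp only [mem_ofPred_eq, h.mem_polarSet i, true_and, h.inner_eq_one_iff]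
  exact ⟨fun hi => hs i hi, fun hi j hj => hj i hi⟩

lemma isExposed_singleton [Finite κ] (i : ι) : IsExposed ℝ (polarSet A) {V i} := by
  convert isExposed_tight (Subset.rfl : polarSet A ⊆ polarSet A) {j | inc i j}
  ext x
  simp only [mem_singleton_iff, mem_ofPred_eq]
  constructor
  · rintro rfl
    exact ⟨h.mem_polarSet i, fun j hj => h.inner_eq hj⟩
  · rintro ⟨-, hx⟩
    exact h.eq_vertex hx

end IsPolarPair

end Faces

/-! ### Dimensions of faces -/

section FaceDim

variable {d : ℕ}

lemma faceDim_eq_zero_iff {F : Set (EuclideanSpace ℝ (Fin d))} :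
    faceDim F = 0 ↔ ∃ x, F = {x} := by
  constructor
  · intro h
    unfold faceDim at h
    split_ifs at h with hne
    · obtain ⟨x, hx⟩ := hne
      refine ⟨x, Subset.antisymm (fun y hy => ?_) (by simpa using hx)⟩
      have h0 : vectorSpan ℝ F = ⊥ := Submodule.finrank_eq_zero.1 (by exact_mod_cast h)
      have := vsub_mem_vectorSpan ℝ hy hx
      rw [h0, Submodule.mem_bot, vsub_eq_sub, sub_eq_zero] at this
      exact this
  · rintro ⟨x, rfl⟩
    simp [faceDim]

lemma faceDim_nonneg_iff {F : Set (EuclideanSpace ℝ (Fin d))} : 0 ≤ faceDim F ↔ F.Nonempty := by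
  unfold faceDim
  split_ifs with h <;> simp [h]

lemma faceDim_eq_of_zero_mem_interior {Q : Set (EuclideanSpace ℝ (Fin d))}
    (h0 : (0 : EuclideanSpace ℝ (Fin d)) ∈ interior Q) : faceDim Q = d := by
  have hne : Q.Nonempty := ⟨0, interior_subset h0⟩
  have h1 : affineSpan ℝ Q = ⊤ := by
    have h2 := (isOpen_interior (s := Q)).affineSpan_eq_top ⟨0, h0⟩
    exact top_le_iff.1 (h2 ▸ affineSpan_mono ℝ interior_subset)
  have h2 : vectorSpan ℝ Q = ⊤ := by
    rw [← direction_affineSpan, h1, AffineSubspace.direction_top]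
  rw [faceDim, if_pos hne, h2, finrank_top]
  simp

/-- A set in a hyperplane off the origin has codimension one iff it spans the space. -/
lemma faceDim_eq_sub_one_iff {F : Set (EuclideanSpace ℝ (Fin d))} {y : EuclideanSpace ℝ (Fin d)}
    (hF : ∀ x ∈ F, ⟪y, x⟫_ℝ = 1) (hne : F.Nonempty) :
    faceDim F = d - 1 ↔ ∀ u, (∀ x ∈ F, ⟪x, u⟫_ℝ = 0) → u = 0 := by
  obtain ⟨x0, hx0⟩ := hne
  have hdim : finrank ℝ (EuclideanSpace ℝ (Fin d)) = d := by simp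
  have hy : ∀ v ∈ vectorSpan ℝ F, ⟪y, v⟫_ℝ = 0 := by
    have : vectorSpan ℝ F ≤ LinearMap.ker (innerSL ℝ y).toLinearMap := by
      refine Submodule.span_le.2 ?_
      rintro _ ⟨a, ha, b, hb, rfl⟩
      simp [inner_sub_right, hF a ha, hF b hb]
    intro v hv
    simpa using this hv
  have hx0' : x0 ∉ vectorSpan ℝ F := fun hm => by
    have := hy x0 hm
    rw [hF x0 hx0] at this
    norm_num at this
  have hspan : Submodule.span ℝ F = vectorSpan ℝ F ⊔ Submodule.span ℝ {x0} := by
    refine le_antisymm (Submodule.span_le.2 fun x hx => ?_) (sup_le ?_ ?_)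
    · have h1 := vsub_mem_vectorSpan ℝ hx hx0
      rw [vsub_eq_sub] at h1
      rw [SetLike.mem_coe, ← sub_add_cancel x x0]
      exact Submodule.add_mem_sup h1 (Submodule.mem_span_singleton_self x0)
    · refine Submodule.span_le.2 ?_
      rintro _ ⟨a, ha, b, hb, rfl⟩
      exact Submodule.sub_mem _ (Submodule.subset_span ha) (Submodule.subset_span hb)
    · exact Submodule.span_mono (by simpa using hx0)
  have hlt : finrank ℝ (vectorSpan ℝ F) + 1 = finrank ℝ (Submodule.span ℝ F) := by
    refine le_antisymm ?_ ?_
    · refine Submodule.finrank_lt_finrank_of_lt (lt_of_le_of_ne (hspan ▸ le_sup_left) fun he => ?_)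
      exact hx0' (he ▸ Submodule.subset_span hx0)
    · rw [hspan]
      refine (Submodule.finrank_add_le_finrank_add_finrank _ _).trans ?_
      exact Nat.add_le_add_left ((finrank_span_le_card _).trans (by simp)) _
  have hiff : (∀ u, (∀ x ∈ F, ⟪x, u⟫_ℝ = 0) → u = 0) ↔ Submodule.span ℝ F = ⊤ := by
    rw [← Submodule.orthogonal_eq_bot_iff, Submodule.eq_bot_iff]
    refine forall_congr' fun u => ?_
    rw [Submodule.mem_orthogonal]
    refine imp_congr ⟨fun hu v hv => ?_, fun hu x hx => hu x (Submodule.subset_span hx)⟩ Iff.rfl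
    induction hv using Submodule.span_induction with
    | mem x hx => exact hu x hx
    | zero => simp
    | add a b _ _ ha hb => rw [inner_add_left, ha, hb, add_zero]
    | smul c a _ ha => rw [real_inner_smul_left, ha, mul_zero]
  rw [hiff]
  have hfd : faceDim F = finrank ℝ (vectorSpan ℝ F) := if_pos ⟨x0, hx0⟩
  rw [hfd]
  constructor
  · intro h
    refine Submodule.eq_top_of_finrank_eq ?_
    rw [hdim]
    omega
  · intro h
    rw [h, finrank_top, hdim] at hlt
    omega

end FaceDim

/-! ### Labeled polytopes and polar pairs -/

section Labeled

variable {d n m : ℕ}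

instance [NeZero d] : Nontrivial (EuclideanSpace ℝ (Fin d)) :=
  Module.nontrivial_of_finrank_pos (R := ℝ) (by simpa using NeZero.pos d)

namespace IsPolarPair

variable {inc : Fin n → Fin m → Prop} {V : Fin n → EuclideanSpace ℝ (Fin d)}
  {A : Fin m → EuclideanSpace ℝ (Fin d)}

lemma facet_nonempty [NeZero d] (h : IsPolarPair inc V A) (j : Fin m) :
    {x ∈ polarSet A | ⟪A j, x⟫_ℝ = 1}.Nonempty := by
  obtain ⟨i, hi⟩ := h.exists_inc_right j
  exact ⟨V i, h.mem_polarSet i, h.inner_eq hi⟩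

lemma isExposed_facet (j : Fin m) :
    IsExposed ℝ (polarSet A) {x ∈ polarSet A | ⟪A j, x⟫_ℝ = 1} := by
  simpa using isExposed_tight (Subset.rfl : polarSet A ⊆ polarSet A) {j}

lemma facet_mem_facesOfDim [NeZero d] (h : IsPolarPair inc V A) (j : Fin m) :
    {x ∈ polarSet A | ⟪A j, x⟫_ℝ = 1} ∈ facesOfDim (polarSet A) (d - 1) := by
  refine ⟨isExposed_facet j, ?_⟩
  rw [faceDim_eq_sub_one_iff (fun x hx => hx.2) (h.facet_nonempty j)]
  exact fun u hu => h.eq_zero_right j u fun i hi => hu _ ⟨h.mem_polarSet i, h.inner_eq hi⟩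

/-- Every facet is cut out by one of the `A j`: its normal is an extreme point of the polar. -/
lemma exists_facet_eq [NeZero d] (h : IsPolarPair inc V A) {F : Set (EuclideanSpace ℝ (Fin d))}
    (hF : F ∈ facesOfDim (polarSet A) (d - 1)) :
    ∃ j, {x ∈ polarSet A | ⟪A j, x⟫_ℝ = 1} = F := by
  obtain ⟨hF, hd⟩ := hF
  have hF : IsExposed ℝ (polarSet A) F := hF
  have hd0 : (0 : ℤ) < d := by exact_mod_cast NeZero.pos d
  have hne : F.Nonempty := faceDim_nonneg_iff.1 (by omega)
  rcases eq_self_or_exists_of_isExposed (zero_mem_interior_polarSet A) hF hne with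
    rfl | ⟨y, hy, hFy⟩
  · rw [faceDim_eq_of_zero_mem_interior (zero_mem_interior_polarSet A)] at hd
    omega
  · have hyV : y ∈ polarSet V := fun i => by
      rw [real_inner_comm]
      exact hy _ (h.mem_polarSet i)
    have hyF : ∀ x ∈ F, ⟪y, x⟫_ℝ = 1 := by
      rw [hFy]
      exact fun x hx => hx.2
    have hext : y ∈ (polarSet V).extremePoints ℝ := by
      refine mem_extremePoints_of_tight hyV fun u hu => ?_
      refine (faceDim_eq_sub_one_iff hyF hne).1 hd u fun x hx => ?_
      rw [h.eq_convexHull hF] at hx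
      have hsub : convexHull ℝ (V '' {i | V i ∈ F}) ⊆ {x | innerSL ℝ u x = 0} := by
        refine convexHull_min ?_ (convex_hyperplane (innerSL ℝ u).toLinearMap.isLinear 0)
        rintro _ ⟨i, hi, rfl⟩
        have := hu i (by rw [real_inner_comm]; exact hyF _ hi)
        simpa [real_inner_comm] using this
      simpa [real_inner_comm] using hsub hx
    rw [← h.swap.hull] at hext
    obtain ⟨j, rfl⟩ := extremePoints_convexHull_subset hext
    exact ⟨j, hFy.symm⟩

/-- The labeled polytope described by a polar pair. -/
def toLabeledPolytope [NeZero d] (h : IsPolarPair inc V A) : LabeledPolytope d n m where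
  carrier := polarSet A
  isFullPolytope := ⟨⟨range V, finite_range V, h.hull.symm⟩,
    faceDim_eq_of_zero_mem_interior (zero_mem_interior_polarSet A)⟩
  vertex := V
  vertex_injective := h.injective_left
  range_vertex := by
    refine Subset.antisymm ?_ ?_
    · rintro _ ⟨i, rfl⟩
      exact ⟨h.isExposed_singleton i, faceDim_eq_zero_iff.2 ⟨_, rfl⟩⟩
    · rintro F ⟨hF, hd⟩
      obtain ⟨x, rfl⟩ := faceDim_eq_zero_iff.1 hd
      have hx : x ∈ (polarSet A).extremePoints ℝ :=
        isExtreme_singleton.1 (IsExposed.isExtreme hF)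
      rw [← h.hull] at hx
      obtain ⟨i, rfl⟩ := extremePoints_convexHull_subset hx
      exact ⟨i, rfl⟩
  facet := fun j => {x ∈ polarSet A | ⟪A j, x⟫_ℝ = 1}
  facet_injective := by
    intro j j' hjj'
    refine h.injective_right (h.eq_normal fun i hi => ?_)
    have := (Set.ext_iff.1 hjj' (V i)).2 ⟨h.mem_polarSet i, h.inner_eq hi⟩
    rw [real_inner_comm]
    exact this.2
  range_facet := by
    refine Subset.antisymm ?_ fun F hF => h.exists_facet_eq hF
    rintro _ ⟨j, rfl⟩
    exact h.facet_mem_facesOfDim j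

lemma isCentered_toLabeledPolytope [NeZero d] (h : IsPolarPair inc V A) :
    h.toLabeledPolytope.IsCentered := zero_mem_interior_polarSet A

lemma isDescribedBy_toLabeledPolytope [NeZero d] (h : IsPolarPair inc V A) :
    h.toLabeledPolytope.IsDescribedBy V A :=
  ⟨h.hull.symm, rfl, fun _ => rfl, fun _ => rfl⟩

/-- The face lattice embeds into the lattice of sets of vertices. -/
def faceEmbedding (h : IsPolarPair inc V A) : faces (polarSet A) ↪o Set (Fin n) :=
  OrderEmbedding.ofMapLEIff (fun F => {i | V i ∈ F.1}) fun F F' => (h.subset_iff F.2 F'.2).symm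

lemma range_faceEmbedding [NeZero d] (h : IsPolarPair inc V A) :
    range h.faceEmbedding = {s | IsClosedVertexSet inc s} := by
  refine Subset.antisymm ?_ fun s hs => ?_
  · rintro _ ⟨F, rfl⟩
    exact h.isClosedVertexSet F.2
  · obtain ⟨F, hF, rfl⟩ := h.exists_face hs
    exact ⟨⟨F, hF⟩, rfl⟩

/-- The face lattice is determined by the incidences between vertices and facets. -/
theorem exists_faces_orderIso [NeZero d] {V' : Fin n → EuclideanSpace ℝ (Fin d)}
    {A' : Fin m → EuclideanSpace ℝ (Fin d)} (h : IsPolarPair inc V A) (h' : IsPolarPair inc V' A') :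
    ∃ φ : faces (polarSet A) ≃o faces (polarSet A'), ∀ F i, V' i ∈ (φ F).1 ↔ V i ∈ F.1 := by
  have e : range h.faceEmbedding = range h'.faceEmbedding := by
    rw [h.range_faceEmbedding, h'.range_faceEmbedding]
  refine ⟨(h.faceEmbedding.orderIso.trans (OrderIso.setCongr _ _ e)).trans
    h'.faceEmbedding.orderIso.symm, fun F i => ?_⟩
  set G := h'.faceEmbedding.orderIso.symm
    (OrderIso.setCongr _ _ e (h.faceEmbedding.orderIso F)) with hG
  have h1 : h'.faceEmbedding.orderIso G = OrderIso.setCongr _ _ e (h.faceEmbedding.orderIso F) := by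
    rw [hG, OrderIso.apply_symm_apply]
  have h2 : h'.faceEmbedding G = h.faceEmbedding F := congrArg Subtype.val h1
  exact Set.ext_iff.1 h2 i

end IsPolarPair

namespace LabeledPolytope

/-- Incidence of vertices and facets, in terms of their labels. -/
def Inc (P : LabeledPolytope d n m) (i : Fin n) (j : Fin m) : Prop := P.vertex i ∈ P.facet j

lemma isExposed_vertex (P : LabeledPolytope d n m) (i : Fin n) :
    IsExposed ℝ P.carrier {P.vertex i} := (P.range_vertex.subset ⟨i, rfl⟩).1

lemma facet_mem (P : LabeledPolytope d n m) (j : Fin m) :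
    P.facet j ∈ facesOfDim P.carrier (d - 1) := P.range_facet.subset ⟨j, rfl⟩

lemma inc_iff (P : LabeledPolytope d n m) (i : Fin n) (j : Fin m) :
    P.Inc i j ↔ P.vertexFace i ≤ P.facetFace j := by
  change P.vertex i ∈ P.facet j ↔ {P.vertex i} ⊆ P.facet j
  simp

lemma Realizes.inc_iff {P Q : LabeledPolytope d n m} (h : Q.Realizes P) (i : Fin n) (j : Fin m) :
    Q.Inc i j ↔ P.Inc i j := by
  obtain ⟨φ, h1, h2⟩ := h
  rw [Q.inc_iff, P.inc_iff, ← h1, ← h2, φ.le_iff_le]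

lemma Realizes.trans {P Q R : LabeledPolytope d n m} (h : Q.Realizes P) (h' : R.Realizes Q) :
    R.Realizes P := by
  obtain ⟨φ, h1, h2⟩ := h
  obtain ⟨ψ, h3, h4⟩ := h'
  exact ⟨φ.trans ψ, fun i => by simp [h1, h3], fun j => by simp [h2, h4]⟩

/-- The vertices and facet normals of a centered polytope form a polar pair. -/
theorem IsDescribedBy.isPolarPair [NeZero d] {Q : LabeledPolytope d n m}
    {V : Fin n → EuclideanSpace ℝ (Fin d)} {A : Fin m → EuclideanSpace ℝ (Fin d)}
    (h : Q.IsDescribedBy V A) : IsPolarPair Q.Inc V A := by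
  obtain ⟨hV, hA, hv, hf⟩ := h
  have hA : Q.carrier = polarSet A := hA
  have hmem : ∀ i, V i ∈ polarSet A := fun i => by
    rw [← hA, hV]
    exact subset_convexHull ℝ _ ⟨i, rfl⟩
  have hinc : ∀ i j, ⟪A j, V i⟫_ℝ = 1 ↔ Q.Inc i j := by
    intro i j
    rw [Inc, hf, hv, hA]
    exact ⟨fun h => ⟨hmem i, h⟩, fun h => h.2⟩
  refine ⟨by rw [← hV, hA], hinc, ?_, ?_, ?_, ?_⟩
  · intro i i' hi
    exact Q.vertex_injective (by rw [hv, hv, hi])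
  · intro j j' hj
    exact Q.facet_injective (by rw [hf, hf, hj])
  · intro i u hu
    have hx : V i ∈ (polarSet A).extremePoints ℝ := by
      rw [← hv, ← hA]
      exact isExtreme_singleton.1 (Q.isExposed_vertex i).isExtreme
    exact eq_zero_of_mem_extremePoints hx fun j hj => hu j ((hinc i j).1 hj)
  · intro j u hu
    obtain ⟨hF, hd⟩ := Q.facet_mem j
    have hF : IsExposed ℝ Q.carrier (Q.facet j) := hF
    have hd0 : (0 : ℤ) < d := by exact_mod_cast NeZero.pos d
    have hne : (Q.facet j).Nonempty := faceDim_nonneg_iff.1 (by omega)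
    refine (faceDim_eq_sub_one_iff (y := A j) (fun x hx => ?_) hne).1 hd u fun x hx => ?_
    · rw [hf] at hx
      exact hx.2
    · rw [hV] at hF
      rw [eq_convexHull_of_isExposed hF] at hx
      have hsub : convexHull ℝ (V '' {i | V i ∈ Q.facet j}) ⊆ {x | innerSL ℝ u x = 0} := by
        refine convexHull_min ?_ (convex_hyperplane (innerSL ℝ u).toLinearMap.isLinear 0)
        rintro _ ⟨i, hi, rfl⟩
        have := hu i (by rw [Inc, hv]; exact hi)
        simpa [real_inner_comm] using this
      simpa [real_inner_comm] using hsub hx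

/-- Centered polytopes with the same incidences realize each other. -/
theorem IsDescribedBy.realizes [NeZero d] {P Q : LabeledPolytope d n m}
    {V V' : Fin n → EuclideanSpace ℝ (Fin d)} {A A' : Fin m → EuclideanSpace ℝ (Fin d)}
    (hP : P.IsDescribedBy V A) (hQ : Q.IsDescribedBy V' A') (hPQ : ∀ i j, Q.Inc i j ↔ P.Inc i j) :
    Q.Realizes P := by
  have h := hP.isPolarPair
  have h' := hQ.isPolarPair
  have e : Q.Inc = P.Inc := by
    ext i j
    exact hPQ i j
  rw [e] at h'
  have hPA : P.carrier = polarSet A := hP.2.1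
  have hQA : Q.carrier = polarSet A' := hQ.2.1
  obtain ⟨φ, hφ⟩ : ∃ φ : faces P.carrier ≃o faces Q.carrier, ∀ F i, V' i ∈ (φ F).1 ↔ V i ∈ F.1 := by
    rw [hPA, hQA]
    exact h.exists_faces_orderIso h'
  have key : ∀ F F' : faces Q.carrier, (∀ i, V' i ∈ F.1 ↔ V' i ∈ F'.1) → F = F' := by
    intro F F' hFF
    have h1 : IsExposed ℝ (polarSet A') F.1 := hQA ▸ F.2
    have h2 : IsExposed ℝ (polarSet A') F'.1 := hQA ▸ F'.2
    refine Subtype.ext (Subset.antisymm ?_ ?_)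
    · exact (h'.subset_iff h1 h2).2 fun i hi => (hFF i).1 hi
    · exact (h'.subset_iff h2 h1).2 fun i hi => (hFF i).2 hi
  refine ⟨φ, fun i => key _ _ fun i' => ?_, fun j => key _ _ fun i' => ?_⟩
  · rw [hφ]
    change V i' ∈ {P.vertex i} ↔ V' i' ∈ {Q.vertex i}
    rw [hP.2.2.1, hQ.2.2.1, mem_singleton_iff, mem_singleton_iff, h.injective_left.eq_iff,
      h'.injective_left.eq_iff]
  · rw [hφ]
    change V i' ∈ P.facet j ↔ V' i' ∈ Q.facet j
    rw [← hP.2.2.1, ← hQ.2.2.1]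
    exact (hPQ i' j).symm

/-- If a centered realization exists, the realization space consists of the polar pairs
with the incidences of `P`. -/
theorem mem_centeredRealizationSpace_iff [NeZero d] {P Q : LabeledPolytope d n m}
    {V V' : Fin n → EuclideanSpace ℝ (Fin d)} {A A' : Fin m → EuclideanSpace ℝ (Fin d)}
    (hQP : Q.Realizes P) (hQ : Q.IsDescribedBy V A) :
    (V', A') ∈ P.centeredRealizationSpace ↔ IsPolarPair P.Inc V' A' := by
  constructor
  · rintro ⟨R, -, hR, hRd⟩
    have := hRd.isPolarPair
    rwa [show R.Inc = P.Inc from funext₂ fun i j => propext (hR.inc_iff i j)] at this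
  · intro h
    refine ⟨h.toLabeledPolytope, h.isCentered_toLabeledPolytope, ?_,
      h.isDescribedBy_toLabeledPolytope⟩
    refine hQP.trans (hQ.realizes h.isDescribedBy_toLabeledPolytope fun i j => ?_)
    rw [hQP.inc_iff]
    change V' i ∈ {x ∈ polarSet A' | ⟪A' j, x⟫_ℝ = 1} ↔ _
    rw [← h.inner_eq_one_iff]
    exact ⟨fun h => h.2, fun hi => ⟨h.mem_polarSet i, hi⟩⟩

end LabeledPolytope

end Labeled

/-! ### Polar description of a centered polytope -/

section Existence

variable {E : Type*} [NormedAddCommGroup E] [InnerProductSpace ℝ E]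

lemma isBounded_polarSet {ι : Type*} {V : ι → E}
    (h0 : (0 : E) ∈ interior (convexHull ℝ (range V))) : Bornology.IsBounded (polarSet V) := by
  obtain ⟨r, hr, hb⟩ := Metric.mem_nhds_iff.1 (mem_interior_iff_mem_nhds.1 h0)
  refine (Metric.isBounded_closedBall (x := (0 : E)) (r := 2 / r)).subset fun y hy => ?_
  have hy' : ∀ x ∈ convexHull ℝ (range V), ⟪y, x⟫_ℝ ≤ 1 := by
    intro x hx
    have hsub : convexHull ℝ (range V) ⊆ {x | innerSL ℝ y x ≤ 1} := by
      refine convexHull_min ?_ (convex_halfSpace_le (innerSL ℝ y).toLinearMap.isLinear 1)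
      rintro _ ⟨i, rfl⟩
      simpa [real_inner_comm] using hy i
    simpa using hsub hx
  rw [mem_closedBall_zero_iff]
  by_cases hy0 : y = 0
  · rw [hy0, norm_zero]
    positivity
  have hn : 0 < ‖y‖ := norm_pos_iff.2 hy0
  have h1 := hy' ((r / 2 / ‖y‖) • y) (hb (by
    rw [mem_ball_zero_iff, norm_smul, Real.norm_of_nonneg (by positivity), div_mul_cancel₀ _ hn.ne']
    linarith))
  rw [inner_smul_right, real_inner_self_eq_norm_sq] at h1
  have h2 : r / 2 / ‖y‖ * ‖y‖ ^ 2 = r / 2 * ‖y‖ := by field_simp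
  rw [h2] at h1
  rw [le_div_iff₀ hr]
  linarith

lemma finite_extremePoints_polarSet {ι : Type*} [Finite ι] (V : ι → E) :
    ((polarSet V).extremePoints ℝ).Finite := by
  refine Set.Finite.of_injOn (f := fun y => {i | ⟪V i, y⟫_ℝ = 1}) (t := univ) (by simp [MapsTo])
    ?_ finite_univ
  intro y hy y' hy' hyy'
  refine sub_eq_zero.1 (eq_zero_of_mem_extremePoints hy fun i hi => ?_)
  have : ⟪V i, y'⟫_ℝ = 1 := (Set.ext_iff.1 hyy' i).1 hi
  rw [inner_sub_right, hi, this, sub_self]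

/-- A polytope with the origin in its interior is the intersection of the half-spaces given by the
extreme points of its polar. -/
lemma convexHull_eq_polarSet [FiniteDimensional ℝ E] {ι : Type*} [Finite ι] {V : ι → E}
    (h0 : (0 : E) ∈ interior (convexHull ℝ (range V))) :
    convexHull ℝ (range V) = polarSet (Subtype.val : (polarSet V).extremePoints ℝ → E) := by
  refine Subset.antisymm (convexHull_min ?_ (convex_polarSet _)) fun x hx => ?_
  · rintro _ ⟨i, rfl⟩ y
    rw [real_inner_comm]
    exact y.2.1 i
  · have hcomp : IsCompact (polarSet V) :=
      Metric.isCompact_of_isClosed_isBounded (isClosed_polarSet V) (isBounded_polarSet h0)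
    have hKM := closure_convexHull_extremePoints hcomp (convex_polarSet V)
    rw [((finite_extremePoints_polarSet V).isClosed_convexHull ℝ).closure_eq] at hKM
    have hxy : ∀ y ∈ polarSet V, ⟪x, y⟫_ℝ ≤ 1 := by
      intro y hy
      rw [← hKM] at hy
      have hsub : convexHull ℝ ((polarSet V).extremePoints ℝ) ⊆ {y | innerSL ℝ x y ≤ 1} := by
        refine convexHull_min ?_ (convex_halfSpace_le (innerSL ℝ x).toLinearMap.isLinear 1)
        intro y hy
        simpa [real_inner_comm] using hx ⟨y, hy⟩
      simpa using hsub hy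
    by_contra hxV
    obtain ⟨l, u, hlt, hux⟩ := geometric_hahn_banach_closed_point (convex_convexHull ℝ (range V))
      ((finite_range V).isClosed_convexHull ℝ) hxV
    have hu : 0 < u := by simpa using hlt 0 (interior_subset h0)
    let z := (InnerProductSpace.toDual ℝ E).symm l
    have hz : ∀ v, ⟪z, v⟫_ℝ = l v := fun v => InnerProductSpace.toDual_symm_apply
    have h1 := hxy (u⁻¹ • z) fun i => by
      rw [real_inner_comm, real_inner_smul_left, hz, inv_mul_le_iff₀ hu, mul_one]
      exact (hlt _ (subset_convexHull ℝ _ ⟨i, rfl⟩)).le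
    rw [real_inner_comm, real_inner_smul_left, hz, inv_mul_le_iff₀ hu, mul_one] at h1
    linarith

end Existence

namespace LabeledPolytope

variable {d n m : ℕ}

/-- Every centered polytope is described by its vertices and its suitably scaled facet normals. -/
theorem IsCentered.exists_isDescribedBy [NeZero d] {Q : LabeledPolytope d n m}
    (h0 : Q.IsCentered) : ∃ V A, Q.IsDescribedBy V A := by
  obtain ⟨⟨S, hS, hQS⟩, -⟩ := Q.isFullPolytope
  have : Finite S := hS
  let W : S → EuclideanSpace ℝ (Fin d) := Subtype.val
  let B : (polarSet W).extremePoints ℝ → EuclideanSpace ℝ (Fin d) := Subtype.val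
  have hQW : Q.carrier = convexHull ℝ (range W) := by rw [hQS, Subtype.range_coe]
  have h0 : (0 : EuclideanSpace ℝ (Fin d)) ∈ interior Q.carrier := h0
  have hQB : Q.carrier = polarSet B := by
    rw [hQW]
    exact convexHull_eq_polarSet (hQW ▸ h0)
  have : Finite ((polarSet W).extremePoints ℝ) := finite_extremePoints_polarSet W
  have hd0 : (0 : ℤ) < d := by exact_mod_cast NeZero.pos d
  have hA : ∀ j, ∃ y, (∀ x ∈ Q.carrier, ⟪y, x⟫_ℝ ≤ 1) ∧
      Q.facet j = {x ∈ Q.carrier | ⟪y, x⟫_ℝ = 1} := by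
    intro j
    obtain ⟨hF, hd⟩ := Q.facet_mem j
    have hF : IsExposed ℝ Q.carrier (Q.facet j) := hF
    have hne : (Q.facet j).Nonempty := faceDim_nonneg_iff.1 (by omega)
    rcases eq_self_or_exists_of_isExposed h0 hF hne with h | h
    · rw [h, faceDim_eq_of_zero_mem_interior h0] at hd
      omega
    · exact h
  choose A hA1 hA2 using hA
  have hvert : ∀ x ∈ Q.carrier.extremePoints ℝ, x ∈ range Q.vertex := by
    intro x hx
    have hx1 : IsExposed ℝ Q.carrier {x} := by
      have hset : {x} = {x' ∈ Q.carrier | ∀ b ∈ {b | ⟪B b, x⟫_ℝ = 1}, ⟪B b, x'⟫_ℝ = 1} := by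
        ext x'
        simp only [mem_singleton_iff, mem_ofPred_eq]
        constructor
        · rintro rfl
          exact ⟨hx.1, fun b hb => hb⟩
        · rintro ⟨-, hx'⟩
          rw [hQB] at hx
          refine (sub_eq_zero.1 (eq_zero_of_mem_extremePoints hx fun b hb => ?_)).symm
          rw [inner_sub_right, hb, hx' b hb, sub_self]
      rw [hset]
      exact isExposed_tight hQB.subset _
    obtain ⟨i, hi⟩ := Q.range_vertex.superset ⟨hx1, faceDim_eq_zero_iff.2 ⟨x, rfl⟩⟩
    exact ⟨i, singleton_injective hi⟩
  -- the extreme points of the polar are normals of facets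
  have hfac : ∀ b, ∃ j, A j = B b := by
    intro b
    have hb : ∀ u, (∀ s, ⟪W s, B b⟫_ℝ = 1 → ⟪W s, u⟫_ℝ = 0) → u = 0 := fun u hu =>
      eq_zero_of_mem_extremePoints b.2 hu
    have hWQ : ∀ s, W s ∈ Q.carrier := fun s => by
      rw [hQW]
      exact subset_convexHull ℝ _ ⟨s, rfl⟩
    have hsep : ∀ u, (∀ x ∈ {x ∈ Q.carrier | ⟪B b, x⟫_ℝ = 1}, ⟪x, u⟫_ℝ = 0) → u = 0 :=
      fun u hu => hb u fun s hs => hu _ ⟨hWQ s, by rw [real_inner_comm]; exact hs⟩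
    have hne : {x ∈ Q.carrier | ⟪B b, x⟫_ℝ = 1}.Nonempty := by
      by_contra hcon
      obtain ⟨u, hu⟩ := exists_ne (0 : EuclideanSpace ℝ (Fin d))
      exact hu (hsep u fun x hx => absurd ⟨x, hx⟩ hcon)
    have hface : {x ∈ Q.carrier | ⟪B b, x⟫_ℝ = 1} ∈ facesOfDim Q.carrier (d - 1) := by
      refine ⟨?_, (faceDim_eq_sub_one_iff (fun x hx => hx.2) hne).2 hsep⟩
      change IsExposed ℝ _ _
      simpa using isExposed_tight hQB.subset {b}
    obtain ⟨j, hj⟩ := Q.range_facet.superset hface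
    refine ⟨j, sub_eq_zero.1 (hsep _ fun x hx => ?_)⟩
    have hx2 := hx.2
    have hx' : x ∈ Q.facet j := by
      change Q.facet j = _ at hj
      rw [hj]
      exact hx
    rw [hA2] at hx'
    rw [inner_sub_right, real_inner_comm, hx'.2, real_inner_comm, hx2, sub_self]
  refine ⟨Q.vertex, A, ?_, ?_, fun _ => rfl, hA2⟩
  · have hcomp : IsCompact Q.carrier := by
      rw [hQW]
      exact (finite_range W).isCompact_convexHull ℝ
    have hconv : Convex ℝ Q.carrier := by
      rw [hQW]
      exact convex_convexHull ℝ _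
    refine Subset.antisymm ?_ (convexHull_min ?_ hconv)
    · rw [← closure_convexHull_extremePoints hcomp hconv]
      exact closure_minimal (convexHull_mono hvert) ((finite_range _).isClosed_convexHull ℝ)
    · rintro _ ⟨i, rfl⟩
      exact (Q.isExposed_vertex i).subset rfl
  · refine Subset.antisymm (fun x hx j => hA1 j x hx) fun x hx => ?_
    rw [hQB]
    intro b
    obtain ⟨j, hj⟩ := hfac b
    rw [← hj]
    exact hx j

/-! ### Translations -/

section Translate

variable (c : EuclideanSpace ℝ (Fin d))

lemma isExposed_translate {P F : Set (EuclideanSpace ℝ (Fin d))} (h : IsExposed ℝ P F) :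
    IsExposed ℝ ((fun x => x + c) '' P) ((fun x => x + c) '' F) := by
  rintro ⟨_, x, hx, rfl⟩
  obtain ⟨l, hl⟩ := h ⟨x, hx⟩
  refine ⟨l, ?_⟩
  rw [hl]
  ext y
  constructor
  · rintro ⟨z, hz, rfl⟩
    refine ⟨⟨z, hz.1, rfl⟩, ?_⟩
    rintro _ ⟨w, hw, rfl⟩
    simpa using hz.2 w hw
  · rintro ⟨⟨z, hz, rfl⟩, h2⟩
    refine ⟨z, ⟨hz, fun w hw => ?_⟩, rfl⟩
    simpa using h2 _ ⟨w, hw, rfl⟩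

lemma faceDim_translate (F : Set (EuclideanSpace ℝ (Fin d))) :
    faceDim ((fun x => x + c) '' F) = faceDim F := by
  have h : vectorSpan ℝ ((fun x => x + c) '' F) = vectorSpan ℝ F := by
    have : ((fun x => x + c) '' F) -ᵥ ((fun x => x + c) '' F) = F -ᵥ F := by
      ext v
      constructor
      · rintro ⟨_, ⟨a, ha, rfl⟩, _, ⟨b, hb, rfl⟩, rfl⟩
        exact ⟨a, ha, b, hb, by simp⟩
      · rintro ⟨a, ha, b, hb, rfl⟩
        exact ⟨_, ⟨a, ha, rfl⟩, _, ⟨b, hb, rfl⟩, by simp⟩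
    rw [vectorSpan, this, vectorSpan]
  rw [faceDim, faceDim, h, image_nonempty]

lemma image_translate_neg (F : Set (EuclideanSpace ℝ (Fin d))) :
    (fun x => x + -c) '' ((fun x => x + c) '' F) = F := by
  rw [image_image]
  simp

lemma image_translate_neg' (F : Set (EuclideanSpace ℝ (Fin d))) :
    (fun x => x + c) '' ((fun x => x + -c) '' F) = F := by
  rw [image_image]
  simp

lemma facesOfDim_translate (P : Set (EuclideanSpace ℝ (Fin d))) (k : ℤ) :
    facesOfDim ((fun x => x + c) '' P) k = image (fun x => x + c) '' facesOfDim P k := by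
  refine Subset.antisymm ?_ ?_
  · rintro F ⟨hF, hk⟩
    refine ⟨(fun x => x + -c) '' F, ⟨?_, ?_⟩, image_translate_neg' c F⟩
    · have := isExposed_translate (-c) hF
      rwa [image_translate_neg] at this
    · rw [faceDim_translate, hk]
  · rintro _ ⟨F, ⟨hF, hk⟩, rfl⟩
    exact ⟨isExposed_translate c hF, by rw [faceDim_translate, hk]⟩

lemma image_translate_injective :
    Function.Injective (image fun x : EuclideanSpace ℝ (Fin d) => x + c) :=
  (add_left_injective c).image_injective

lemma fNum_translate (P : Set (EuclideanSpace ℝ (Fin d))) (k : ℤ) :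
    fNum ((fun x => x + c) '' P) k = fNum P k := by
  rw [fNum, facesOfDim_translate, ncard_image_of_injective _ (image_translate_injective c), fNum]

/-- The translate of a labeled polytope. -/
def translate (P : LabeledPolytope d n m) : LabeledPolytope d n m where
  carrier := (fun x => x + c) '' P.carrier
  isFullPolytope := by
    obtain ⟨⟨S, hS, hP⟩, hd⟩ := P.isFullPolytope
    refine ⟨⟨(fun x => x + c) '' S, hS.image _, ?_⟩, ?_⟩
    · rw [hP]
      have := (AffineEquiv.vaddConst ℝ c :
        EuclideanSpace ℝ (Fin d) ≃ᵃ[ℝ] _).toAffineMap.image_convexHull S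
      simpa using this
    · rw [faceDim_translate, hd]
  vertex i := P.vertex i + c
  vertex_injective := fun i i' h => P.vertex_injective (add_right_cancel h)
  range_vertex := by
    rw [facesOfDim_translate, ← P.range_vertex, ← range_comp]
    simp [Function.comp_def]
  facet j := (fun x => x + c) '' P.facet j
  facet_injective := (image_translate_injective c).comp P.facet_injective
  range_facet := by
    rw [facesOfDim_translate, ← P.range_facet, ← range_comp]
    rfl

lemma realizes_translate (P : LabeledPolytope d n m) : (P.translate c).Realizes P := by
  refine ⟨⟨⟨fun F => ⟨_, isExposed_translate c F.2⟩, fun F => ⟨(fun x => x + -c) '' F.1, ?_⟩,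
    fun F => ?_, fun F => ?_⟩, fun {F F'} => ?_⟩, fun i => ?_, fun j => rfl⟩
  · have := isExposed_translate (-c) F.2
    change IsExposed ℝ ((fun x => x + -c) '' ((fun x => x + c) '' _)) _ at this
    rwa [image_translate_neg] at this
  · exact Subtype.ext (image_translate_neg c F.1)
  · exact Subtype.ext (image_translate_neg' c F.1)
  · exact image_subset_image_iff (add_left_injective c)
  · exact Subtype.ext (image_singleton ..)

/-- Some translate of a polytope is centered. -/
lemma exists_isCentered_translate (P : LabeledPolytope d n m) :
    ∃ c, (P.translate c).IsCentered := by
  obtain ⟨⟨S, hS, hP⟩, hd⟩ := P.isFullPolytope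
  have hconv : Convex ℝ P.carrier := by
    rw [hP]
    exact convex_convexHull ℝ _
  have hne : P.carrier.Nonempty := faceDim_nonneg_iff.1 (by omega)
  have hspan : affineSpan ℝ P.carrier = ⊤ := by
    rw [← AffineSubspace.direction_eq_top_iff_of_nonempty ((affineSpan_nonempty ℝ).2 hne),
      direction_affineSpan]
    refine Submodule.eq_top_of_finrank_eq ?_
    rw [faceDim, if_pos hne] at hd
    rw [finrank_euclideanSpace_fin]
    exact_mod_cast hd
  obtain ⟨x, hx⟩ := hconv.interior_nonempty_iff_affineSpan_eq_top.2 hspan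
  refine ⟨-x, ?_⟩
  have h1 : interior ((fun y => y + -x) '' P.carrier) = (fun y => y + -x) '' interior P.carrier :=
    ((Homeomorph.addRight (-x)).image_interior P.carrier).symm
  change 0 ∈ interior ((fun y => y + -x) '' P.carrier)
  rw [h1]
  exact ⟨x, hx, by simp⟩

end Translate

/-- Every polytope has a realization described by a polar pair. -/
theorem exists_realization [NeZero d] (P : LabeledPolytope d n m) :
    ∃ Q : LabeledPolytope d n m, Q.Realizes P ∧ (∀ k, fNum Q.carrier k = fNum P.carrier k) ∧
      ∃ V A, Q.IsDescribedBy V A ∧ IsPolarPair P.Inc V A := by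
  obtain ⟨c, hc⟩ := P.exists_isCentered_translate
  obtain ⟨V, A, h⟩ := hc.exists_isDescribedBy
  refine ⟨P.translate c, P.realizes_translate c, fun k => fNum_translate c _ k, V, A, h, ?_⟩
  have h1 := h.isPolarPair
  rwa [show (P.translate c).Inc = P.Inc from
    funext₂ fun i j => propext ((P.realizes_translate c).inc_iff i j)] at h1

end LabeledPolytope

/-! ### Stability of the description under perturbation -/

section Perturbation

variable {E : Type*} [NormedAddCommGroup E] [InnerProductSpace ℝ E] [FiniteDimensional ℝ E]
variable {ι κ : Type*}

omit [FiniteDimensional ℝ E] in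
lemma continuousAt_inner_family {X : Type*} [TopologicalSpace X] {f : X → κ → E} {g : X → E}
    {x : X} (hf : ContinuousAt f x) (hg : ContinuousAt g x) (j : κ) :
    ContinuousAt (fun z => ⟪f z j, g z⟫_ℝ) x :=
  ContinuousAt.inner ((continuous_apply j).continuousAt.comp hf) hg

/-- A finite family of vectors which separates directions does so after a perturbation. -/
lemma eventually_eq_zero [Finite κ] {A₀ : κ → E} {s : Set κ}
    (h : ∀ u, (∀ j ∈ s, ⟪A₀ j, u⟫_ℝ = 0) → u = 0) :
    ∀ᶠ A in 𝓝 A₀, ∀ u, (∀ j ∈ s, ⟪A j, u⟫_ℝ = 0) → u = 0 := by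
  have h1 : ∀ᶠ A in 𝓝 A₀, ∀ u ∈ Metric.sphere (0 : E) 1, ∃ j ∈ s, ⟪A j, u⟫_ℝ ≠ 0 := by
    refine (isCompact_sphere (0 : E) 1).eventually_forall_of_forall_eventually
      (P := fun (A : κ → E) u => ∃ j ∈ s, ⟪A j, u⟫_ℝ ≠ 0) fun u hu => ?_
    have hu0 : u ≠ 0 := fun h0 => by simp [h0] at hu
    obtain ⟨j, hj, hju⟩ : ∃ j ∈ s, ⟪A₀ j, u⟫_ℝ ≠ 0 := by
      by_contra! hcon
      exact hu0 (h u hcon)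
    have hc : ContinuousAt (fun z : (κ → E) × E => ⟪z.1 j, z.2⟫_ℝ) (A₀, u) :=
      continuousAt_inner_family continuousAt_fst continuousAt_snd j
    filter_upwards [hc.eventually_ne hju] with z hz
    exact ⟨j, hj, hz⟩
  filter_upwards [h1] with A hA u hu
  by_contra hu0
  obtain ⟨j, hj, hju⟩ := hA (‖u‖⁻¹ • u) (by simp [norm_smul, hu0])
  exact hju (by rw [inner_smul_right, hu j hj, mul_zero])

/-- If a polyhedron is bounded, so are its perturbations. -/
lemma eventually_polarSet_subset [Finite κ] {A₀ : κ → E} {R : ℝ} (hR : 0 < R)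
    (h : ∀ x ∈ polarSet A₀, ‖x‖ < R) :
    ∀ᶠ A in 𝓝 A₀, polarSet A ⊆ Metric.closedBall 0 R := by
  have h1 : ∀ᶠ A in 𝓝 A₀, ∀ x ∈ Metric.sphere (0 : E) R, ∃ j, 1 < ⟪A j, x⟫_ℝ := by
    refine (isCompact_sphere (0 : E) R).eventually_forall_of_forall_eventually
      (P := fun (A : κ → E) x => ∃ j, 1 < ⟪A j, x⟫_ℝ) fun x hx => ?_
    obtain ⟨j, hj⟩ : ∃ j, 1 < ⟪A₀ j, x⟫_ℝ := by
      by_contra! hcon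
      have := h x hcon
      rw [mem_sphere_zero_iff_norm.1 hx] at this
      exact lt_irrefl _ this
    have hc : ContinuousAt (fun z : (κ → E) × E => ⟪z.1 j, z.2⟫_ℝ) (A₀, x) :=
      continuousAt_inner_family continuousAt_fst continuousAt_snd j
    filter_upwards [hc.eventually_const_lt hj] with z hz
    exact ⟨j, hz⟩
  filter_upwards [h1] with A hA x hx
  rw [mem_closedBall_zero_iff]
  by_contra! hlt
  have hx0 : 0 < ‖x‖ := hR.trans hlt
  obtain ⟨j, hj⟩ := hA ((R / ‖x‖) • x) (by
    rw [mem_sphere_zero_iff_norm, norm_smul, Real.norm_of_nonneg (by positivity),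
      div_mul_cancel₀ _ hx0.ne'])
  rw [inner_smul_right] at hj
  have h2 : R / ‖x‖ ≤ 1 := (div_le_one hx0).2 hlt.le
  have h3 : 0 < R / ‖x‖ := by positivity
  nlinarith [hx j]

/-- The constraints which are tight at a point of a perturbed polyhedron, in a bounded region, are
tight at a common point of the original one. -/
lemma eventually_exists_tight [Finite κ] (A₀ : κ → E) (R : ℝ) :
    ∀ᶠ A in 𝓝 A₀, ∀ x ∈ Metric.closedBall (0 : E) R, x ∈ polarSet A →
      ∃ x₀ ∈ polarSet A₀, ∀ j, ⟪A j, x⟫_ℝ = 1 → ⟪A₀ j, x₀⟫_ℝ = 1 := by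
  refine (isCompact_closedBall (0 : E) R).eventually_forall_of_forall_eventually
    (P := fun (A : κ → E) x => x ∈ polarSet A →
      ∃ x₀ ∈ polarSet A₀, ∀ j, ⟪A j, x⟫_ℝ = 1 → ⟪A₀ j, x₀⟫_ℝ = 1) fun x _ => ?_
  have hc : ∀ j, ContinuousAt (fun z : (κ → E) × E => ⟪z.1 j, z.2⟫_ℝ) (A₀, x) :=
    continuousAt_inner_family continuousAt_fst continuousAt_snd
  by_cases hx : x ∈ polarSet A₀
  · have h1 : ∀ᶠ z : (κ → E) × E in 𝓝 (A₀, x), ∀ j, ⟪A₀ j, x⟫_ℝ ≠ 1 → ⟪z.1 j, z.2⟫_ℝ ≠ 1 :=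
      eventually_all.2 fun j => by
        by_cases hj : ⟪A₀ j, x⟫_ℝ = 1
        · exact Eventually.of_forall fun z h => absurd hj h
        · filter_upwards [(hc j).eventually_ne hj] with z hz _ using hz
    filter_upwards [h1] with z hz _
    exact ⟨x, hx, fun j hj => by_contra fun h => hz j h hj⟩
  · obtain ⟨j, hj⟩ : ∃ j, 1 < ⟪A₀ j, x⟫_ℝ := by
      by_contra! hcon
      exact hx hcon
    filter_upwards [(hc j).eventually_const_lt hj] with z hz hz'
    exact absurd (hz' j) (not_le.2 hz)

/-- Near a polar pair, the incidence equations alone characterize the polar pairs with the same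
incidences. An extreme point of the perturbed polyhedron lies on facets which have a vertex in
common in the original polytope, so it is the vertex with that label. -/
theorem IsPolarPair.eventually [Finite ι] [Finite κ] {inc : ι → κ → Prop} {V₀ : ι → E} {A₀ : κ → E}
    (h : IsPolarPair inc V₀ A₀) :
    ∀ᶠ p : (ι → E) × (κ → E) in 𝓝 (V₀, A₀),
      (∀ i j, inc i j → ⟪p.2 j, p.1 i⟫_ℝ = 1) → IsPolarPair inc p.1 p.2 := by
  have := Fintype.ofFinite ι
  have hfst : Tendsto Prod.fst (𝓝 (V₀, A₀)) (𝓝 V₀) := continuousAt_fst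
  have hsnd : Tendsto Prod.snd (𝓝 (V₀, A₀)) (𝓝 A₀) := continuousAt_snd
  obtain ⟨R, hR⟩ := h.isCompact.isBounded.exists_norm_le
  have hR' : ∀ x ∈ polarSet A₀, ‖x‖ < |R| + 1 := fun x hx => by
    linarith [hR x hx, le_abs_self R]
  have e1 : ∀ᶠ p : (ι → E) × (κ → E) in 𝓝 (V₀, A₀), ∀ i j, ¬ inc i j → ⟪p.2 j, p.1 i⟫_ℝ < 1 := by
    refine eventually_all.2 fun i => eventually_all.2 fun j => ?_
    by_cases hij : inc i j
    · exact Eventually.of_forall fun p hp => absurd hij hp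
    · have hc : ContinuousAt (fun p : (ι → E) × (κ → E) => ⟪p.2 j, p.1 i⟫_ℝ) (V₀, A₀) := by fun_prop
      filter_upwards [hc.eventually_lt_const (h.inner_lt hij)] with p hp _ using hp
  filter_upwards [e1,
    hsnd.eventually (eventually_all.2 fun i => eventually_eq_zero (h.eq_zero_left i)),
    hfst.eventually (eventually_all.2 fun j => eventually_eq_zero (s := {i | inc i j})
      (h.eq_zero_right j)),
    hsnd.eventually (eventually_polarSet_subset (by positivity) hR'),
    hsnd.eventually (eventually_exists_tight A₀ (|R| + 1))] with p h1 h2 h3 h4 h5 heq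
  have hiff : ∀ i j, ⟪p.2 j, p.1 i⟫_ℝ = 1 ↔ inc i j := fun i j =>
    ⟨fun he => by_contra fun hn => (h1 i j hn).ne he, heq i j⟩
  have hmem : ∀ i, p.1 i ∈ polarSet p.2 := fun i j => by
    by_cases hij : inc i j
    · exact (heq i j hij).le
    · exact (h1 i j hij).le
  refine ⟨Subset.antisymm (convexHull_min ?_ (convex_polarSet _)) ?_, hiff, ?_, ?_, h2, h3⟩
  · rintro _ ⟨i, rfl⟩
    exact hmem i
  · have hcomp : IsCompact (polarSet p.2) :=
      Metric.isCompact_of_isClosed_isBounded (isClosed_polarSet _)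
        (Metric.isBounded_closedBall.subset h4)
    rw [← closure_convexHull_extremePoints hcomp (convex_polarSet _)]
    refine closure_minimal (convexHull_mono fun x hx => ?_) ((finite_range _).isClosed_convexHull ℝ)
    obtain ⟨x₀, hx₀, htight⟩ := h5 x (h4 hx.1) hx.1
    obtain ⟨i, hi⟩ := h.exists_vertex hx₀
    refine ⟨i, sub_eq_zero.1 (eq_zero_of_mem_extremePoints hx fun j hj => ?_)⟩
    rw [inner_sub_right, hj, heq i j (hi j (htight j hj)), sub_self]
  · intro i i' hii'
    refine h.injective_left (h.eq_vertex fun j hj => ?_)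
    rw [h.inner_eq_one_iff, ← hiff, hii', heq i' j hj]
  · intro j j' hjj'
    refine h.injective_right (h.eq_normal fun i hi => ?_)
    rw [real_inner_comm, h.inner_eq_one_iff, ← hiff, hjj', heq i j' hi]

end Perturbation

/-! ### Local structure of three-dimensional polytopes -/

section ThreeDim

variable {E : Type*} [NormedAddCommGroup E] [InnerProductSpace ℝ E]
variable {ι κ : Type*}

namespace IsPolarPair

variable {inc : ι → κ → Prop} {V : ι → E} {A : κ → E}

/-- A nontrivial affine dependence of the facet normals has at least two positive coefficients,
because they are in convex position. -/
lemma two_le_card_pos [Fintype κ] [Nontrivial E] (h : IsPolarPair inc V A) {w : κ → ℝ}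
    (hw : w ≠ 0) (hs : ∑ j, w j = 0) (hA : ∑ j, w j • A j = 0) :
    2 ≤ (Finset.univ.filter fun j => 0 < w j).card := by
  classical
  by_contra! hlt
  obtain ⟨k, hk⟩ : ∃ k, 0 < w k := by
    by_contra! hcon
    refine hw (funext fun j => ?_)
    exact (Finset.sum_eq_zero_iff_of_nonpos fun j _ => hcon j).1 hs j (Finset.mem_univ j)
  have hneg : ∀ j, j ≠ k → w j ≤ 0 := by
    intro j hj
    by_contra! hpos
    have h2 : ({j, k} : Finset κ).card ≤ (Finset.univ.filter fun j => 0 < w j).card := by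
      refine Finset.card_le_card fun l hl => ?_
      simp only [Finset.mem_insert, Finset.mem_singleton] at hl
      rcases hl with rfl | rfl <;> simpa
    rw [Finset.card_pair hj] at h2
    omega
  obtain ⟨j, hjk, hj⟩ : ∃ j, j ≠ k ∧ w j ≠ 0 := by
    by_contra! hcon
    rw [Fintype.sum_eq_single k hcon] at hs
    exact hk.ne' hs
  refine hjk (h.injective_right (h.eq_normal fun i hi => ?_))
  -- every vertex of the facet `k` lies on the facet `j`
  have h1 : ∑ l, w l * (⟪A l, V i⟫_ℝ - 1) = 0 := by
    have : ⟪∑ l, w l • A l, V i⟫_ℝ = 0 := by rw [hA, inner_zero_left]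
    rw [sum_inner] at this
    simp only [real_inner_smul_left] at this
    simp only [mul_sub, Finset.sum_sub_distrib, this, mul_one, hs, sub_self]
  have h2 : ∀ l ∈ Finset.univ, 0 ≤ w l * (⟪A l, V i⟫_ℝ - 1) := by
    intro l _
    by_cases hl : l = k
    · rw [hl, h.inner_eq hi]
      simp
    · exact mul_nonneg_of_nonpos_of_nonpos (hneg l hl) (sub_nonpos.2 (h.inner_le i l))
  have h3 := (Finset.sum_eq_zero_iff_of_nonneg h2).1 h1 j (Finset.mem_univ j)
  rw [real_inner_comm]
  rcases mul_eq_zero.1 h3 with h4 | h4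
  · exact absurd h4 hj
  · linarith

/-- A nontrivial linear dependence of the facet normals at a vertex involves at least four of
them. It is an affine dependence, since these normals lie on the hyperplane `⟪·, V i⟫ = 1`, so it
has two positive and two negative coefficients. -/
theorem four_le_card_dependence [Fintype κ] [Nontrivial E] (h : IsPolarPair inc V A) {w : κ → ℝ}
    (hw : w ≠ 0) {i : ι} (hi : ∀ j, w j ≠ 0 → inc i j) (hA : ∑ j, w j • A j = 0) :
    4 ≤ (Finset.univ.filter fun j => w j ≠ 0).card := by
  classical
  have hs : ∑ j, w j = 0 := by
    have : ⟪∑ l, w l • A l, V i⟫_ℝ = 0 := by rw [hA, inner_zero_left]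
    rw [sum_inner] at this
    rw [← this]
    refine Finset.sum_congr rfl fun j _ => ?_
    rw [real_inner_smul_left]
    by_cases hj : w j = 0
    · simp [hj]
    · rw [h.inner_eq (hi j hj), mul_one]
  have h1 := h.two_le_card_pos hw hs hA
  have h2 := h.two_le_card_pos (w := -w) (neg_ne_zero.2 hw) (by simp [hs]) (by simp [hA])
  have h3 : (Finset.univ.filter fun j => 0 < w j) ∪ (Finset.univ.filter fun j => 0 < (-w) j) ⊆
      Finset.univ.filter fun j => w j ≠ 0 := by
    intro j hj
    simp only [Finset.mem_union, Finset.mem_filter, Finset.mem_univ, true_and, Pi.neg_apply,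
      Left.neg_pos_iff] at hj ⊢
    rcases hj with hj | hj
    · exact hj.ne'
    · exact hj.ne
  have h4 : Disjoint (Finset.univ.filter fun j => 0 < w j)
      (Finset.univ.filter fun j => 0 < (-w) j) := by
    rw [Finset.disjoint_filter]
    intro j _ hj hj'
    simp only [Pi.neg_apply, Left.neg_pos_iff] at hj'
    linarith
  have h5 := Finset.card_le_card h3
  rw [Finset.card_union_of_disjoint h4] at h5
  omega

/-- In dimension three, the normals of three facets at a vertex separate directions. -/
lemma eq_zero_of_three [Fintype κ] (h : IsPolarPair inc V A) (hE : finrank ℝ E = 3) {i : ι}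
    {j₁ j₂ j₃ : κ} (h12 : j₁ ≠ j₂) (h13 : j₁ ≠ j₃) (h23 : j₂ ≠ j₃) (h1 : inc i j₁) (h2 : inc i j₂)
    (h3 : inc i j₃) {v : E} (hv1 : ⟪A j₁, v⟫_ℝ = 0) (hv2 : ⟪A j₂, v⟫_ℝ = 0)
    (hv3 : ⟪A j₃, v⟫_ℝ = 0) : v = 0 := by
  classical
  have : Nontrivial E := Module.nontrivial_of_finrank_pos (R := ℝ) (by omega)
  have hli : LinearIndependent ℝ ![A j₁, A j₂, A j₃] := by
    rw [Fintype.linearIndependent_iff]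
    intro g hg
    simp only [Fin.sum_univ_three, Matrix.cons_val_zero, Matrix.cons_val_one,
      Matrix.cons_val_two, Matrix.tail_cons, Matrix.head_cons] at hg
    let w : κ → ℝ := Pi.single j₁ (g 0) + Pi.single j₂ (g 1) + Pi.single j₃ (g 2)
    have hw1 : w j₁ = g 0 := by simp [w, h12, h13]
    have hw2 : w j₂ = g 1 := by simp [w, h12.symm, h23]
    have hw3 : w j₃ = g 2 := by simp [w, h13.symm, h23.symm]
    have hsupp : ∀ j, w j ≠ 0 → j = j₁ ∨ j = j₂ ∨ j = j₃ := by
      intro j hj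
      by_contra! hcon
      simp [w, hcon.1, hcon.2.1, hcon.2.2] at hj
    have hw0 : w = 0 := by
      by_contra hne
      have h4 := h.four_le_card_dependence hne (i := i) (fun j hj => by
        rcases hsupp j hj with rfl | rfl | rfl <;> assumption) (by
        simp only [w, Pi.add_apply, add_smul, Finset.sum_add_distrib, Pi.single_apply, ite_smul,
          zero_smul, Finset.sum_ite_eq', Finset.mem_univ, if_true]
        simpa using hg)
      have h5 : (Finset.univ.filter fun j => w j ≠ 0) ⊆ {j₁, j₂, j₃} := by
        intro j hj
        simp only [Finset.mem_filter, Finset.mem_univ, true_and] at hj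
        simpa using hsupp j hj
      have := (Finset.card_le_card h5).trans Finset.card_le_three
      omega
    rw [hw0] at hw1 hw2 hw3
    intro l
    fin_cases l
    · exact hw1.symm
    · exact hw2.symm
    · exact hw3.symm
  have hspan := hli.span_eq_top_of_card_eq_finrank (by simp [hE])
  have hvv : v ∈ (Submodule.span ℝ (range ![A j₁, A j₂, A j₃]))ᗮ := by
    rw [Submodule.mem_orthogonal]
    intro u hu
    induction hu using Submodule.span_induction with
    | mem x hx =>
      obtain ⟨l, rfl⟩ := hx
      fin_cases l
      · exact hv1
      · exact hv2
      · exact hv3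
    | zero => simp
    | add a b _ _ ha hb => rw [inner_add_left, ha, hb, add_zero]
    | smul c a _ ha => rw [real_inner_smul_left, ha, mul_zero]
  rw [hspan, Submodule.top_orthogonal_eq_bot] at hvv
  simpa using hvv

/-- In dimension three, two vertices have at most two facets in common. -/
lemma eq_of_three [Fintype κ] (h : IsPolarPair inc V A) (hE : finrank ℝ E = 3) {i i' : ι}
    {j₁ j₂ j₃ : κ} (h12 : j₁ ≠ j₂) (h13 : j₁ ≠ j₃) (h23 : j₂ ≠ j₃) (h1 : inc i j₁) (h2 : inc i j₂)
    (h3 : inc i j₃) (h1' : inc i' j₁) (h2' : inc i' j₂) (h3' : inc i' j₃) : i' = i := by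
  refine h.injective_left (sub_eq_zero.1 (h.eq_zero_of_three hE h12 h13 h23 h1 h2 h3 ?_ ?_ ?_)) <;>
  rw [inner_sub_right, h.inner_eq ‹_›, h.inner_eq ‹_›, sub_self]

end IsPolarPair

/-- In dimension three, a plane `cᗮ` is spanned by a given nonzero vector `u` and another one. -/
lemma exists_plane_basis (hE : finrank ℝ E = 3) {c u : E} (hc : c ≠ 0) (hu : u ≠ 0)
    (hcu : ⟪c, u⟫_ℝ = 0) : ∃ w : E, w ≠ 0 ∧ ⟪c, w⟫_ℝ = 0 ∧ ⟪u, w⟫_ℝ = 0 ∧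
      ∀ g, ⟪c, g⟫_ℝ = 0 → ∃ a b : ℝ, g = a • u + b • w := by
  have : FiniteDimensional ℝ E := Module.finite_of_finrank_pos (by omega)
  obtain ⟨w, hw, hw0⟩ : ∃ w ∈ (Submodule.span ℝ (range ![c, u]))ᗮ, w ≠ 0 := by
    rw [← Submodule.ne_bot_iff, Ne, Submodule.orthogonal_eq_bot_iff]
    intro htop
    have := finrank_range_le_card (R := ℝ) ![c, u]
    rw [Set.finrank, htop, finrank_top, hE] at this
    simp at this
  rw [Submodule.mem_orthogonal] at hw
  have hcw : ⟪c, w⟫_ℝ = 0 := hw c (Submodule.subset_span ⟨0, rfl⟩)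
  have huw : ⟪u, w⟫_ℝ = 0 := hw u (Submodule.subset_span ⟨1, rfl⟩)
  refine ⟨w, hw0, hcw, huw, fun g hg => ?_⟩
  have hli : LinearIndependent ℝ ![c, u, w] := by
    refine linearIndependent_of_ne_zero_of_inner_eq_zero ?_ ?_
    · intro l
      fin_cases l <;> simpa
    · intro l l' hl
      fin_cases l <;> fin_cases l' <;> simp_all [real_inner_comm]
  have hg' : g ∈ Submodule.span ℝ (range ![c, u, w]) := by
    rw [hli.span_eq_top_of_card_eq_finrank (by simp [hE])]
    trivial
  obtain ⟨a, rfl⟩ := (Submodule.mem_span_range_iff_exists_fun ℝ).1 hg'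
  simp only [Fin.sum_univ_three, Matrix.cons_val_zero, Matrix.cons_val_one,
    Matrix.cons_val_two, Matrix.tail_cons, Matrix.head_cons] at hg ⊢
  rw [inner_add_right, inner_add_right, inner_smul_right, inner_smul_right, inner_smul_right, hcu,
    hcw, mul_zero, mul_zero, add_zero, add_zero] at hg
  have ha : a 0 = 0 := by
    rcases mul_eq_zero.1 hg with h | h
    · exact h
    · exact absurd (inner_self_eq_zero.1 h) hc
  exact ⟨a 1, a 2, by simp [ha]⟩

/-- **The two sides of a planar cone.** The cone `{g ∈ cᗮ | ⟪p k, g⟫ ≤ 0}` in a plane, if it has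
interior and is pointed, and if each of its boundary rays is on only one of the lines
`⟪p k, g⟫ = 0`, has exactly two sides. In a basis `u`, `w` of the plane with `u` in the interior,
they correspond to the extreme slopes of the lines. -/
theorem card_sides_eq_two (hE : finrank ℝ E = 3) {c : E} (hc : c ≠ 0) (K : Finset κ) {p : κ → E}
    {u : E} (hcu : ⟪c, u⟫_ℝ = 0) (hu : ∀ k ∈ K, ⟪p k, u⟫_ℝ < 0)
    (hsep : ∀ g, ⟪c, g⟫_ℝ = 0 → (∀ k ∈ K, ⟪p k, g⟫_ℝ = 0) → g = 0)
    (htwo : ∀ g, g ≠ 0 → ⟪c, g⟫_ℝ = 0 → (∀ l ∈ K, ⟪p l, g⟫_ℝ ≤ 0) → ∀ k ∈ K, ∀ k' ∈ K,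
      ⟪p k, g⟫_ℝ = 0 → ⟪p k', g⟫_ℝ = 0 → k = k') :
    open Classical in (K.filter fun k => ∃ g, g ≠ 0 ∧ ⟪c, g⟫_ℝ = 0 ∧ ⟪p k, g⟫_ℝ = 0 ∧
      ∀ l ∈ K, ⟪p l, g⟫_ℝ ≤ 0).card = 2 := by
  classical
  have hKne : K.Nonempty := by
    rw [Finset.nonempty_iff_ne_empty]
    rintro rfl
    obtain ⟨v, hv, hvc⟩ : ∃ v : E, v ≠ 0 ∧ ⟪c, v⟫_ℝ = 0 := by
      have : FiniteDimensional ℝ E := Module.finite_of_finrank_pos (by omega)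
      have h1 := (Submodule.span ℝ {c}).finrank_add_finrank_orthogonal
      rw [finrank_span_singleton hc, hE] at h1
      have : Nontrivial (Submodule.span ℝ {c})ᗮ :=
        Module.nontrivial_of_finrank_pos (R := ℝ) (by omega)
      obtain ⟨v, hv⟩ := exists_ne (0 : (Submodule.span ℝ {c})ᗮ)
      exact ⟨v, by simpa using hv, Submodule.mem_orthogonal_singleton_iff_inner_right.1 v.2⟩
    exact hv (hsep v hvc (by simp))
  have hu0 : u ≠ 0 := by
    rintro rfl
    obtain ⟨k, hk⟩ := hKne
    simpa using hu k hk
  obtain ⟨w, hw0, hcw, huw, hbasis⟩ := exists_plane_basis hE hc hu0 hcu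
  let s : κ → ℝ := fun k => ⟪p k, w⟫_ℝ / (-⟪p k, u⟫_ℝ)
  have hval : ∀ k ∈ K, ∀ a b : ℝ, ⟪p k, a • u + b • w⟫_ℝ = -⟪p k, u⟫_ℝ * (b * s k - a) := by
    intro k hk a b
    have : -⟪p k, u⟫_ℝ ≠ 0 := by linarith [hu k hk]
    have h2 : ⟪p k, w⟫_ℝ = s k * -⟪p k, u⟫_ℝ := (div_mul_cancel₀ _ this).symm
    rw [inner_add_right, inner_smul_right, inner_smul_right, h2]
    ring
  have hne : ∀ a b : ℝ, b ≠ 0 → a • u + b • w ≠ 0 := by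
    intro a b hb h0
    have : ⟪w, a • u + b • w⟫_ℝ = 0 := by rw [h0, inner_zero_right]
    rw [inner_add_right, inner_smul_right, inner_smul_right, real_inner_comm, huw, mul_zero,
      zero_add] at this
    rcases mul_eq_zero.1 this with h | h
    · exact hb h
    · exact hw0 (inner_self_eq_zero.1 h)
  have hcg : ∀ a b : ℝ, ⟪c, a • u + b • w⟫_ℝ = 0 := by
    intro a b
    rw [inner_add_right, inner_smul_right, inner_smul_right, hcu, hcw]
    simp
  obtain ⟨k₁, hk₁, hmax⟩ := K.exists_max_image s hKne
  obtain ⟨k₂, hk₂, hmin⟩ := K.exists_min_image s hKne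
  -- the boundary rays are `s k₁ • u + w` and `-(s k₂ • u + w)`
  have hray₁ : ∀ l ∈ K, ⟪p l, s k₁ • u + (1 : ℝ) • w⟫_ℝ ≤ 0 := by
    intro l hl
    rw [hval l hl]
    nlinarith [hu l hl, hmax l hl]
  have hray₂ : ∀ l ∈ K, ⟪p l, (-s k₂) • u + (-1 : ℝ) • w⟫_ℝ ≤ 0 := by
    intro l hl
    rw [hval l hl]
    nlinarith [hu l hl, hmin l hl]
  have hzero₁ : ∀ k ∈ K, s k = s k₁ → k = k₁ := by
    intro k hk hs
    refine htwo _ (hne (s k₁) 1 one_ne_zero) (hcg _ _) hray₁ k hk k₁ hk₁ ?_ ?_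
    · rw [hval k hk, hs]
      ring
    · rw [hval k₁ hk₁]
      ring
  have hzero₂ : ∀ k ∈ K, s k = s k₂ → k = k₂ := by
    intro k hk hs
    refine htwo _ (hne (-s k₂) (-1) (by norm_num)) (hcg _ _) hray₂ k hk k₂ hk₂ ?_ ?_
    · rw [hval k hk, hs]
      ring
    · rw [hval k₂ hk₂]
      ring
  have h12 : k₁ ≠ k₂ := by
    intro he
    refine hne (s k₁) 1 one_ne_zero (hsep _ (hcg _ _) fun k hk => ?_)
    have : s k = s k₁ := le_antisymm (hmax k hk) (he ▸ hmin k hk)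
    rw [hval k hk, this]
    ring
  have hset : (K.filter fun k => ∃ g, g ≠ 0 ∧ ⟪c, g⟫_ℝ = 0 ∧ ⟪p k, g⟫_ℝ = 0 ∧
      ∀ l ∈ K, ⟪p l, g⟫_ℝ ≤ 0) = {k₁, k₂} := by
    ext k
    simp only [Finset.mem_filter, Finset.mem_insert, Finset.mem_singleton]
    constructor
    · rintro ⟨hk, g, hg0, hgc, hgk, hgl⟩
      obtain ⟨a, b, rfl⟩ := hbasis g hgc
      have hka : b * s k = a := by
        rw [hval k hk] at hgk
        rcases mul_eq_zero.1 hgk with h | h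
        · linarith [hu k hk]
        · linarith
      have hla : ∀ l ∈ K, b * s l ≤ a := by
        intro l hl
        have := hgl l hl
        rw [hval l hl] at this
        nlinarith [hu l hl]
      rcases lt_trichotomy b 0 with hb | hb | hb
      · right
        refine hzero₂ k hk (le_antisymm ?_ (hmin k hk))
        have := hla k₂ hk₂
        rw [← hka] at this
        nlinarith
      · exfalso
        subst hb
        rw [zero_mul] at hka
        exact hg0 (by simp [← hka])
      · left
        refine hzero₁ k hk (le_antisymm (hmax k hk) ?_)
        have := hla k₁ hk₁
        rw [← hka] at this
        nlinarith
    · rintro (rfl | rfl)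
      · refine ⟨hk₁, _, hne (s k) 1 one_ne_zero, hcg _ _, ?_, hray₁⟩
        rw [hval k hk₁]
        ring
      · refine ⟨hk₂, _, hne (-s k) (-1) (by norm_num), hcg _ _, ?_, hray₂⟩
        rw [hval k hk₂]
        ring
  rw [hset, Finset.card_pair h12]

end ThreeDim

/-! ### Edges of three-dimensional polytopes -/

section Edges

variable {ι κ : Type*}

/-- The edges of a three-dimensional polytope, read off from the incidences: pairs of vertices and
pairs of facets which are all incident. Two vertices of the polytope span an edge exactly if they
have two facets in common. -/
def Edge (inc : ι → κ → Prop) : Type _ :=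
  {e : Finset ι × Finset κ // e.1.card = 2 ∧ e.2.card = 2 ∧ ∀ i ∈ e.1, ∀ j ∈ e.2, inc i j}

variable {inc : ι → κ → Prop}

/-- The vertices of an edge. -/
def Edge.verts (e : Edge inc) : Finset ι := e.1.1

/-- The facets through an edge. -/
def Edge.facets (e : Edge inc) : Finset κ := e.1.2

lemma Edge.card_verts (e : Edge inc) : e.verts.card = 2 := e.2.1

lemma Edge.card_facets (e : Edge inc) : e.facets.card = 2 := e.2.2.1

lemma Edge.inc_of_mem (e : Edge inc) {i : ι} (hi : i ∈ e.verts) {j : κ} (hj : j ∈ e.facets) :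
    inc i j := e.2.2.2 i hi j hj

lemma Edge.ext' {e e' : Edge inc} (h1 : ∀ i, i ∈ e.verts ↔ i ∈ e'.verts)
    (h2 : ∀ j, j ∈ e.facets ↔ j ∈ e'.facets) : e = e' :=
  Subtype.ext (Prod.ext (Finset.ext h1) (Finset.ext h2))

instance [Finite ι] [Finite κ] : Finite (Edge inc) := by
  unfold Edge
  infer_instance

instance [Finite ι] [Finite κ] : Fintype (Edge inc) := Fintype.ofFinite _

lemma exists_other {α : Type*} {s : Finset α} (hs : s.card = 2) {a : α} (ha : a ∈ s) :
    ∃ b, b ≠ a ∧ ∀ x, x ∈ s ↔ x = a ∨ x = b := by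
  classical
  obtain ⟨x, y, hxy, rfl⟩ := Finset.card_eq_two.1 hs
  rcases Finset.mem_insert.1 ha with rfl | ha
  · exact ⟨y, hxy.symm, by simp⟩
  · rw [Finset.mem_singleton] at ha
    subst ha
    exact ⟨x, hxy, fun z => by simp [or_comm]⟩

/-- The edge with vertices `i`, `i'` and facets `j`, `j'`. -/
lemma exists_edge {i i' : ι} {j j' : κ} (hi : i' ≠ i) (hj : j' ≠ j) (h1 : inc i j) (h2 : inc i j')
    (h3 : inc i' j) (h4 : inc i' j') : ∃ e : Edge inc, (∀ x, x ∈ e.verts ↔ x = i ∨ x = i') ∧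
      ∀ x, x ∈ e.facets ↔ x = j ∨ x = j' := by
  classical
  refine ⟨⟨({i, i'}, {j, j'}), Finset.card_pair hi.symm, Finset.card_pair hj.symm, ?_⟩,
    fun x => by simp [Edge.verts], fun x => by simp [Edge.facets]⟩
  intro a ha b hb
  simp only [Finset.mem_insert, Finset.mem_singleton] at ha hb
  rcases ha with rfl | rfl <;> rcases hb with rfl | rfl <;> assumption

/-- The two edges `e₁`, `e₂` of the facet `j` at its vertex `i`: `e₁` joins `i` to `i₁` and
separates `j` from `k₁`, and likewise for `e₂`. -/
structure IsCorner (inc : ι → κ → Prop) (i : ι) (j : κ) (i₁ i₂ : ι) (k₁ k₂ : κ) (e₁ e₂ : Edge inc) :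
    Prop where
  facet_ne : k₁ ≠ k₂
  facet_ne₁ : k₁ ≠ j
  facet_ne₂ : k₂ ≠ j
  vertex_ne₁ : i₁ ≠ i
  vertex_ne₂ : i₂ ≠ i
  mem_verts₁ : ∀ x, x ∈ e₁.verts ↔ x = i ∨ x = i₁
  mem_verts₂ : ∀ x, x ∈ e₂.verts ↔ x = i ∨ x = i₂
  mem_facets₁ : ∀ x, x ∈ e₁.facets ↔ x = j ∨ x = k₁
  mem_facets₂ : ∀ x, x ∈ e₂.facets ↔ x = j ∨ x = k₂
  edge_iff : ∀ e : Edge inc, i ∈ e.verts ∧ j ∈ e.facets ↔ e = e₁ ∨ e = e₂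

namespace IsCorner

variable {i : ι} {j : κ} {i₁ i₂ : ι} {k₁ k₂ : κ} {e₁ e₂ : Edge inc}
  (hc : IsCorner inc i j i₁ i₂ k₁ k₂ e₁ e₂)
include hc

lemma symm : IsCorner inc i j i₂ i₁ k₂ k₁ e₂ e₁ :=
  ⟨hc.facet_ne.symm, hc.facet_ne₂, hc.facet_ne₁, hc.vertex_ne₂, hc.vertex_ne₁, hc.mem_verts₂,
    hc.mem_verts₁, hc.mem_facets₂, hc.mem_facets₁, fun e => (hc.edge_iff e).trans or_comm⟩

lemma edge_ne : e₁ ≠ e₂ := by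
  rintro rfl
  rcases (hc.mem_facets₂ k₁).1 ((hc.mem_facets₁ k₁).2 (.inr rfl)) with h | h
  · exact hc.facet_ne₁ h
  · exact hc.facet_ne h

lemma inc₀₀ : inc i j :=
  e₁.inc_of_mem ((hc.mem_verts₁ i).2 (.inl rfl)) ((hc.mem_facets₁ j).2 (.inl rfl))

lemma inc₁₀ : inc i₁ j :=
  e₁.inc_of_mem ((hc.mem_verts₁ i₁).2 (.inr rfl)) ((hc.mem_facets₁ j).2 (.inl rfl))

lemma inc₀₁ : inc i k₁ :=
  e₁.inc_of_mem ((hc.mem_verts₁ i).2 (.inl rfl)) ((hc.mem_facets₁ k₁).2 (.inr rfl))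

lemma inc₁₁ : inc i₁ k₁ :=
  e₁.inc_of_mem ((hc.mem_verts₁ i₁).2 (.inr rfl)) ((hc.mem_facets₁ k₁).2 (.inr rfl))

end IsCorner

variable {E : Type*} [NormedAddCommGroup E] [InnerProductSpace ℝ E] [FiniteDimensional ℝ E]
  [Nontrivial E] [Fintype ι] [Fintype κ] {V : ι → E} {A : κ → E}

namespace IsPolarPair

omit [FiniteDimensional ℝ E] [Nontrivial E] in
/-- The facets which contain a feasible ray at a vertex have another vertex in common. -/
lemma exists_vertex_of_ray (h : IsPolarPair inc V A) {i : ι} {g : E} (hg0 : g ≠ 0)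
    (hg : ∀ l, inc i l → ⟪A l, g⟫_ℝ ≤ 0) :
    ∃ i', i' ≠ i ∧ ∀ l, inc i l → ⟪A l, g⟫_ℝ = 0 → inc i' l := by
  obtain ⟨t, ht, hmem⟩ := exists_add_smul_mem_polarSet (h.mem_polarSet i)
    fun j hj => hg j ((h.inner_eq_one_iff i j).1 hj)
  obtain ⟨i', hi', hinc⟩ := h.exists_vertex_ne hmem (i := i) (by simp [ht.ne', hg0])
  refine ⟨i', hi', fun l hl hgl => hinc l ?_⟩
  rw [inner_add_right, h.inner_eq hl, inner_smul_right, hgl, mul_zero, add_zero]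

variable (h : IsPolarPair inc V A) (hE : finrank ℝ E = 3)
include h hE

/-- Two facets have at most two vertices in common. -/
lemma eq_of_three' {j j' : κ} {i₁ i₂ i₃ : ι} (h12 : i₁ ≠ i₂) (h13 : i₁ ≠ i₃) (h23 : i₂ ≠ i₃)
    (h1 : inc i₁ j) (h2 : inc i₂ j) (h3 : inc i₃ j) (h1' : inc i₁ j') (h2' : inc i₂ j')
    (h3' : inc i₃ j') : j' = j :=
  h.swap.eq_of_three hE h12 h13 h23 h1 h2 h3 h1' h2' h3'

omit [FiniteDimensional ℝ E] [Nontrivial E] in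
open Classical in
/-- Exactly two facets share with the facet `j` an edge at its vertex `i`. -/
lemma card_neighbours {i : ι} {j : κ} (hij : inc i j) :
    (Finset.univ.filter fun k => (k ≠ j ∧ inc i k) ∧ ∃ i', i' ≠ i ∧ inc i' j ∧ inc i' k).card =
      2 := by
  have hc : A j ≠ 0 := by
    intro h0
    have := h.inner_eq hij
    rw [h0, inner_zero_left] at this
    norm_num at this
  -- a direction from `V i` into the relative interior of the facet `j`
  let u : E := ∑ i' with inc i' j, (V i' - V i)
  have hval : ∀ k, ⟪A k, u⟫_ℝ = ∑ i' with inc i' j, (⟪A k, V i'⟫_ℝ - ⟪A k, V i⟫_ℝ) := by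
    intro k
    simp only [u, inner_sum, inner_sub_right]
  have hcu : ⟪A j, u⟫_ℝ = 0 := by
    rw [hval]
    refine Finset.sum_eq_zero fun i' hi' => ?_
    rw [h.inner_eq (by simpa using hi'), h.inner_eq hij, sub_self]
  have hkey := card_sides_eq_two hE hc (Finset.univ.filter fun k => k ≠ j ∧ inc i k) (p := A)
    hcu ?_ ?_ ?_
  · rw [← hkey, Finset.filter_filter]
    congr 1
    refine Finset.filter_congr fun k _ => and_congr_right fun hk => ?_
    constructor
    · rintro ⟨i', hi', h1, h2⟩
      refine ⟨V i' - V i, sub_ne_zero.2 (h.injective_left.ne hi'), ?_, ?_, fun l hl => ?_⟩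
      · rw [inner_sub_right, h.inner_eq h1, h.inner_eq hij, sub_self]
      · rw [inner_sub_right, h.inner_eq h2, h.inner_eq hk.2, sub_self]
      · rw [inner_sub_right, h.inner_eq (Finset.mem_filter.1 hl).2.2, sub_nonpos]
        exact h.inner_le i' l
    · rintro ⟨g, hg0, hgj, hgk, hgl⟩
      obtain ⟨i', hi', hinc⟩ := h.exists_vertex_of_ray (i := i) hg0 fun l hl => by
        by_cases hlj : l = j
        · rw [hlj, hgj]
        · exact hgl l (by simp [hlj, hl])
      exact ⟨i', hi', hinc j hij hgj, hinc k hk.2 hgk⟩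
  · intro k hk
    rw [Finset.mem_filter] at hk
    rw [hval]
    refine Finset.sum_neg' (fun i' _ => ?_) ?_
    · rw [h.inner_eq hk.2.2, sub_nonpos]
      exact h.inner_le i' k
    · by_contra! hcon
      refine hk.2.1 (h.injective_right (h.eq_normal fun i' hi' => ?_))
      have := hcon i' (by simpa using hi')
      rw [h.inner_eq hk.2.2] at this
      rw [real_inner_comm]
      exact le_antisymm (h.inner_le i' k) (by linarith)
  · intro g hg hgk
    refine h.eq_zero_left i g fun k hk => ?_
    by_cases hkj : k = j
    · rw [hkj, hg]
    · exact hgk k (by simp [hkj, hk])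
  · intro g hg0 hgj hgl k hk k' hk' hgk hgk'
    rw [Finset.mem_filter] at hk hk'
    obtain ⟨i', hi', hinc⟩ := h.exists_vertex_of_ray (i := i) hg0 fun l hl => by
      by_cases hlj : l = j
      · rw [hlj, hgj]
      · exact hgl l (by simp [hlj, hl])
    by_contra hkk'
    exact hi' (h.eq_of_three hE hk.2.1.symm hk'.2.1.symm hkk' hij hk.2.2 hk'.2.2
      (hinc _ hij hgj) (hinc _ hk.2.2 hgk) (hinc _ hk'.2.2 hgk'))

/-- A facet has exactly two edges at each of its vertices. -/
theorem exists_isCorner {i : ι} {j : κ} (hij : inc i j) :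
    ∃ i₁ i₂ k₁ k₂ e₁ e₂, IsCorner inc i j i₁ i₂ k₁ k₂ e₁ e₂ := by
  classical
  obtain ⟨k₁, k₂, hk, hN⟩ := Finset.card_eq_two.1 (h.card_neighbours hE hij)
  have hN' : ∀ k, ((k ≠ j ∧ inc i k) ∧ ∃ i', i' ≠ i ∧ inc i' j ∧ inc i' k) ↔ k = k₁ ∨ k = k₂ := by
    intro k
    simpa using congrArg (k ∈ ·) hN
  obtain ⟨⟨hk₁, hik₁⟩, i₁, hi₁, hi₁j, hi₁k⟩ := (hN' k₁).2 (.inl rfl)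
  obtain ⟨⟨hk₂, hik₂⟩, i₂, hi₂, hi₂j, hi₂k⟩ := (hN' k₂).2 (.inr rfl)
  obtain ⟨e₁, hv₁, hf₁⟩ := exists_edge hi₁ hk₁ hij hik₁ hi₁j hi₁k
  obtain ⟨e₂, hv₂, hf₂⟩ := exists_edge hi₂ hk₂ hij hik₂ hi₂j hi₂k
  refine ⟨i₁, i₂, k₁, k₂, e₁, e₂, hk, hk₁, hk₂, hi₁, hi₂, hv₁, hv₂, hf₁, hf₂, fun e => ⟨?_, ?_⟩⟩
  · rintro ⟨hi, hj⟩
    obtain ⟨i', hi', hv⟩ := exists_other e.card_verts hi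
    obtain ⟨k, hkj, hf⟩ := exists_other e.card_facets hj
    have hi'm := (hv i').2 (.inr rfl)
    have hkm := (hf k).2 (.inr rfl)
    have hmem := (hN' k).1 ⟨⟨hkj, e.inc_of_mem hi hkm⟩, i', hi', e.inc_of_mem hi'm hj,
      e.inc_of_mem hi'm hkm⟩
    rcases hmem with rfl | rfl
    · left
      have : i' = i₁ := by
        by_contra hne
        exact hkj (h.eq_of_three' hE hi'.symm hi₁.symm hne hij (e.inc_of_mem hi'm hj) hi₁j hik₁
          (e.inc_of_mem hi'm hkm) hi₁k)
      subst this
      exact Edge.ext' (fun x => by rw [hv, hv₁]) (fun x => by rw [hf, hf₁])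
    · right
      have : i' = i₂ := by
        by_contra hne
        exact hkj (h.eq_of_three' hE hi'.symm hi₂.symm hne hij (e.inc_of_mem hi'm hj) hi₂j hik₂
          (e.inc_of_mem hi'm hkm) hi₂k)
      subst this
      exact Edge.ext' (fun x => by rw [hv, hv₂]) (fun x => by rw [hf, hf₂])
  · rintro (rfl | rfl)
    · exact ⟨(hv₁ i).2 (.inl rfl), (hf₁ j).2 (.inl rfl)⟩
    · exact ⟨(hv₂ i).2 (.inl rfl), (hf₂ j).2 (.inl rfl)⟩

omit [FiniteDimensional ℝ E] [Nontrivial E] [Fintype ι] in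
lemma inner_edge_neg {i : ι} {j : κ} {i₁ i₂ : ι} {k₁ k₂ : κ} {e₁ e₂ : Edge inc}
    (hc : IsCorner inc i j i₁ i₂ k₁ k₂ e₁ e₂) : ⟪A k₂, V i₁ - V i⟫_ℝ < 0 := by
  rw [inner_sub_right, h.inner_eq hc.symm.inc₀₁, sub_neg]
  refine h.inner_lt fun hinc => hc.vertex_ne₁ ?_
  exact h.eq_of_three hE hc.facet_ne₁.symm hc.facet_ne₂.symm hc.facet_ne hc.inc₀₀ hc.inc₀₁
    hc.symm.inc₀₁ hc.inc₁₀ hc.inc₁₁ hinc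

omit [FiniteDimensional ℝ E] [Nontrivial E] [Fintype ι] in
/-- The cone of a facet at a vertex is spanned by the two edges. -/
lemma exists_cone {i : ι} {j : κ} {i₁ i₂ : ι} {k₁ k₂ : κ} {e₁ e₂ : Edge inc}
    (hc : IsCorner inc i j i₁ i₂ k₁ k₂ e₁ e₂) {g : E} (hg : ⟪A j, g⟫_ℝ = 0)
    (hg₁ : ⟪A k₁, g⟫_ℝ ≤ 0) (hg₂ : ⟪A k₂, g⟫_ℝ ≤ 0) :
    ∃ a b : ℝ, 0 ≤ a ∧ 0 ≤ b ∧ g = a • (V i₁ - V i) + b • (V i₂ - V i) := by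
  have hz : ∀ {i' k}, inc i k → inc i' k → ⟪A k, V i' - V i⟫_ℝ = 0 := fun h1 h2 => by
    rw [inner_sub_right, h.inner_eq h1, h.inner_eq h2, sub_self]
  have h1 := h.inner_edge_neg hE hc
  have h2 := h.inner_edge_neg hE hc.symm
  refine ⟨⟪A k₂, g⟫_ℝ / ⟪A k₂, V i₁ - V i⟫_ℝ, ⟪A k₁, g⟫_ℝ / ⟪A k₁, V i₂ - V i⟫_ℝ,
    div_nonneg_of_nonpos hg₂ h1.le, div_nonneg_of_nonpos hg₁ h2.le, ?_⟩
  refine sub_eq_zero.1 (h.eq_zero_of_three hE hc.facet_ne₁.symm hc.facet_ne₂.symm hc.facet_ne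
    hc.inc₀₀ hc.inc₀₁ hc.symm.inc₀₁ ?_ ?_ ?_)
  · rw [inner_sub_right, inner_add_right, inner_smul_right, inner_smul_right, hg,
      hz hc.inc₀₀ hc.inc₁₀, hz hc.inc₀₀ hc.symm.inc₁₀]
    simp
  · rw [inner_sub_right, inner_add_right, inner_smul_right, inner_smul_right,
      hz hc.inc₀₁ hc.inc₁₁, div_mul_cancel₀ _ h2.ne]
    simp
  · rw [inner_sub_right, inner_add_right, inner_smul_right, inner_smul_right,
      hz hc.symm.inc₀₁ hc.symm.inc₁₁, div_mul_cancel₀ _ h1.ne]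
    simp

end IsPolarPair

end Edges

/-! ### Euler's formula from a generic height function -/

section Euler

variable {ι κ : Type*} {inc : ι → κ → Prop}
variable {E : Type*} [NormedAddCommGroup E] [InnerProductSpace ℝ E] {V : ι → E} {A : κ → E}

/-- A linear functional taking different values at the given points. -/
lemma exists_injective_inner [FiniteDimensional ℝ E] [Finite ι] (hV : Function.Injective V) :
    ∃ c : E, Function.Injective fun i => ⟪c, V i⟫_ℝ := by
  obtain ⟨φ, hφ⟩ := Module.exists_dual_forall_apply_ne_zero (K := ℝ)
    (fun p : {p : ι × ι // p.1 ≠ p.2} => V p.1.1 - V p.1.2)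
    fun p => sub_ne_zero.2 (hV.ne p.2)
  refine ⟨(InnerProductSpace.toDual ℝ E).symm φ.toContinuousLinearMap, fun i i' hi => ?_⟩
  by_contra hne
  refine hφ ⟨(i, i'), hne⟩ ?_
  simpa [sub_eq_zero] using hi

/-- The edge `e` descends from its vertex `i`, with respect to the height function `f`. -/
def Edge.DescendsFrom (e : Edge inc) (f : ι → ℝ) (i : ι) : Prop :=
  i ∈ e.verts ∧ ∀ i' ∈ e.verts, f i' ≤ f i

open Classical in
/-- The number of edges of the facet `j` which descend from its vertex `i`, with respect to the
height function `f`. -/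
def downCount [Finite ι] [Finite κ] (inc : ι → κ → Prop) (f : ι → ℝ) (i : ι) (j : κ) : ℕ :=
  (Finset.univ.filter fun e : Edge inc => e.DescendsFrom f i ∧ j ∈ e.facets).card

/-- Every edge descends from exactly one vertex and lies in two facets. -/
lemma sum_downCount [Fintype ι] [Fintype κ] {f : ι → ℝ} (hf : Function.Injective f) :
    ∑ i, ∑ j, downCount inc f i j = 2 * Fintype.card (Edge inc) := by
  classical
  simp only [downCount, Finset.card_filter]
  have hswap : ∀ F : ι → κ → Edge inc → ℕ, ∑ i, ∑ j, ∑ e, F i j e = ∑ e, ∑ i, ∑ j, F i j e := by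
    intro F
    rw [Finset.sum_congr rfl fun i _ => Finset.sum_comm, Finset.sum_comm]
  rw [hswap, Finset.sum_const_nat (m := 2), Finset.card_univ, mul_comm]
  intro e _
  obtain ⟨i₀, hi₀, hmax⟩ := Finset.exists_max_image e.verts f
    (Finset.card_pos.1 (by rw [e.card_verts]; norm_num))
  rw [Finset.sum_eq_single i₀, ← Finset.card_filter, ← e.card_facets]
  · congr 1
    ext j
    simp only [Finset.mem_filter, Finset.mem_univ, true_and]
    exact ⟨fun hj => hj.2, fun hj => ⟨⟨hi₀, hmax⟩, hj⟩⟩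
  · intro i _ hi
    refine Finset.sum_eq_zero fun j _ => if_neg ?_
    rintro ⟨⟨hi1, hi2⟩, -⟩
    exact hi (hf (le_antisymm (hmax i hi1) (hi2 i₀ hi₀)))
  · simp

lemma downCount_eq_zero [Finite ι] [Finite κ] {f : ι → ℝ} {i : ι} {j : κ} (hij : ¬ inc i j) :
    downCount inc f i j = 0 := by
  classical
  rw [downCount, Finset.card_eq_zero, Finset.filter_eq_empty_iff]
  rintro e - ⟨⟨hi, -⟩, hj⟩
  exact hij (e.inc_of_mem hi hj)

lemma IsCorner.downCount_eq [Finite ι] [Finite κ] {f : ι → ℝ} (hf : Function.Injective f)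
    {i : ι} {j : κ} {i₁ i₂ : ι} {k₁ k₂ : κ} {e₁ e₂ : Edge inc}
    (hc : IsCorner inc i j i₁ i₂ k₁ k₂ e₁ e₂) :
    downCount inc f i j = (if f i₁ < f i then 1 else 0) + if f i₂ < f i then 1 else 0 := by
  classical
  have hset : (Finset.univ.filter fun e : Edge inc => e.DescendsFrom f i ∧ j ∈ e.facets) =
      ({e₁, e₂} : Finset (Edge inc)).filter fun e => ∀ i' ∈ e.verts, f i' ≤ f i := by
    ext e
    simp [← hc.edge_iff, Edge.DescendsFrom, and_right_comm]
  have key : ∀ {e : Edge inc} {i' : ι}, i' ≠ i → (∀ x, x ∈ e.verts ↔ x = i ∨ x = i') →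
      ((∀ x ∈ e.verts, f x ≤ f i) ↔ f i' < f i) := by
    intro e i' hne hv
    constructor
    · intro hle
      exact lt_of_le_of_ne (hle i' ((hv i').2 (.inr rfl))) (hf.ne hne)
    · intro hlt x hx
      rcases (hv x).1 hx with rfl | rfl
      exacts [le_rfl, hlt.le]
  rw [downCount, hset, Finset.card_filter, Finset.sum_pair hc.edge_ne]
  simp only [key hc.vertex_ne₁ hc.mem_verts₁, key hc.vertex_ne₂ hc.mem_verts₂]

namespace IsPolarPair

variable [FiniteDimensional ℝ E] [Nontrivial E] [Fintype ι] [Fintype κ]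
  (h : IsPolarPair inc V A) (hE : finrank ℝ E = 3) {c : E}
  (hc : Function.Injective fun i => ⟪c, V i⟫_ℝ)
include h hE hc

/-- A facet has two descending edges at its highest vertex only. -/
lemma downCount_eq_two_iff {i : ι} {j : κ} :
    downCount inc (fun i => ⟪c, V i⟫_ℝ) i j = 2 ↔
      inc i j ∧ ∀ i', inc i' j → ⟪c, V i'⟫_ℝ ≤ ⟪c, V i⟫_ℝ := by
  constructor
  · intro hd
    by_cases hij : inc i j
    swap
    · rw [downCount_eq_zero hij] at hd
      omega
    obtain ⟨i₁, i₂, k₁, k₂, e₁, e₂, hcor⟩ := h.exists_isCorner hE hij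
    rw [hcor.downCount_eq hc] at hd
    have h1 : ⟪c, V i₁⟫_ℝ < ⟪c, V i⟫_ℝ := by
      by_contra hn
      rw [if_neg hn] at hd
      split_ifs at hd <;> omega
    have h2 : ⟪c, V i₂⟫_ℝ < ⟪c, V i⟫_ℝ := by
      by_contra hn
      rw [if_neg hn] at hd
      split_ifs at hd
      omega
    refine ⟨hij, fun i' hi' => ?_⟩
    have hle : ∀ k, inc i k → ⟪A k, V i' - V i⟫_ℝ ≤ 0 := fun k hk => by
      rw [inner_sub_right, h.inner_eq hk]
      linarith [h.inner_le i' k]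
    obtain ⟨a, b, ha, hb, hab⟩ := h.exists_cone hE hcor (g := V i' - V i)
      (by rw [inner_sub_right, h.inner_eq hij, h.inner_eq hi', sub_self])
      (hle _ hcor.inc₀₁) (hle _ hcor.symm.inc₀₁)
    have := congrArg (fun x => ⟪c, x⟫_ℝ) hab
    simp only [inner_add_right, inner_smul_right, inner_sub_right] at this
    nlinarith [mul_nonneg ha (sub_nonneg.2 h1.le), mul_nonneg hb (sub_nonneg.2 h2.le)]
  · rintro ⟨hij, hmax⟩
    obtain ⟨i₁, i₂, k₁, k₂, e₁, e₂, hcor⟩ := h.exists_isCorner hE hij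
    rw [hcor.downCount_eq hc, if_pos, if_pos]
    · exact lt_of_le_of_ne (hmax i₂ hcor.symm.inc₁₀) (hc.ne hcor.vertex_ne₂)
    · exact lt_of_le_of_ne (hmax i₁ hcor.inc₁₀) (hc.ne hcor.vertex_ne₁)

lemma downCount_le_two (i : ι) (j : κ) : downCount inc (fun i => ⟪c, V i⟫_ℝ) i j ≤ 2 := by
  by_cases hij : inc i j
  · obtain ⟨i₁, i₂, k₁, k₂, e₁, e₂, hcor⟩ := h.exists_isCorner hE hij
    rw [hcor.downCount_eq hc]
    split_ifs <;> omega
  · rw [downCount_eq_zero hij]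
    omega

/-- A facet at a vertex has one ascending and one descending edge there exactly if the level plane
through the vertex meets the relative interior of the facet close to the vertex, that is, if
it contains a feasible direction along the facet. -/
lemma downCount_eq_one_iff {i : ι} {j : κ} :
    downCount inc (fun i => ⟪c, V i⟫_ℝ) i j = 1 ↔ inc i j ∧ ∃ g, g ≠ 0 ∧ ⟪c, g⟫_ℝ = 0 ∧
      ⟪A j, g⟫_ℝ = 0 ∧ ∀ l, inc i l → ⟪A l, g⟫_ℝ ≤ 0 := by
  by_cases hij : inc i j
  swap
  · simp [downCount_eq_zero hij, hij]
  obtain ⟨i₁, i₂, k₁, k₂, e₁, e₂, hcor⟩ := h.exists_isCorner hE hij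
  have hle : ∀ i' k, inc i k → ⟪A k, V i' - V i⟫_ℝ ≤ 0 := fun i' k hk => by
    rw [inner_sub_right, h.inner_eq hk]
    linarith [h.inner_le i' k]
  -- the level direction in the cone spanned by an ascending and a descending edge
  have mixed : ∀ {i₁ i₂ k₁ k₂ e₁ e₂}, IsCorner inc i j i₁ i₂ k₁ k₂ e₁ e₂ →
      ⟪c, V i₁⟫_ℝ < ⟪c, V i⟫_ℝ → ⟪c, V i⟫_ℝ < ⟪c, V i₂⟫_ℝ → ∃ g, g ≠ 0 ∧ ⟪c, g⟫_ℝ = 0 ∧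
      ⟪A j, g⟫_ℝ = 0 ∧ ∀ l, inc i l → ⟪A l, g⟫_ℝ ≤ 0 := by
    intro i₁ i₂ k₁ k₂ e₁ e₂ hcor h1 h2
    have h1' := sub_pos.2 h1
    have h2' := sub_pos.2 h2
    refine ⟨(⟪c, V i₂⟫_ℝ - ⟪c, V i⟫_ℝ) • (V i₁ - V i) +
      (⟪c, V i⟫_ℝ - ⟪c, V i₁⟫_ℝ) • (V i₂ - V i), fun h0 => ?_, ?_, ?_, fun l hl => ?_⟩
    · have := congrArg (fun x => ⟪A k₁, x⟫_ℝ) h0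
      simp only [inner_add_right, inner_smul_right, inner_zero_right] at this
      nlinarith [mul_neg_of_pos_of_neg h1' (h.inner_edge_neg hE hcor.symm),
        mul_nonpos_of_nonneg_of_nonpos h2'.le (hle i₁ k₁ hcor.inc₀₁)]
    · simp only [inner_add_right, inner_smul_right, inner_sub_right]
      ring
    · simp only [inner_add_right, inner_smul_right, inner_sub_right, h.inner_eq hij,
        h.inner_eq hcor.inc₁₀, h.inner_eq hcor.symm.inc₁₀]
      ring
    · rw [inner_add_right, inner_smul_right, inner_smul_right]
      exact add_nonpos (mul_nonpos_of_nonneg_of_nonpos h2'.le (hle _ _ hl))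
        (mul_nonpos_of_nonneg_of_nonpos h1'.le (hle _ _ hl))
  have hne₁ := hc.ne hcor.vertex_ne₁
  have hne₂ := hc.ne hcor.vertex_ne₂
  beta_reduce at hne₁ hne₂
  rw [hcor.downCount_eq hc]
  refine ⟨fun hd => ⟨hij, ?_⟩, ?_⟩
  · by_cases h1 : ⟪c, V i₁⟫_ℝ < ⟪c, V i⟫_ℝ
    · by_cases h2 : ⟪c, V i₂⟫_ℝ < ⟪c, V i⟫_ℝ
      · rw [if_pos h1, if_pos h2] at hd
        omega
      · exact mixed hcor h1 (lt_of_le_of_ne (not_lt.1 h2) hne₂.symm)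
    · by_cases h2 : ⟪c, V i₂⟫_ℝ < ⟪c, V i⟫_ℝ
      · exact mixed hcor.symm h2 (lt_of_le_of_ne (not_lt.1 h1) hne₁.symm)
      · rw [if_neg h1, if_neg h2] at hd
        omega
  · rintro ⟨-, g, hg0, hcg, hjg, hg⟩
    obtain ⟨a, b, ha, hb, hab⟩ := h.exists_cone hE hcor hjg (hg _ hcor.inc₀₁)
      (hg _ hcor.symm.inc₀₁)
    have hval : a * (⟪c, V i₁⟫_ℝ - ⟪c, V i⟫_ℝ) + b * (⟪c, V i₂⟫_ℝ - ⟪c, V i⟫_ℝ) = 0 := by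
      rw [← hcg, hab]
      simp only [inner_add_right, inner_smul_right, inner_sub_right]
    have hpos : 0 < a ∨ 0 < b := by
      by_contra! hcon
      obtain rfl : a = 0 := le_antisymm hcon.1 ha
      obtain rfl : b = 0 := le_antisymm hcon.2 hb
      exact hg0 (by simpa using hab)
    by_cases h1 : ⟪c, V i₁⟫_ℝ < ⟪c, V i⟫_ℝ
    · rw [if_pos h1, if_neg]
      intro h2
      rcases hpos with ha' | hb'
      · nlinarith [mul_pos ha' (sub_pos.2 h1), mul_nonneg hb (sub_pos.2 h2).le]
      · nlinarith [mul_nonneg ha (sub_pos.2 h1).le, mul_pos hb' (sub_pos.2 h2)]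
    · rw [if_neg h1, if_pos]
      by_contra h2
      have h1' := lt_of_le_of_ne (not_lt.1 h1) hne₁.symm
      have h2' := lt_of_le_of_ne (not_lt.1 h2) hne₂.symm
      rcases hpos with ha' | hb'
      · nlinarith [mul_pos ha' (sub_pos.2 h1'), mul_nonneg hb (sub_pos.2 h2').le]
      · nlinarith [mul_nonneg ha (sub_pos.2 h1').le, mul_pos hb' (sub_pos.2 h2')]

/-- The level plane through a vertex which is neither the highest nor the lowest one cuts exactly
two of its facets. -/
lemma card_downCount_eq_one {i : ι} (hmax : ∃ i', ⟪c, V i⟫_ℝ < ⟪c, V i'⟫_ℝ)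
    (hmin : ∃ i', ⟪c, V i'⟫_ℝ < ⟪c, V i⟫_ℝ) :
    (Finset.univ.filter fun j => downCount inc (fun i => ⟪c, V i⟫_ℝ) i j = 1).card = 2 := by
  classical
  have hc0 : c ≠ 0 := by
    rintro rfl
    obtain ⟨i', hi'⟩ := hmin
    simp at hi'
  -- a direction in the level plane from the vertex into the interior of the polytope
  obtain ⟨u, hcu, hu⟩ : ∃ u, ⟪c, u⟫_ℝ = 0 ∧ ∀ k, inc i k → ⟪A k, u⟫_ℝ < 0 := by
    obtain ⟨i', s, hs, hs'⟩ : ∃ i', ∃ s : ℝ, 0 ≤ s ∧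
        -⟪c, V i⟫_ℝ + s * (⟪c, V i'⟫_ℝ - ⟪c, V i⟫_ℝ) = 0 := by
      rcases le_total 0 ⟪c, V i⟫_ℝ with h0 | h0
      · obtain ⟨i', hi'⟩ := hmax
        have hpos := sub_pos.2 hi'
        refine ⟨i', ⟪c, V i⟫_ℝ / (⟪c, V i'⟫_ℝ - ⟪c, V i⟫_ℝ), div_nonneg h0 hpos.le, ?_⟩
        rw [div_mul_cancel₀ _ hpos.ne', neg_add_cancel]
      · obtain ⟨i', hi'⟩ := hmin
        have hneg := sub_neg.2 hi'
        refine ⟨i', ⟪c, V i⟫_ℝ / (⟪c, V i'⟫_ℝ - ⟪c, V i⟫_ℝ), div_nonneg_of_nonpos h0 hneg.le, ?_⟩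
        rw [div_mul_cancel₀ _ hneg.ne, neg_add_cancel]
    refine ⟨-V i + s • (V i' - V i), ?_, fun k hk => ?_⟩
    · rw [← hs', inner_add_right, inner_neg_right, inner_smul_right, inner_sub_right]
    · rw [inner_add_right, inner_neg_right, inner_smul_right, inner_sub_right, h.inner_eq hk]
      nlinarith [mul_nonneg hs (sub_nonneg.2 (h.inner_le i' k))]
  rw [← card_sides_eq_two hE hc0 (Finset.univ.filter fun k => inc i k) (p := A) hcu
    (fun k hk => hu k (by simpa using hk)) ?_ ?_, Finset.filter_filter]
  · congr 1
    ext j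
    simp only [Finset.mem_filter, Finset.mem_univ, true_and]
    exact h.downCount_eq_one_iff hE hc
  · intro g _ hg
    exact h.eq_zero_left i g fun k hk => hg k (by simpa using hk)
  · intro g hg0 hcg hgl k hk k' hk' hgk hgk'
    simp only [Finset.mem_filter, Finset.mem_univ, true_and] at hgl hk hk'
    by_contra hkk'
    obtain ⟨i', hi', hinc⟩ := h.exists_vertex_of_ray hg0 hgl
    obtain ⟨l, hl, hgl0⟩ : ∃ l, inc i l ∧ ⟪A l, g⟫_ℝ ≠ 0 := by
      by_contra! hcon
      exact hg0 (h.eq_zero_left i g hcon)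
    have hz := h.eq_zero_of_three hE (v := ⟪A l, V i' - V i⟫_ℝ • g - ⟪A l, g⟫_ℝ • (V i' - V i))
      hkk' (by rintro rfl; exact hgl0 hgk) (by rintro rfl; exact hgl0 hgk') hk hk' hl ?_ ?_ ?_
    · have := congrArg (fun x => ⟪c, x⟫_ℝ) hz
      simp only [inner_sub_right, inner_smul_right, hcg, inner_zero_right, mul_zero, zero_sub,
        neg_eq_zero, mul_eq_zero, hgl0, false_or, sub_eq_zero] at this
      exact hi' (hc this)
    · simp only [inner_sub_right, inner_smul_right, hgk, h.inner_eq hk, h.inner_eq (hinc k hk hgk)]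
      ring
    · simp only [inner_sub_right, inner_smul_right, hgk', h.inner_eq hk',
        h.inner_eq (hinc k' hk' hgk')]
      ring
    · simp only [inner_sub_right, inner_smul_right]
      ring

/-- From every vertex but the highest one, an edge ascends. -/
lemma exists_up {i : ι} (hmax : ∃ i', ⟪c, V i⟫_ℝ < ⟪c, V i'⟫_ℝ) :
    ∃ e : Edge inc, i ∈ e.verts ∧ ∃ i' ∈ e.verts, ⟪c, V i⟫_ℝ < ⟪c, V i'⟫_ℝ := by
  obtain ⟨j, hij, hd⟩ : ∃ j, inc i j ∧ downCount inc (fun i => ⟪c, V i⟫_ℝ) i j ≠ 2 := by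
    by_cases hmin : ∃ i', ⟪c, V i'⟫_ℝ < ⟪c, V i⟫_ℝ
    · obtain ⟨j, hj⟩ := Finset.card_pos.1
        ((h.card_downCount_eq_one hE hc hmax hmin).symm ▸ Nat.two_pos)
      rw [Finset.mem_filter] at hj
      exact ⟨j, ((h.downCount_eq_one_iff hE hc).1 hj.2).1, by omega⟩
    · push Not at hmin
      obtain ⟨j, hij⟩ := h.exists_inc_left i
      refine ⟨j, hij, fun hd => ?_⟩
      obtain ⟨i₁, i₂, k₁, k₂, e₁, e₂, hcor⟩ := h.exists_isCorner hE hij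
      exact hcor.vertex_ne₁ (hc (le_antisymm
        (((h.downCount_eq_two_iff hE hc).1 hd).2 i₁ hcor.inc₁₀) (hmin i₁)))
  obtain ⟨i₁, i₂, k₁, k₂, e₁, e₂, hcor⟩ := h.exists_isCorner hE hij
  have hne₁ := hc.ne hcor.vertex_ne₁
  have hne₂ := hc.ne hcor.vertex_ne₂
  beta_reduce at hne₁ hne₂
  by_cases h1 : ⟪c, V i₁⟫_ℝ < ⟪c, V i⟫_ℝ
  · by_cases h2 : ⟪c, V i₂⟫_ℝ < ⟪c, V i⟫_ℝ
    · rw [hcor.downCount_eq hc, if_pos h1, if_pos h2] at hd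
      exact absurd rfl hd
    · exact ⟨e₂, (hcor.mem_verts₂ i).2 (.inl rfl), i₂, (hcor.mem_verts₂ i₂).2 (.inr rfl),
        lt_of_le_of_ne (not_lt.1 h2) hne₂.symm⟩
  · exact ⟨e₁, (hcor.mem_verts₁ i).2 (.inl rfl), i₁, (hcor.mem_verts₁ i₁).2 (.inr rfl),
      lt_of_le_of_ne (not_lt.1 h1) hne₁.symm⟩

omit hc in
/-- **Euler's formula.** The number of pairs of a facet and a descending edge of it is `2 f₁`. The
highest vertices of the facets contribute `2 f₂`, and the facets cut by the level planes through the
vertices contribute `2 (f₀ - 2)`. -/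
theorem card_add_card_eq : Fintype.card ι + Fintype.card κ = Fintype.card (Edge inc) + 2 := by
  classical
  obtain ⟨c, hc⟩ := exists_injective_inner h.injective_left
  have := h.nonempty_left
  set f : ι → ℝ := fun i => ⟪c, V i⟫_ℝ with hf
  set D := downCount inc f with hD
  obtain ⟨imax, himax⟩ := Finite.exists_max f
  obtain ⟨imin, himin⟩ := Finite.exists_min f
  have hlt : f imin < f imax := by
    obtain ⟨j, hij⟩ := h.exists_inc_left imin
    obtain ⟨i₁, i₂, k₁, k₂, e₁, e₂, hcor⟩ := h.exists_isCorner hE hij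
    exact (lt_of_le_of_ne (himin i₁) (hc.ne hcor.vertex_ne₁.symm)).trans_le (himax i₁)
  have hone : ∀ i, (Finset.univ.filter fun j => D i j = 1).card =
      if i ∈ ({imin, imax} : Finset ι) then 0 else 2 := by
    intro i
    split_ifs with hi
    · rw [Finset.card_eq_zero, Finset.filter_eq_empty_iff]
      intro j _ hd
      have hij := ((h.downCount_eq_one_iff hE hc).1 hd).1
      rw [Finset.mem_insert, Finset.mem_singleton] at hi
      rcases hi with rfl | rfl
      · obtain ⟨i₁, i₂, k₁, k₂, e₁, e₂, hcor⟩ := h.exists_isCorner hE hij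
        rw [hD, hcor.downCount_eq hc, if_neg (himin i₁).not_gt, if_neg (himin i₂).not_gt] at hd
        omega
      · rw [hD, (h.downCount_eq_two_iff hE hc).2 ⟨hij, fun i' _ => himax i'⟩] at hd
        omega
    · simp only [Finset.mem_insert, Finset.mem_singleton, not_or] at hi
      exact h.card_downCount_eq_one hE hc ⟨imax, lt_of_le_of_ne (himax i) (hc.ne hi.2)⟩
        ⟨imin, lt_of_le_of_ne (himin i) (hc.ne (Ne.symm hi.1))⟩
  have htwo : ∀ j, (Finset.univ.filter fun i => D i j = 2).card = 1 := by
    intro j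
    obtain ⟨i₀, hi₀⟩ := h.exists_inc_right j
    obtain ⟨i, hi, him⟩ := Finset.exists_max_image (Finset.univ.filter fun i => inc i j) f
      ⟨i₀, by simpa using hi₀⟩
    simp only [Finset.mem_filter, Finset.mem_univ, true_and] at hi him
    rw [Finset.card_eq_one]
    refine ⟨i, Finset.ext fun i' => ?_⟩
    simp only [Finset.mem_filter, Finset.mem_univ, true_and, Finset.mem_singleton]
    rw [hD, h.downCount_eq_two_iff hE hc]
    constructor
    · rintro ⟨hi', hm'⟩
      exact hc (le_antisymm (him i' hi') (hm' i hi))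
    · rintro rfl
      exact ⟨hi, him⟩
  -- `∑ D` counts one descending edge for each facet cut by the level plane, and two at each top
  have hsplit : ∀ i j, D i j = (if D i j = 1 then 1 else 0) + 2 * if D i j = 2 then 1 else 0 := by
    intro i j
    have := h.downCount_le_two hE hc i j
    change D i j ≤ 2 at this
    interval_cases D i j <;> rfl
  have hsum := sum_downCount (inc := inc) hc
  change ∑ i, ∑ j, D i j = _ at hsum
  rw [Finset.sum_congr rfl fun i _ => Finset.sum_congr rfl fun j _ => hsplit i j] at hsum
  simp only [Finset.sum_add_distrib, ← Finset.mul_sum] at hsum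
  rw [Finset.sum_comm (f := fun i j => if D i j = 2 then 1 else 0)] at hsum
  simp only [← Finset.card_filter, hone, htwo, Finset.sum_const, Finset.card_univ,
    smul_eq_mul, mul_one] at hsum
  have hrest : (∑ i, if i ∈ ({imin, imax} : Finset ι) then 0 else 2) + 4 = 2 * Fintype.card ι := by
    have h4 : ∑ i, (if i ∈ ({imin, imax} : Finset ι) then 2 else 0) = 4 := by
      rw [Finset.sum_ite_mem, Finset.univ_inter, Finset.sum_const,
        Finset.card_pair (fun he => hlt.ne (congrArg f he)), smul_eq_mul]
    rw [← h4, ← Finset.sum_add_distrib, Finset.sum_congr rfl fun i _ => (by split_ifs <;> rfl :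
      _ = 2), Finset.sum_const, Finset.card_univ, smul_eq_mul, mul_comm]
  omega

end IsPolarPair

end Euler

/-! ### The boundary of a three-dimensional polytope as a quadrangulated sphere -/

section Sphere

variable {ι κ : Type*} {inc : ι → κ → Prop}
variable {E : Type*} [NormedAddCommGroup E] [InnerProductSpace ℝ E] {V : ι → E} {A : κ → E}

/-- An edge of the polar polytope as an edge of the polytope. -/
def Edge.ofSwap (e : Edge fun (j : κ) (i : ι) => inc i j) : Edge inc :=
  ⟨(e.facets, e.verts), e.card_facets, e.card_verts, fun _ hi _ hj => e.inc_of_mem hj hi⟩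

namespace IsPolarPair

variable [FiniteDimensional ℝ E] [Nontrivial E] [Fintype ι] [Fintype κ]
  (h : IsPolarPair inc V A) (hE : finrank ℝ E = 3)
include h hE

/-- The boundary of a facet is connected: along a generic height function, every vertex of the
facet but the highest one has a higher neighbour in the facet. -/
lemma eq_of_mem_facets {X : Type*} {g : Edge inc → X}
    (hg : ∀ i j e e', i ∈ e.verts → j ∈ e.facets → i ∈ e'.verts → j ∈ e'.facets → g e = g e')
    {j : κ} {e e' : Edge inc} (he : j ∈ e.facets) (he' : j ∈ e'.facets) : g e = g e' := by
  classical
  obtain ⟨c, hc⟩ := exists_injective_inner h.injective_left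
  obtain ⟨i₀, hi₀⟩ := h.exists_inc_right j
  obtain ⟨t, ht, htm⟩ := Finset.exists_max_image (Finset.univ.filter fun i => inc i j)
    (fun i => ⟪c, V i⟫_ℝ) ⟨i₀, by simpa using hi₀⟩
  simp only [Finset.mem_filter, Finset.mem_univ, true_and] at ht htm
  obtain ⟨_, _, _, _, e₀, _, hcor₀⟩ := h.exists_isCorner hE ht
  have hte : t ∈ e₀.verts ∧ j ∈ e₀.facets := (hcor₀.edge_iff e₀).2 (.inl rfl)
  have key : ∀ e : Edge inc, j ∈ e.facets → g e = g e₀ := by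
    by_contra! hcon
    obtain ⟨e, he, hne⟩ := hcon
    obtain ⟨x, hx⟩ := Finset.card_pos.1 (e.card_verts.symm ▸ Nat.two_pos)
    obtain ⟨i, hi, him⟩ := Finset.exists_max_image (Finset.univ.filter fun i =>
      ∃ e : Edge inc, i ∈ e.verts ∧ j ∈ e.facets ∧ g e ≠ g e₀) (fun i => ⟪c, V i⟫_ℝ)
      ⟨x, by simpa using ⟨e, hx, he, hne⟩⟩
    simp only [Finset.mem_filter, Finset.mem_univ, true_and] at hi him
    obtain ⟨e, hie, hje, hne⟩ := hi
    have hij := e.inc_of_mem hie hje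
    obtain ⟨i₁, i₂, k₁, k₂, e₁, e₂, hcor⟩ := h.exists_isCorner hE hij
    have hlow : ∀ {i₁ i₂ k₁ k₂ e₁ e₂}, IsCorner inc i j i₁ i₂ k₁ k₂ e₁ e₂ →
        ⟪c, V i₁⟫_ℝ < ⟪c, V i⟫_ℝ := by
      intro i₁ i₂ k₁ k₂ e₁ e₂ hcor
      have he₁ := (hcor.edge_iff e₁).2 (.inl rfl)
      refine lt_of_le_of_ne (him i₁ ⟨e₁, (hcor.mem_verts₁ i₁).2 (.inr rfl), he₁.2, ?_⟩)
        (hc.ne hcor.vertex_ne₁)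
      rwa [hg i j e₁ e he₁.1 he₁.2 hie hje]
    have htop := ((h.downCount_eq_two_iff hE hc).1
      (by rw [hcor.downCount_eq hc, if_pos (hlow hcor), if_pos (hlow hcor.symm)])).2
    obtain rfl : i = t := hc (le_antisymm (htm i hij) (htop t ht))
    exact hne (hg i j e e₀ hie hje hte.1 hte.2)
  rw [key e he, key e' he']

/-- The vertices, facets and edges of a three-dimensional polytope quadrangulate the sphere. -/
theorem isQuadrangulation :
    IsQuadrangulation inc (Edge.verts (inc := inc)) (Edge.facets (inc := inc)) where
  card_left := Edge.card_verts
  card_right := Edge.card_facets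
  inc_of_mem e _ hi _ hj := e.inc_of_mem hi hj
  card_corner i j hij := by
    classical
    obtain ⟨i₁, i₂, k₁, k₂, e₁, e₂, hcor⟩ := h.exists_isCorner hE hij
    rw [Finset.card_eq_two]
    refine ⟨e₁, e₂, hcor.edge_ne, Finset.ext fun e => ?_⟩
    simp [hcor.edge_iff]
  euler := h.card_add_card_eq hE
  conn_edge g hg := by
    classical
    -- along a generic height function on the polar, every facet but one has a higher neighbour
    obtain ⟨c, hc⟩ := exists_injective_inner h.injective_right
    obtain ⟨i₀⟩ := h.nonempty_left
    obtain ⟨j₀, hj₀⟩ := h.exists_inc_left i₀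
    have : Nonempty κ := ⟨j₀⟩
    obtain ⟨t, ht⟩ := Finite.exists_max fun j => ⟪c, A j⟫_ℝ
    obtain ⟨i, hi⟩ := h.exists_inc_right t
    obtain ⟨_, _, _, _, e₀, _, hcor₀⟩ := h.exists_isCorner hE hi
    have hte : t ∈ e₀.facets := ((hcor₀.edge_iff e₀).2 (.inl rfl)).2
    have key : ∀ e, g e = g e₀ := by
      by_contra! hcon
      obtain ⟨e, hne⟩ := hcon
      obtain ⟨x, hx⟩ := Finset.card_pos.1 (e.card_facets.symm ▸ Nat.two_pos)
      obtain ⟨j, hj, hjm⟩ := Finset.exists_max_image (Finset.univ.filter fun j =>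
        ∃ e : Edge inc, j ∈ e.facets ∧ g e ≠ g e₀) (fun j => ⟪c, A j⟫_ℝ)
        ⟨x, by simpa using ⟨e, hx, hne⟩⟩
      simp only [Finset.mem_filter, Finset.mem_univ, true_and] at hj hjm
      obtain ⟨e, hje, hne⟩ := hj
      have hjt : j ≠ t := by
        rintro rfl
        exact hne (h.eq_of_mem_facets hE hg hje hte)
      obtain ⟨e', hje', j', hj'e', hlt⟩ := h.swap.exists_up hE hc
        ⟨t, lt_of_le_of_ne (ht j) (hc.ne hjt)⟩
      refine (hjm j' ⟨e'.ofSwap, hj'e', ?_⟩).not_gt hlt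
      rwa [h.eq_of_mem_facets hE hg (e := e'.ofSwap) hje' hje]
    intro e e'
    rw [key e, key e']
  conn_node y hy := by
    classical
    obtain ⟨c, hc⟩ := exists_injective_inner h.injective_left
    have := h.nonempty_left
    obtain ⟨t, ht⟩ := Finite.exists_max fun i => ⟪c, V i⟫_ℝ
    have key : ∀ i, y (.inl i) = y (.inl t) := by
      by_contra! hcon
      obtain ⟨x, hx⟩ := hcon
      obtain ⟨i, hi, him⟩ := Finset.exists_max_image (Finset.univ.filter fun i =>
        y (.inl i) ≠ y (.inl t)) (fun i => ⟪c, V i⟫_ℝ) ⟨x, by simpa using hx⟩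
      simp only [Finset.mem_filter, Finset.mem_univ, true_and] at hi him
      have hit : i ≠ t := by
        rintro rfl
        exact hi rfl
      obtain ⟨e, hie, i', hi'e, hlt⟩ := h.exists_up hE hc ⟨t, lt_of_le_of_ne (ht i) (hc.ne hit)⟩
      obtain ⟨j, hj⟩ := Finset.card_pos.1 (e.card_facets.symm ▸ Nat.two_pos)
      refine (him i' ?_).not_gt hlt
      rwa [hy i' j (e.inc_of_mem hi'e hj), ← hy i j (e.inc_of_mem hie hj)]
    have key' : ∀ x, y x = y (.inl t) := by
      rintro (i | j)
      · exact key i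
      · obtain ⟨i, hi⟩ := h.exists_inc_right j
        rw [← hy i j hi, key]
    intro x x'
    rw [key' x, key' x']

/-- The normals of the facets and the vertices satisfy no common linear dependence: this is where
the planarity of the incidence graph enters. -/
theorem stress_eq_zero {σ : ι × κ → ℝ} (hσ : ∀ i j, σ (i, j) ≠ 0 → inc i j)
    (hA : ∀ i, ∑ j, σ (i, j) • A j = 0) (hV : ∀ j, ∑ i, σ (i, j) • V i = 0) : σ = 0 := by
  classical
  by_contra hne
  obtain ⟨p, hp⟩ := Function.ne_iff.1 hne
  obtain ⟨x, ⟨q, hq, hxq⟩, hle⟩ := (h.isQuadrangulation hE).exists_degree_le_three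
    (S := Finset.univ.filter fun p => σ p ≠ 0) ⟨p, by simpa using hp⟩
    fun p hp => hσ p.1 p.2 (by simpa using hp)
  have hq0 : σ q ≠ 0 := by simpa using hq
  rcases x with i | j
  · have hi : i = q.1 := by simpa [IsEnd] using hxq
    have h4 := h.four_le_card_dependence (w := fun j => σ (i, j)) (i := i)
      (fun h0 => hq0 (by simpa [hi] using congrFun h0 q.2)) (fun j => hσ i j) (hA i)
    refine absurd (h4.trans (Finset.card_le_card_of_injOn (fun j => (i, j)) ?_ ?_)) (by
      exact not_le.2 (Nat.lt_succ_of_le hle))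
    · intro j hj
      simpa [IsEnd] using hj
    · intro j _ j' _ hjj
      exact (Prod.ext_iff.1 hjj).2
  · have hj : j = q.2 := by simpa [IsEnd] using hxq
    have h4 := h.swap.four_le_card_dependence (w := fun i => σ (i, j)) (i := j)
      (fun h0 => hq0 (by simpa [hj] using congrFun h0 q.1)) (fun i => hσ i j) (hV j)
    refine absurd (h4.trans (Finset.card_le_card_of_injOn (fun i => (i, j)) ?_ ?_)) (by
      exact not_le.2 (Nat.lt_succ_of_le hle))
    · intro i hi
      simpa [IsEnd] using hi
    · intro i _ i' _ hii
      exact (Prod.ext_iff.1 hii).1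

end IsPolarPair

end Sphere

/-! ### The incidence equations -/

section Jacobian

variable {ι κ : Type*} {inc : ι → κ → Prop}
variable {E : Type*} [NormedAddCommGroup E] [InnerProductSpace ℝ E] {V : ι → E} {A : κ → E}

/-- The left hand sides of the equations `⟪A j, V i⟫ = 1`, one for each incidence. -/
def incidenceMap (inc : ι → κ → Prop) (q : (ι → E) × (κ → E))
    (p : {p : ι × κ // inc p.1 p.2}) : ℝ :=
  ⟪q.2 p.1.2, q.1 p.1.1⟫_ℝ

variable [Fintype ι] [Fintype κ] [Fintype {p : ι × κ // inc p.1 p.2}]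

lemma contDiff_incidenceMap :
    ContDiff ℝ ω (incidenceMap inc : (ι → E) × (κ → E) → {p : ι × κ // inc p.1 p.2} → ℝ) := by
  rw [contDiff_pi]
  intro p
  exact ContDiff.inner ℝ ((contDiff_apply ℝ E p.1.2).comp contDiff_snd)
    ((contDiff_apply ℝ E p.1.1).comp contDiff_fst)

lemma differentiable_incidenceMap :
    Differentiable ℝ (incidenceMap inc : (ι → E) × (κ → E) → {p : ι × κ // inc p.1 p.2} → ℝ) :=
  contDiff_incidenceMap.differentiable (by simp)

lemma fderiv_incidenceMap_apply (q v : (ι → E) × (κ → E)) (p : {p : ι × κ // inc p.1 p.2}) :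
    fderiv ℝ (incidenceMap inc) q v p =
      ⟪q.2 p.1.2, v.1 p.1.1⟫_ℝ + ⟪v.2 p.1.2, q.1 p.1.1⟫_ℝ := by
  have h1 := (hasFDerivAt_pi'.1 (differentiable_incidenceMap (inc := inc) q).hasFDerivAt) p
  have h2 : HasFDerivAt (fun q : (ι → E) × (κ → E) => q.2 p.1.2) _ q :=
    ((ContinuousLinearMap.proj (R := ℝ) (φ := fun _ : κ => E) p.1.2).comp
      (ContinuousLinearMap.snd ℝ (ι → E) (κ → E))).hasFDerivAt
  have h3 : HasFDerivAt (fun q : (ι → E) × (κ → E) => q.1 p.1.1) _ q :=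
    ((ContinuousLinearMap.proj (R := ℝ) (φ := fun _ : ι => E) p.1.1).comp
      (ContinuousLinearMap.fst ℝ (ι → E) (κ → E))).hasFDerivAt
  have h4 := h1.unique (h2.inner ℝ h3)
  simpa using congrArg (fun l => l v) h4

/-- The incidence equations of a three-dimensional polytope are independent to first order. -/
theorem IsPolarPair.surjective_fderiv_incidenceMap [FiniteDimensional ℝ E] [Nontrivial E]
    (h : IsPolarPair inc V A) (hE : finrank ℝ E = 3) :
    Function.Surjective (fderiv ℝ (incidenceMap inc) (V, A)) := by
  classical
  set D := fderiv ℝ (incidenceMap inc) (V, A) with hD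
  by_contra hns
  have hlt : D.range < ⊤ := lt_top_iff_ne_top.2 fun ht => hns (LinearMap.range_eq_top.1 ht)
  obtain ⟨φ, hφ, hker⟩ := Submodule.exists_le_ker_of_lt_top _ hlt
  -- the coefficients of a relation between the differentials
  let σ : ι × κ → ℝ := fun p => if hp : inc p.1 p.2 then φ (Pi.single ⟨p, hp⟩ 1) else 0
  have hσ : ∀ p, σ p ≠ 0 → inc p.1 p.2 := fun p hp => by
    by_contra hcon
    exact hp (dif_neg hcon)
  have hφσ : ∀ G : ι × κ → ℝ, φ (fun p => G p.1) = ∑ p, σ p * G p := by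
    intro G
    rw [LinearMap.pi_apply_eq_sum_univ φ]
    rw [← Finset.sum_filter_of_ne (p := fun p : ι × κ => inc p.1 p.2)
      (fun p _ hp => hσ p (left_ne_zero_of_mul hp)),
      Finset.sum_subtype (p := fun p : ι × κ => inc p.1 p.2) _ (by simp)]
    refine Finset.sum_congr rfl fun p _ => ?_
    rw [smul_eq_mul, mul_comm]
    congr 1
    simp only [σ, dif_pos p.2]
    congr 1
    ext x
    simp [Pi.single_apply, eq_comm]
  have hzero : ∀ v : (ι → E) × (κ → E),
      ∑ p : ι × κ, σ p * (⟪A p.2, v.1 p.1⟫_ℝ + ⟪v.2 p.2, V p.1⟫_ℝ) = 0 := by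
    intro v
    rw [← hφσ fun p => ⟪A p.2, v.1 p.1⟫_ℝ + ⟪v.2 p.2, V p.1⟫_ℝ]
    have := hker ⟨v, rfl⟩
    rw [LinearMap.mem_ker] at this
    convert this using 2
    ext p
    exact (fderiv_incidenceMap_apply (V, A) v p).symm
  have hσ0 : σ = 0 := by
    refine h.stress_eq_zero hE (fun i j => hσ (i, j)) (fun i => ?_) (fun j => ?_)
    · have := hzero (fun i => ∑ j, σ (i, j) • A j, 0)
      simp only [Pi.zero_apply, inner_zero_left, add_zero, Fintype.sum_prod_type,
        ← real_inner_smul_left, ← sum_inner] at this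
      exact inner_self_eq_zero.1 ((Finset.sum_eq_zero_iff_of_nonneg
        fun i _ => real_inner_self_nonneg).1 this i (Finset.mem_univ i))
    · have := hzero (0, fun j => ∑ i, σ (i, j) • V i)
      simp only [Pi.zero_apply, inner_zero_right, zero_add, Fintype.sum_prod_type_right,
        ← real_inner_smul_right, ← inner_sum] at this
      exact inner_self_eq_zero.1 ((Finset.sum_eq_zero_iff_of_nonneg
        fun i _ => real_inner_self_nonneg).1 this j (Finset.mem_univ j))
  refine hφ (LinearMap.pi_ext' fun p => LinearMap.ext_ring ?_)
  have := congrFun hσ0 p.1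
  simpa [σ, dif_pos p.2] using this

end Jacobian

/-! ### Counting faces -/

section Counting

lemma faceDim_convexHull_pair {d : ℕ} {x y : EuclideanSpace ℝ (Fin d)} (hxy : x ≠ y) :
    faceDim (convexHull ℝ {x, y}) = 1 := by
  have hne : (convexHull ℝ {x, y}).Nonempty := (Set.insert_nonempty _ _).convexHull
  rw [faceDim, if_pos hne, ← direction_affineSpan, affineSpan_convexHull, direction_affineSpan,
    vectorSpan_pair, finrank_span_singleton (vsub_ne_zero.2 hxy)]
  rfl

namespace IsPolarPair

variable {n m : ℕ} {inc : Fin n → Fin m → Prop} {V : Fin n → EuclideanSpace ℝ (Fin 3)}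
  {A : Fin m → EuclideanSpace ℝ (Fin 3)}

/-- The one-dimensional face spanned by an edge, cut out by its two facets. -/
def edgeFace (A : Fin m → EuclideanSpace ℝ (Fin 3)) (e : Edge inc) :
    Set (EuclideanSpace ℝ (Fin 3)) :=
  {x ∈ polarSet A | ∀ j ∈ (e.facets : Set (Fin m)), ⟪A j, x⟫_ℝ = 1}

lemma isExposed_edgeFace (e : Edge inc) : IsExposed ℝ (polarSet A) (edgeFace A e) :=
  isExposed_tight Subset.rfl _

variable (h : IsPolarPair inc V A)
include h

lemma mem_edgeFace {e : Edge inc} {i : Fin n} : V i ∈ edgeFace A e ↔ i ∈ e.verts := by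
  have hE : finrank ℝ (EuclideanSpace ℝ (Fin 3)) = 3 := by simp
  refine ⟨fun hi => ?_, fun hi => ⟨h.mem_polarSet i, fun j hj => h.inner_eq (e.inc_of_mem hi hj)⟩⟩
  have hinc : ∀ j ∈ e.facets, inc i j := fun j hj => (h.inner_eq_one_iff i j).1 (hi.2 j hj)
  by_contra hie
  obtain ⟨i₁, i₂, hne, hv⟩ := Finset.card_eq_two.1 e.card_verts
  obtain ⟨j₁, j₂, hne', hf⟩ := Finset.card_eq_two.1 e.card_facets
  have hi₁ : i₁ ∈ e.verts := by simp [hv]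
  have hi₂ : i₂ ∈ e.verts := by simp [hv]
  have hj₁ : j₁ ∈ e.facets := by simp [hf]
  have hj₂ : j₂ ∈ e.facets := by simp [hf]
  exact hne' (h.eq_of_three' hE hne (by rintro rfl; exact hie hi₁) (by rintro rfl; exact hie hi₂)
    (e.inc_of_mem hi₁ hj₂) (e.inc_of_mem hi₂ hj₂) (hinc _ hj₂) (e.inc_of_mem hi₁ hj₁)
    (e.inc_of_mem hi₂ hj₁) (hinc _ hj₁))

lemma faceDim_edgeFace (e : Edge inc) : faceDim (edgeFace A e) = 1 := by
  obtain ⟨i₁, i₂, hne, hv⟩ := Finset.card_eq_two.1 e.card_verts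
  have hset : {i | V i ∈ edgeFace A e} = {i₁, i₂} := by
    ext i
    simp [h.mem_edgeFace, hv]
  rw [h.eq_convexHull (isExposed_edgeFace e), hset, image_pair]
  exact faceDim_convexHull_pair (h.injective_left.ne hne)

lemma edgeFace_injective : Function.Injective (edgeFace A : Edge inc → _) := by
  have hE : finrank ℝ (EuclideanSpace ℝ (Fin 3)) = 3 := by simp
  intro e e' hee
  have hverts : ∀ i, i ∈ e.verts ↔ i ∈ e'.verts := fun i => by
    rw [← h.mem_edgeFace, ← h.mem_edgeFace, hee]
  have key : ∀ {e e' : Edge inc}, (∀ i, i ∈ e.verts ↔ i ∈ e'.verts) → ∀ j ∈ e.facets,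
      j ∈ e'.facets := by
    intro e e' hverts j hj
    by_contra hje
    obtain ⟨i₁, i₂, hne, hv⟩ := Finset.card_eq_two.1 e.card_verts
    obtain ⟨j₁, j₂, hne', hf⟩ := Finset.card_eq_two.1 e'.card_facets
    have hi₁ : i₁ ∈ e.verts := by simp [hv]
    have hi₂ : i₂ ∈ e.verts := by simp [hv]
    have hj₁ : j₁ ∈ e'.facets := by simp [hf]
    have hj₂ : j₂ ∈ e'.facets := by simp [hf]
    have hi₁' := (hverts i₁).1 hi₁
    have hi₂' := (hverts i₂).1 hi₂
    exact hne (h.eq_of_three hE hne' (by rintro rfl; exact hje hj₁) (by rintro rfl; exact hje hj₂)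
      (e'.inc_of_mem hi₂' hj₁) (e'.inc_of_mem hi₂' hj₂) (e.inc_of_mem hi₂ hj)
      (e'.inc_of_mem hi₁' hj₁) (e'.inc_of_mem hi₁' hj₂) (e.inc_of_mem hi₁ hj))
  exact Edge.ext' hverts fun j => ⟨key hverts j, key (fun i => (hverts i).symm) j⟩

lemma eq_of_forall_mem_iff {F F' : Set (EuclideanSpace ℝ (Fin 3))}
    (hF : IsExposed ℝ (polarSet A) F) (hF' : IsExposed ℝ (polarSet A) F')
    (hFF : ∀ i, V i ∈ F ↔ V i ∈ F') : F = F' := by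
  rw [h.eq_convexHull hF, h.eq_convexHull hF']
  simp only [hFF]

/-- The one-dimensional faces are those of the edges. -/
lemma range_edgeFace : range (edgeFace A : Edge inc → _) = facesOfDim (polarSet A) 1 := by
  have hE : finrank ℝ (EuclideanSpace ℝ (Fin 3)) = 3 := by simp
  refine Subset.antisymm ?_ ?_
  · rintro _ ⟨e, rfl⟩
    exact ⟨isExposed_edgeFace e, h.faceDim_edgeFace e⟩
  rintro F ⟨hF, hd⟩
  have hF : IsExposed ℝ (polarSet A) F := hF
  have hhull := h.eq_convexHull hF
  have hclosed := h.isClosedVertexSet hF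
  have hne : F.Nonempty := faceDim_nonneg_iff.1 (by rw [hd]; norm_num)
  obtain ⟨i, hi⟩ : {i | V i ∈ F}.Nonempty := by
    rw [hhull, convexHull_nonempty_iff, image_nonempty] at hne
    exact hne
  obtain ⟨i', hi', hne'⟩ : ∃ i', V i' ∈ F ∧ i' ≠ i := by
    by_contra! hcon
    have hs : {i | V i ∈ F} = {i} := by
      ext x
      exact ⟨fun hx => hcon x hx, fun hx => by rw [mem_singleton_iff.1 hx]; exact hi⟩
    rw [hs, image_singleton, convexHull_singleton] at hhull
    have := faceDim_eq_zero_iff.2 ⟨_, hhull⟩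
    rw [hd] at this
    norm_num at this
  obtain ⟨j, hj⟩ : ∃ j, ∀ x, V x ∈ F → inc x j := by
    by_contra! hcon
    have huniv : {i | V i ∈ F} = univ := eq_univ_of_forall fun x =>
      hclosed x fun j hj => by
        obtain ⟨y, hy, hyj⟩ := hcon j
        exact absurd (hj y hy) hyj
    rw [huniv, image_univ, h.hull] at hhull
    have := faceDim_eq_of_zero_mem_interior (zero_mem_interior_polarSet A)
    rw [← hhull, hd] at this
    norm_num at this
  obtain ⟨j', hj', hjj⟩ : ∃ j', (∀ x, V x ∈ F → inc x j') ∧ j' ≠ j := by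
    by_contra! hcon
    have hfac : F = {x ∈ polarSet A | ⟪A j, x⟫_ℝ = 1} := by
      refine h.eq_of_forall_mem_iff hF (isExposed_facet j) fun x =>
        ⟨fun hx => ⟨h.mem_polarSet x, h.inner_eq (hj x hx)⟩, fun hx => hclosed x fun l hl => ?_⟩
      rw [hcon l hl]
      exact (h.inner_eq_one_iff x j).1 hx.2
    have := (h.facet_mem_facesOfDim j).2
    rw [← hfac, hd] at this
    norm_num at this
  obtain ⟨e, hv, -⟩ := exists_edge hne' hjj (hj i hi) (hj' i hi) (hj i' hi') (hj' i' hi')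
  refine ⟨e, h.eq_of_forall_mem_iff (isExposed_edgeFace e) hF fun x => ?_⟩
  rw [h.mem_edgeFace, hv]
  constructor
  · rintro (rfl | rfl) <;> assumption
  · intro hx
    by_contra! hcon
    exact hjj (h.eq_of_three' hE hne'.symm hcon.1.symm hcon.2.symm (hj i hi) (hj i' hi') (hj x hx)
      (hj' i hi) (hj' i' hi') (hj' x hx))

lemma fNum_one : fNum (polarSet A) 1 = Fintype.card (Edge inc) := by
  rw [fNum, ← h.range_edgeFace, ← image_univ, ncard_image_of_injective _ h.edgeFace_injective,
    ncard_univ, Nat.card_eq_fintype_card]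

end IsPolarPair

open Classical in
lemma LabeledPolytope.naturalGuess_eq {d n m : ℕ} (P : LabeledPolytope d n m) :
    naturalGuess P.carrier =
      d * ((n : ℤ) + m) - Fintype.card {p : Fin n × Fin m // P.Inc p.1 p.2} := by
  have hv : Function.Injective fun i => ({P.vertex i} : Set (EuclideanSpace ℝ (Fin d))) :=
    fun i i' hii => P.vertex_injective (singleton_injective hii)
  have h0 : fNum P.carrier 0 = n := by
    rw [fNum, ← P.range_vertex, ← image_univ, ncard_image_of_injective _ hv, ncard_univ]
    simp
  have h2 : fNum P.carrier (d - 1) = m := by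
    rw [fNum, ← P.range_facet, ← image_univ, ncard_image_of_injective _ P.facet_injective,
      ncard_univ]
    simp
  have h02 : flagNum P.carrier 0 (d - 1) = Fintype.card {p : Fin n × Fin m // P.Inc p.1 p.2} := by
    rw [flagNum, ← P.range_vertex, ← P.range_facet, ← Nat.card_eq_fintype_card, ← ncard_univ,
      ← ncard_image_of_injective univ (f := fun p : {p : Fin n × Fin m // P.Inc p.1 p.2} =>
        (({P.vertex p.1.1} : Set (EuclideanSpace ℝ (Fin d))), P.facet p.1.2))]
    · congr 1
      ext ⟨F, G⟩
      simp only [mem_ofPred_eq, mem_range, image_univ, Prod.mk.injEq, Subtype.exists, Prod.exists]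
      constructor
      · rintro ⟨⟨i, rfl⟩, ⟨j, rfl⟩, hs⟩
        exact ⟨i, j, singleton_subset_iff.1 hs, rfl, rfl⟩
      · rintro ⟨i, j, hij, rfl, rfl⟩
        exact ⟨⟨i, rfl⟩, ⟨j, rfl⟩, singleton_subset_iff.2 hij⟩
    · rintro ⟨⟨i, j⟩, hp⟩ ⟨⟨i', j'⟩, hp'⟩ hpp
      obtain ⟨h1, h2⟩ := Prod.mk.inj hpp
      obtain rfl := hv h1
      obtain rfl := P.facet_injective h2
      rfl
  rw [naturalGuess, h0, h2, h02]

end Counting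

end Polytopes

end

open Polytopes Module Filter

theorem mainTheorem9 {n m : ℕ} (P : Polytopes.LabeledPolytope 3 n m) :
    P.centeredRealizationSpace.Nonempty ∧
    Polytopes.IsSmoothSubmanifold P.centeredRealizationSpace
      (Polytopes.fNum P.carrier 1 + 6) ∧
    Polytopes.naturalGuess P.carrier = (Polytopes.fNum P.carrier 1 : ℤ) + 6 := by
  classical
  have hE : finrank ℝ (EuclideanSpace ℝ (Fin 3)) = 3 := by simp
  obtain ⟨Q, hQP, hnum, V, A, hQ, h⟩ := P.exists_realization
  have hmem : ∀ q, q ∈ P.centeredRealizationSpace ↔ IsPolarPair P.Inc q.1 q.2 :=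
    fun q => LabeledPolytope.mem_centeredRealizationSpace_iff hQP hQ
  have hedge : fNum P.carrier 1 = Fintype.card (Edge P.Inc) := by
    rw [← hnum, hQ.2.1]
    exact h.fNum_one
  have heuler := h.card_add_card_eq hE
  have hcorner := (h.isQuadrangulation hE).card_corners
  rw [Fintype.card_fin, Fintype.card_fin] at heuler
  refine ⟨⟨(V, A), (hmem _).2 h⟩, ?_, ?_⟩
  · refine isSmoothSubmanifold_of_levelSet (f := incidenceMap P.Inc)
      (f' := fderiv ℝ (incidenceMap P.Inc)) 1 contDiff_incidenceMap ?_
      (fun q _ => (differentiable_incidenceMap q).hasFDerivAt)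
      (fun q hq => ((hmem q).1 hq).surjective_fderiv_incidenceMap hE) fun q hq => ?_
    · rw [finrank_prod, finrank_pi_fintype, finrank_pi_fintype, finrank_fintype_fun_eq_card,
        hcorner, hedge]
      simp only [hE, Finset.sum_const, Finset.card_univ, Fintype.card_fin, smul_eq_mul]
      omega
    · filter_upwards [((hmem q).1 hq).eventually] with q' hq'
      rw [hmem]
      refine ⟨fun hp => funext fun p => hp.inner_eq p.2, fun hp => hq' fun i j hij => ?_⟩
      exact congrFun hp ⟨(i, j), hij⟩
  · rw [P.naturalGuess_eq, hcorner, hedge]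
    push_cast
    omega
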